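/- Let $d\ge 3$ be an integer, $2<\gamma<\min\{4,d\}$, and let $V:\mathbb R^d\to\mathbb R$. Put $C_d=\Gamma(d/2)/\big((d-2)\,2\pi^{d/2}\big)$, $V_-=\min\{V,0\}$, and define the Kato norm $$\|V\|_{\mathcal K}=\sup_{x\in\mathbb R^d}\int_{\mathbb R^d}\frac{|V(y)|}{|x-y|^{d-2}}\,dy .$$ Let $\mathcal K_0$ be the closure, with respect to $\|\cdot\|_{\mathcal K}$, of the bounded measurable functions with compact support. Assume $$V\in\mathcal K_0\cap L^{d/2}(\mathbb R^d)\qquad\text{and}\qquad \|V_-\|_{\mathcal K}<\frac1{C_d}.$$ For $u\in H^1(\mathbb R^d)=H^1(\mathbb R^d;\mathbb C)$ write $$\|u\|_{\dot H^1_V}^2=\int|\nabla u|^2dx+\int V|u|^2dx,\qquad P(u)=\int(|\cdot|^{-\gamma}*|u|^2)|u|^2dx,$$ and, for $u\neq0$ (as an element of $H^1$), $$W(u)=\frac{P(u)}{\|u\|_{\dot H^1_V}^{\gamma}\,\|u\|_{L^2}^{4-\gamma}} .$$ (i) Suppose $V_-=0$ almost everywhere. The equation $$\Delta Q-Q+(|\cdot|^{-\gamma}*|Q|^2)Q=0$$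 has a ground state, that is, a nonzero $H^1$ weak solution which minimizes the action $\frac12\|\nabla u\|_{L^2}^2+\frac12\|u\|_{L^2}^2-\frac14P(u)$ among all nonzero $H^1$ weak solutions $u$. For every ground state $Q$ and every sequence $(z_n)_{n\in\mathbb N}$ in $\mathbb R^d$ with $|z_n|\to\infty$ (for instance $z_n=ne$ with a fixed vector $e\ne0$), the sequence of translates $Q(\cdot-z_n)$ is a maximizing sequence for $W$: the supremum of $W$ over $H^1(\mathbb R^d)\setminus\{0\}$ is finite, and $W(Q(\cdot-z_n))$ converges to it as $n\to\infty$. (ii) Suppose $V_-$ is not almost everywhere $0$. Then there are $\mathcal Q\in H^1(\mathbb R^d)\setminus\{0\}$ and $\omega>0$ such that $W(u)\le W(\mathcal Q)$ for all $u\in H^1(\mathbb R^d)\setminus\{0\}$, and such that $\mathcal Q$ solves $$(-\Delta+V)\mathcal Q+\omega^2\mathcal Q-(|\cdot|^{-\gamma}*|\mathcal Q|^2)\mathcal Q=0,\qquad \omega^2=\frac{(4-\gamma)\,\|\mathcal Q\|_{\dot H^1_V}^2}{\gamma\,\|\mathcal Q\|_{L^2}^2},$$ in the weak $H^1$ sense.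 -/

import Mathlib

open MeasureTheory Filter Topology
open scoped ENNReal ContDiff ComplexConjugate

noncomputable section

namespace Hartree

/-- The Euclidean space `ℝᵈ`. -/
abbrev E (d : ℕ) : Type := EuclideanSpace ℝ (Fin d)

variable {d : ℕ}

/-! ### The Sobolev space `H¹(ℝᵈ; ℂ)` through weak derivatives -/

/-- `g` is a weak `i`-th partial derivative of `u`:
`∫ u ∂ᵢφ = - ∫ g φ` for every test function `φ ∈ C_c^∞(ℝᵈ)`. -/
def IsWeakPartial (i : Fin d) (u g : E d → ℂ) : Prop :=
  ∀ φ : E d → ℝ, ContDiff ℝ ∞ φ → HasCompactSupport φ →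
    ∫ x, u x * ((fderiv ℝ φ x (EuclideanSpace.single i 1) : ℝ) : ℂ) = -∫ x, g x * (φ x : ℂ)

/-- `u ∈ H¹(ℝᵈ)`: `u` is in `L²` and has all its weak first partial derivatives in `L²`. -/
def MemH1 (u : E d → ℂ) : Prop :=
  MemLp u 2 volume ∧ ∀ i : Fin d, ∃ g : E d → ℂ, MemLp g 2 volume ∧ IsWeakPartial i u g

open Classical in
/-- The weak partial derivative `∂ᵢu` (a representative of the unique `L²` class; `0` if
there is none). -/
def weakPartial (i : Fin d) (u : E d → ℂ) : E d → ℂ :=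
  if h : ∃ g : E d → ℂ, MemLp g 2 volume ∧ IsWeakPartial i u g then h.choose else 0

/-- `‖∇u‖²_{L²}`. -/
def gradSq (u : E d → ℂ) : ℝ := ∑ i : Fin d, ∫ x, ‖weakPartial i u x‖ ^ 2

/-- `‖u‖²_{L²}`. -/
def massSq (u : E d → ℂ) : ℝ := ∫ x, ‖u x‖ ^ 2

/-- `‖u‖²_{Ḣ¹_V} = ∫ |∇u|² + ∫ V |u|²`. -/
def energySq (V : E d → ℝ) (u : E d → ℂ) : ℝ := gradSq u + ∫ x, V x * ‖u x‖ ^ 2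

/-! ### The Hartree nonlinearity -/

/-- `(|·|^{-γ} ∗ |u|²)(x)`. -/
def hartreePotential (γ : ℝ) (u : E d → ℂ) (x : E d) : ℝ := ∫ y, ‖u y‖ ^ 2 / ‖x - y‖ ^ γ

/-- `P(u) = ∫ (|·|^{-γ} ∗ |u|²) |u|²`. -/
def P (γ : ℝ) (u : E d → ℂ) : ℝ := ∫ x, hartreePotential γ u x * ‖u x‖ ^ 2

/-- `W(u) = P(u) / (‖u‖_{Ḣ¹_V}^γ ‖u‖_{L²}^{4-γ})`. -/
def W (γ : ℝ) (V : E d → ℝ) (u : E d → ℂ) : ℝ :=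
  P γ u / (√(energySq V u) ^ γ * √(massSq u) ^ (4 - γ))

/-- `u ∈ H¹ \ {0}`, where `0` is the zero class for almost everywhere equality. -/
def NonzeroH1 (u : E d → ℂ) : Prop := MemH1 u ∧ ¬ u =ᵐ[volume] 0

/-- `u` is a maximizer of `W` over `H¹ \ {0}`. -/
def IsMaximizer (γ : ℝ) (V : E d → ℝ) (u : E d → ℂ) : Prop :=
  NonzeroH1 u ∧ ∀ v : E d → ℂ, NonzeroH1 v → W γ V v ≤ W γ V u

/-- `u : ℕ → H¹ \ {0}` is a maximizing sequence of `W`: the supremum of `W` over `H¹ \ {0}`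
is finite and `W (u n)` converges to it. -/
def IsMaximizingSeq (γ : ℝ) (V : E d → ℝ) (u : ℕ → E d → ℂ) : Prop :=
  (∀ n, NonzeroH1 (u n)) ∧
    ∃ c : ℝ, IsLUB (W γ V '' {v : E d → ℂ | NonzeroH1 v}) c ∧
      Tendsto (fun n => W γ V (u n)) atTop (𝓝 c)

/-- `u ∈ H¹` is a weak solution of `(-Δ + V) u + a u - (|·|^{-γ} ∗ |u|²) u = 0`
(tested against all of `H¹`). -/
def IsWeakSolution (γ : ℝ) (V : E d → ℝ) (a : ℝ) (u : E d → ℂ) : Prop :=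
  MemH1 u ∧ ∀ φ : E d → ℂ, MemH1 φ →
    (∑ i : Fin d, ∫ x, weakPartial i u x * conj (weakPartial i φ x))
      + (∫ x, (V x : ℂ) * u x * conj (φ x))
      + (a : ℂ) * (∫ x, u x * conj (φ x))
      - (∫ x, (hartreePotential γ u x : ℂ) * u x * conj (φ x)) = 0

/-- The action `½‖∇u‖² + ½‖u‖² - ¼P(u)` of the equation `ΔQ - Q + (|·|^{-γ} ∗ |Q|²) Q = 0`. -/
def freeAction (γ : ℝ) (u : E d → ℂ) : ℝ :=
  1 / 2 * gradSq u + 1 / 2 * massSq u - 1 / 4 * P γ u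

/-- `Q` is a ground state of `ΔQ - Q + (|·|^{-γ} ∗ |Q|²) Q = 0`: a nonzero `H¹` solution of
least action among all nonzero `H¹` solutions. -/
def IsFreeGroundState (γ : ℝ) (Q : E d → ℂ) : Prop :=
  IsWeakSolution γ 0 1 Q ∧ ¬ Q =ᵐ[volume] 0 ∧
    ∀ v : E d → ℂ, IsWeakSolution γ 0 1 v → ¬ v =ᵐ[volume] 0 → freeAction γ Q ≤ freeAction γ v

/-! ### Kato potentials -/

/-- The Kato norm `sup_x ∫ |V(y)| / |x - y|^{d-2} dy`, with values in `[0, ∞]`. -/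
def katoNorm (V : E d → ℝ) : ℝ≥0∞ := ⨆ x : E d, ∫⁻ y, ‖V y‖ₑ / ‖x - y‖ₑ ^ (d - 2)

/-- `V ∈ 𝒦₀`, the closure in the Kato norm of the bounded compactly supported
(measurable) functions. -/
def MemKato0 (V : E d → ℝ) : Prop :=
  ∀ ε : ℝ≥0∞, 0 < ε → ∃ U : E d → ℝ,
    Measurable U ∧ (∃ C : ℝ, ∀ x, |U x| ≤ C) ∧ HasCompactSupport U ∧ katoNorm (V - U) < ε

/-- The negative part `V₋ = min {V, 0}`. -/
def negPart (V : E d → ℝ) : E d → ℝ := fun x => min (V x) 0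

/-- `C_d = Γ(d/2) / ((d - 2) 2 π^{d/2})`, so that `C_d |x|^{2-d}` is the fundamental solution
of `-Δ` on `ℝᵈ`. -/
def newtonConst (d : ℕ) : ℝ :=
  Real.Gamma ((d : ℝ) / 2) / (((d : ℝ) - 2) * 2 * Real.pi ^ ((d : ℝ) / 2))

/-- The standing assumptions on the potential: `V ∈ 𝒦₀ ∩ L^{d/2}` and `‖V₋‖_𝒦 < 1 / C_d`. -/
def IsAdmissible (V : E d → ℝ) : Prop :=
  MemKato0 V ∧ MemLp V ((d : ℝ≥0∞) / 2) volume ∧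
    katoNorm (negPart V) < ENNReal.ofReal (1 / newtonConst d)

end Hartree

end

/-!
The theorem compares two sharp constants. Write `g`, `m`, `E_V` for `‖∇u‖²`, `‖u‖²` and
`‖u‖²_{Ḣ¹_V}`. Let `S₀` be the best constant in `P ≤ S₀ √g^γ √m^{4-γ}` and `S_V` the best constant
with `E_V` in place of `g`, that is, the supremum of `W`.

*The free problem.* By the inequality of arithmetic and geometric means and a dilation, optimizing
`P / (√g^γ √m^{4-γ})` is the same as optimizing `P / (g + m)²`. A maximizing sequence of the latter,
suitably translated, keeps a fixed amount of mass in a ball (`exists_ball_mass_ge`), so it has a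
nonzero weak limit `w`, and `g`, `m` and `P` split into the contributions of `w` and of the
remainder (`exists_profile`). Since `P` is quadratic in the normalization, splitting is strictly
disadvantageous (`profile_eq_of_split`), and `w` is an optimizer. An optimizer of the right
amplitude solves the equation (`isWeakSolution_of_forall_P_le`, by differentiating along lines, on which `P`
is a quartic polynomial), and by the Nehari identity the ground states are optimizers
(`exists_groundState`, `exists_free_constant`).

*Nonnegative potentials.* Here `E_V ≥ g`, so `S_V ≤ S₀`. The potential energy of translates that
escape to infinity tends to zero (`tendsto_integral_pot_translate`), so a ground state recovers
`S₀` along them (`isMaximizingSeq_translate`).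

*Potentials with a negative part.* The Kato condition makes `E_V` coercive. Let `p_t` be the heat
kernel and `w ≥ 0` a bounded weight whose Newton potential `∫₀^∞ p_s * w ds` is at most `κ`. This
Newton potential is a supersolution of the heat semigroup, and the ground state transform gives
`∫ w |u|² ≤ κ g` (`lintegral_mul_le_of_newtonPot_le`). Hence
`∫ |V₋| |u|² ≤ C_d ‖V₋‖_𝒦 g` with `C_d ‖V₋‖_𝒦 < 1`. If `V₋ ≠ 0`, some dilated and translated copy
of a ground state has negative potential energy (`exists_integral_pot_neg`), so `S_V > S₀`
(`free_constant_lt`). Normalize a maximizing sequence by dilation and translation to `E = m = 1`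
with mass kept in a fixed ball; the potential becomes `r_n² V(r_n x + b_n)`. If `r_n → 0`,
`r_n → ∞` or `|b_n| → ∞`, the rescaled potentials act negligibly on any fixed function
(`exists_rescale_small`), and the splitting argument would give `S_V ≤ S₀` (`le_of_escape`).
Otherwise scales and centres stay bounded along a subsequence, and the same argument applied to the
original sequence yields a maximizer (`exists_maximizer_of_local`). The inequality of arithmetic and
geometric means, now weighted so that equality holds at the maximizer, turns the sharp inequality
into `P ≤ k (E_V + a m)²`, whose Euler–Lagrange equation is the one claimed, with `a = ω²`
(`exists_solution_of_maximizer`).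
-/

open MeasureTheory Filter Topology
open scoped ENNReal ContDiff ComplexConjugate

noncomputable section

namespace Hartree

variable {d : ℕ}

/-! ### Weak gradients -/

/-- `G` is a family of weak partial derivatives of `u`, with `u` and all the `G i` in `L²`. -/
def HasGrad (u : E d → ℂ) (G : Fin d → E d → ℂ) : Prop :=
  MemLp u 2 volume ∧ ∀ i, MemLp (G i) 2 volume ∧ IsWeakPartial i u (G i)

lemma testFun_memLp {φ : E d → ℝ} (hφ : Continuous φ) (hc : HasCompactSupport φ) (p : ℝ≥0∞) :
    MemLp (fun x => (φ x : ℂ)) p volume := by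
  refine Continuous.memLp_of_hasCompactSupport (by fun_prop) ?_
  exact hc.comp_left (g := fun t : ℝ => (t : ℂ)) (by simp)

lemma testFun_fderiv_memLp {φ : E d → ℝ} (hφ : ContDiff ℝ ∞ φ) (hc : HasCompactSupport φ)
    (v : E d) (p : ℝ≥0∞) :
    MemLp (fun x => ((fderiv ℝ φ x v : ℝ) : ℂ)) p volume := by
  refine testFun_memLp ?_ ?_ p
  · exact (hφ.continuous_fderiv (by simp)).clm_apply continuous_const
  · exact hc.fderiv_apply (𝕜 := ℝ) v

lemma integrable_mul_of_memLp {u v : E d → ℂ} (hu : MemLp u 2 volume) (hv : MemLp v 2 volume) :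
    Integrable (fun x => u x * v x) := hu.integrable_mul hv

lemma IsWeakPartial.ae_unique {i : Fin d} {u g h : E d → ℂ} (hg : MemLp g 2 volume)
    (hh : MemLp h 2 volume) (h1 : IsWeakPartial i u g) (h2 : IsWeakPartial i u h) :
    g =ᵐ[volume] h := by
  refine ae_eq_of_integral_contDiff_smul_eq (hg.locallyIntegrable (by norm_num))
    (hh.locallyIntegrable (by norm_num)) fun φ hφ hc => ?_
  have := (h1 φ hφ hc).symm.trans (h2 φ hφ hc)
  simpa [mul_comm] using neg_injective this

lemma MemH1.hasGrad {u : E d → ℂ} (hu : MemH1 u) : HasGrad u (fun i => weakPartial i u) := by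
  refine ⟨hu.1, fun i => ?_⟩
  have h := hu.2 i
  simp only [weakPartial, dif_pos h]
  exact h.choose_spec

lemma HasGrad.memH1 {u : E d → ℂ} {G : Fin d → E d → ℂ} (h : HasGrad u G) : MemH1 u :=
  ⟨h.1, fun i => ⟨G i, h.2 i⟩⟩

lemma HasGrad.weakPartial_ae {u : E d → ℂ} {G : Fin d → E d → ℂ} (h : HasGrad u G) (i : Fin d) :
    weakPartial i u =ᵐ[volume] G i :=
  (h.memH1.hasGrad.2 i).2.ae_unique (h.memH1.hasGrad.2 i).1 (h.2 i).1 (h.2 i).2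

lemma massSq_congr {u v : E d → ℂ} (h : u =ᵐ[volume] v) : massSq u = massSq v :=
  integral_congr_ae (h.mono fun x hx => by simp only [hx])

lemma gradSq_eq_sum (u : E d → ℂ) : gradSq u = ∑ i, massSq (weakPartial i u) := rfl

lemma HasGrad.gradSq_eq {u : E d → ℂ} {G : Fin d → E d → ℂ} (h : HasGrad u G) :
    gradSq u = ∑ i, massSq (G i) :=
  Finset.sum_congr rfl fun i _ => massSq_congr (h.weakPartial_ae i)

lemma HasGrad.congr {u v : E d → ℂ} {G : Fin d → E d → ℂ} (h : HasGrad u G)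
    (huv : u =ᵐ[volume] v) : HasGrad v G := by
  refine ⟨(memLp_congr_ae huv).1 h.1, fun i => ⟨(h.2 i).1, fun φ hφ hc => ?_⟩⟩
  rw [← (h.2 i).2 φ hφ hc]
  exact integral_congr_ae (huv.mono fun x hx => by simp only [hx])

lemma HasGrad.add {u v : E d → ℂ} {G H : Fin d → E d → ℂ} (hu : HasGrad u G) (hv : HasGrad v H) :
    HasGrad (u + v) (fun i => G i + H i) := by
  refine ⟨hu.1.add hv.1, fun i => ⟨(hu.2 i).1.add (hv.2 i).1, fun φ hφ hc => ?_⟩⟩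
  have e1 := (hu.2 i).2 φ hφ hc
  have e2 := (hv.2 i).2 φ hφ hc
  have k0 := testFun_memLp hφ.continuous hc 2
  have k1 := testFun_fderiv_memLp hφ hc (EuclideanSpace.single i 1) 2
  simp only [Pi.add_apply, add_mul]
  rw [integral_add (integrable_mul_of_memLp hu.1 k1) (integrable_mul_of_memLp hv.1 k1),
    integral_add (integrable_mul_of_memLp (hu.2 i).1 k0) (integrable_mul_of_memLp (hv.2 i).1 k0),
    e1, e2]
  ring

lemma HasGrad.const_smul {u : E d → ℂ} {G : Fin d → E d → ℂ} (hu : HasGrad u G) (c : ℂ) :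
    HasGrad (c • u) (fun i => c • G i) := by
  refine ⟨hu.1.const_smul c, fun i => ⟨(hu.2 i).1.const_smul c, fun φ hφ hc => ?_⟩⟩
  have e1 := (hu.2 i).2 φ hφ hc
  simp only [Pi.smul_apply, smul_eq_mul, mul_assoc]
  rw [integral_const_mul, integral_const_mul, e1]
  ring

lemma HasGrad.sub {u v : E d → ℂ} {G H : Fin d → E d → ℂ} (hu : HasGrad u G) (hv : HasGrad v H) :
    HasGrad (u - v) (fun i => G i - H i) := by
  have := hu.add (hv.const_smul (-1))
  simpa [sub_eq_add_neg] using this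

lemma MemH1.add {u v : E d → ℂ} (hu : MemH1 u) (hv : MemH1 v) : MemH1 (u + v) :=
  (hu.hasGrad.add hv.hasGrad).memH1

lemma MemH1.sub {u v : E d → ℂ} (hu : MemH1 u) (hv : MemH1 v) : MemH1 (u - v) :=
  (hu.hasGrad.sub hv.hasGrad).memH1

lemma MemH1.const_smul {u : E d → ℂ} (hu : MemH1 u) (c : ℂ) : MemH1 (c • u) :=
  (hu.hasGrad.const_smul c).memH1

lemma massSq_nonneg (u : E d → ℂ) : 0 ≤ massSq u := integral_nonneg fun _ => by positivity

lemma gradSq_nonneg (u : E d → ℂ) : 0 ≤ gradSq u := Finset.sum_nonneg fun _ _ => massSq_nonneg _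

lemma integrable_sq_of_memLp {u : E d → ℂ} (hu : MemLp u 2 volume) :
    Integrable (fun x => ‖u x‖ ^ 2) := hu.integrable_norm_pow (by norm_num)

lemma lintegral_enorm_sq {u : E d → ℂ} (hu : MemLp u 2 volume) :
    ∫⁻ x, ‖u x‖ₑ ^ 2 = ENNReal.ofReal (massSq u) := by
  rw [massSq, ofReal_integral_eq_lintegral_ofReal (integrable_sq_of_memLp hu)
    (ae_of_all _ fun _ => by positivity)]
  refine lintegral_congr fun x => ?_
  rw [ENNReal.ofReal_pow (norm_nonneg _), ofReal_norm]

lemma massSq_smul (c : ℂ) (u : E d → ℂ) : massSq (c • u) = ‖c‖ ^ 2 * massSq u := by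
  simp only [massSq, Pi.smul_apply, smul_eq_mul, norm_mul, mul_pow]
  rw [integral_const_mul]

lemma gradSq_smul {u : E d → ℂ} (hu : MemH1 u) (c : ℂ) :
    gradSq (c • u) = ‖c‖ ^ 2 * gradSq u := by
  rw [(hu.hasGrad.const_smul c).gradSq_eq, hu.hasGrad.gradSq_eq, Finset.mul_sum]
  exact Finset.sum_congr rfl fun i _ => massSq_smul _ _

lemma massSq_add_eq {u v : E d → ℂ} (hu : MemLp u 2 volume) (hv : MemLp v 2 volume) :
    massSq (u + v) = massSq u + massSq v + 2 * (∫ x, u x * conj (v x)).re := by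
  have hc : MemLp (fun x => conj (v x)) 2 volume := hv.star
  have hi := integrable_mul_of_memLp hu hc
  have e : (∫ x, u x * conj (v x)).re = ∫ x, (u x * conj (v x)).re :=
    (integral_re hi).symm
  rw [e, massSq, massSq, massSq, ← integral_const_mul,
    ← integral_add (integrable_sq_of_memLp hu) (integrable_sq_of_memLp hv)]
  erw [← integral_add ((integrable_sq_of_memLp hu).add (integrable_sq_of_memLp hv))
      (hi.re.const_mul 2)]
  refine integral_congr_ae (ae_of_all _ fun x => ?_)
  simp only [Pi.add_apply, ← Complex.normSq_eq_norm_sq, Complex.normSq_add]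
  rfl

lemma massSq_add_le {u v : E d → ℂ} (hu : MemLp u 2 volume) (hv : MemLp v 2 volume) :
    massSq (u + v) ≤ 2 * massSq u + 2 * massSq v := by
  simp only [massSq]
  rw [← integral_const_mul, ← integral_const_mul, ← integral_add
    ((integrable_sq_of_memLp hu).const_mul 2) ((integrable_sq_of_memLp hv).const_mul 2)]
  refine integral_mono (integrable_sq_of_memLp (hu.add hv))
    (((integrable_sq_of_memLp hu).const_mul 2).add ((integrable_sq_of_memLp hv).const_mul 2))
    fun x => ?_
  simp only [Pi.add_apply]
  nlinarith [norm_add_le (u x) (v x), norm_nonneg (u x + v x), sq_nonneg (‖u x‖ - ‖v x‖)]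

lemma massSq_neg (u : E d → ℂ) : massSq (-u) = massSq u := by simp [massSq]

lemma massSq_sub_le {u v : E d → ℂ} (hu : MemLp u 2 volume) (hv : MemLp v 2 volume) :
    massSq (u - v) ≤ 2 * massSq u + 2 * massSq v := by
  rw [sub_eq_add_neg, ← massSq_neg v]; exact massSq_add_le hu hv.neg

lemma gradSq_add_le {u v : E d → ℂ} (hu : MemH1 u) (hv : MemH1 v) :
    gradSq (u + v) ≤ 2 * gradSq u + 2 * gradSq v := by
  rw [(hu.hasGrad.add hv.hasGrad).gradSq_eq, hu.hasGrad.gradSq_eq, hv.hasGrad.gradSq_eq,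
    Finset.mul_sum, Finset.mul_sum, ← Finset.sum_add_distrib]
  exact Finset.sum_le_sum fun i _ => massSq_add_le (hu.hasGrad.2 i).1 (hv.hasGrad.2 i).1

lemma gradSq_sub_le {u v : E d → ℂ} (hu : MemH1 u) (hv : MemH1 v) :
    gradSq (u - v) ≤ 2 * gradSq u + 2 * gradSq v := by
  rw [(hu.hasGrad.sub hv.hasGrad).gradSq_eq, hu.hasGrad.gradSq_eq, hv.hasGrad.gradSq_eq,
    Finset.mul_sum, Finset.mul_sum, ← Finset.sum_add_distrib]
  exact Finset.sum_le_sum fun i _ => massSq_sub_le (hu.hasGrad.2 i).1 (hv.hasGrad.2 i).1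

lemma massSq_pos {u : E d → ℂ} (hu : NonzeroH1 u) : 0 < massSq u := by
  refine lt_of_le_of_ne (massSq_nonneg u) fun h => hu.2 ?_
  have := (integral_eq_zero_iff_of_nonneg (fun x => by positivity)
    (integrable_sq_of_memLp hu.1.1)).1 h.symm
  filter_upwards [this] with x hx
  simpa using hx

/-! ### Affine changes of variables -/

lemma integral_comp_affine {F : Type*} [NormedAddCommGroup F] [NormedSpace ℝ F] (f : E d → F)
    {r : ℝ} (hr : 0 < r) (b : E d) :
    ∫ x, f (r • x + b) = (r ^ d)⁻¹ • ∫ x, f x := by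
  have h := Measure.integral_comp_smul (volume : Measure (E d)) (fun x => f (x + b)) r
  rw [h, integral_add_right_eq_self f b]
  simp [abs_of_pos hr]

lemma memLp_comp_affine {F : Type*} [NormedAddCommGroup F] {p : ℝ≥0∞} {f : E d → F}
    (hf : MemLp f p volume)
    {r : ℝ} (hr : 0 < r) (b : E d) : MemLp (fun x => f (r • x + b)) p volume := by
  have hm : Measurable (fun x : E d => r • x + b) := by fun_prop
  have hmap : Measure.map (fun x : E d => r • x + b) volume
      = ENNReal.ofReal ((r ^ d)⁻¹) • (volume : Measure (E d)) := by
    have e : (fun x : E d => r • x + b) = (fun x => x + b) ∘ (fun x => r • x) := rfl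
    rw [e, ← Measure.map_map (by fun_prop) (by fun_prop),
      Measure.map_addHaar_smul _ hr.ne', Measure.map_smul, map_add_right_eq_self]
    simp [abs_of_pos hr]
  have : MemLp f p (Measure.map (fun x : E d => r • x + b) volume) := by
    rw [hmap]; exact hf.smul_measure ENNReal.ofReal_ne_top
  exact (memLp_map_measure_iff this.1 hm.aemeasurable).1 this

lemma massSq_comp_affine (u : E d → ℂ) {r : ℝ} (hr : 0 < r) (b : E d) :
    massSq (fun x => u (r • x + b)) = (r ^ d)⁻¹ * massSq u := by
  simpa [massSq] using integral_comp_affine (fun x => ‖u x‖ ^ 2) hr b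

lemma HasGrad.comp_affine {u : E d → ℂ} {G : Fin d → E d → ℂ} (h : HasGrad u G) {r : ℝ}
    (hr : 0 < r) (b : E d) :
    HasGrad (fun x => u (r • x + b)) (fun i x => (r : ℂ) * G i (r • x + b)) := by
  refine ⟨memLp_comp_affine h.1 hr b, fun i =>
    ⟨(memLp_comp_affine (h.2 i).1 hr b).const_mul _, fun φ hφ hc => ?_⟩⟩
  -- the test function is pulled back by the inverse affine map
  set ψ : E d → ℝ := fun y => φ (r⁻¹ • (y - b)) with hψ
  have hψd : ContDiff ℝ ∞ ψ := by
    rw [hψ]; fun_prop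
  have hψc : HasCompactSupport ψ := by
    have := hc.comp_homeomorph ((Homeomorph.subRight b).trans
      (Homeomorph.smulOfNeZero (r⁻¹) (inv_ne_zero hr.ne')))
    exact this
  have hinv : ∀ x : E d, r⁻¹ • (r • x + b - b) = x := fun x => by
    rw [add_sub_cancel_right, smul_smul, inv_mul_cancel₀ hr.ne', one_smul]
  have hf : ∀ x, fderiv ℝ φ x (EuclideanSpace.single i 1)
      = r * fderiv ℝ ψ (r • x + b) (EuclideanSpace.single i 1) := by
    intro x
    have e1 : HasFDerivAt (fun y : E d => r⁻¹ • (y - b)) (r⁻¹ • ContinuousLinearMap.id ℝ (E d))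
        (r • x + b) := ((hasFDerivAt_id _).sub_const b).const_smul r⁻¹
    have e2 : HasFDerivAt φ (fderiv ℝ φ x) (r⁻¹ • (r • x + b - b)) := by
      rw [hinv]; exact (hφ.differentiable (by simp) x).hasFDerivAt
    have := (e2.comp (r • x + b) e1).fderiv
    have e3 : fderiv ℝ ψ (r • x + b) = (fderiv ℝ φ x).comp (r⁻¹ • ContinuousLinearMap.id ℝ (E d)) :=
      this
    rw [e3]
    simp
    field_simp
  have hq : ∀ x, φ x = ψ (r • x + b) := fun x => by simp only [hψ, hinv]
  have key := (h.2 i).2 ψ hψd hψc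
  have l := integral_comp_affine
    (fun y => u y * ((r * fderiv ℝ ψ y (EuclideanSpace.single i 1) : ℝ) : ℂ)) hr b
  have l' := integral_comp_affine (fun y => (r : ℂ) * G i y * (ψ y : ℂ)) hr b
  simp only [hf]
  rw [l]
  simp only [hq]
  rw [l', ← smul_neg]
  congr 1
  have : ∀ y, u y * ((r * fderiv ℝ ψ y (EuclideanSpace.single i 1) : ℝ) : ℂ)
      = r * (u y * ((fderiv ℝ ψ y (EuclideanSpace.single i 1) : ℝ) : ℂ)) := fun y => by
    push_cast; ring
  simp only [this, mul_assoc]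
  rw [integral_const_mul, integral_const_mul, key]
  ring

lemma MemH1.comp_affine {u : E d → ℂ} (hu : MemH1 u) {r : ℝ} (hr : 0 < r) (b : E d) :
    MemH1 (fun x => u (r • x + b)) := (hu.hasGrad.comp_affine hr b).memH1

lemma gradSq_comp_affine {u : E d → ℂ} (hu : MemH1 u) {r : ℝ} (hr : 0 < r) (b : E d) :
    gradSq (fun x => u (r • x + b)) = (r ^ d)⁻¹ * (r ^ 2 * gradSq u) := by
  rw [(hu.hasGrad.comp_affine hr b).gradSq_eq, hu.hasGrad.gradSq_eq, Finset.mul_sum,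
    Finset.mul_sum]
  refine Finset.sum_congr rfl fun i _ => ?_
  have := massSq_smul (r : ℂ) (fun x => weakPartial i u (r • x + b))
  rw [massSq_comp_affine _ hr b] at this
  have e : massSq (fun x => (r : ℂ) * weakPartial i u (r • x + b))
    = massSq ((r : ℂ) • fun x => weakPartial i u (r • x + b)) := rfl
  rw [e, this]
  simp
  ring

/-! ### Mollification and density of test functions -/

/-- `k` is a probability density. -/
structure IsDensity (k : E d → ℝ) : Prop where
  meas : Measurable k
  nonneg : ∀ x, 0 ≤ k x
  lintegral_eq_one : ∫⁻ x, ENNReal.ofReal (k x) = 1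

/-- Jensen's inequality for an average against a probability density. Nothing has to be assumed
about the integrability of `F`: if the right side is finite, `F` is integrable. -/
lemma IsDensity.enorm_avg_sub_sq_le {k : E d → ℝ} (hk : IsDensity k) {F : E d → ℂ}
    (hF : AEStronglyMeasurable F volume) (c : ℂ) :
    ‖(∫ h, (k h : ℂ) * F h) - c‖ₑ ^ 2 ≤ ∫⁻ h, ENNReal.ofReal (k h) * ‖F h - c‖ₑ ^ 2 := by
  set ν := volume.withDensity (fun h => ENNReal.ofReal (k h)) with hν
  have hkm : Measurable (fun h => ENNReal.ofReal (k h)) := hk.meas.ennreal_ofReal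
  have : IsProbabilityMeasure ν := ⟨by rw [hν, withDensity_apply _ .univ]; simpa using
    hk.lintegral_eq_one⟩
  have hac : ν ≪ volume := withDensity_absolutelyContinuous _ _
  have hFν : AEStronglyMeasurable (fun h => F h - c) ν :=
    (hF.mono_ac hac).sub aestronglyMeasurable_const
  have e1 : ∫⁻ h, ENNReal.ofReal (k h) * ‖F h - c‖ₑ ^ 2 = ∫⁻ h, ‖F h - c‖ₑ ^ 2 ∂ν := by
    rw [hν, lintegral_withDensity_eq_lintegral_mul₀ hkm.aemeasurable]
    · rfl
    · exact (hF.sub aestronglyMeasurable_const).enorm.pow_const 2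
  have e2 : ∫ h, (k h : ℂ) * F h = ∫ h, F h ∂ν := by
    rw [hν, integral_withDensity_eq_integral_toReal_smul hkm
      (ae_of_all _ fun _ => ENNReal.ofReal_lt_top)]
    refine integral_congr_ae (ae_of_all _ fun h => ?_)
    simp [ENNReal.toReal_ofReal (hk.nonneg h)]
  rw [e1, e2]
  have h2 : (∫⁻ h, ‖F h - c‖ₑ ^ 2 ∂ν) = eLpNorm (fun h => F h - c) 2 ν ^ 2 := by
    rw [eLpNorm_eq_lintegral_rpow_enorm_toReal (by norm_num) (by norm_num)]
    simp only [ENNReal.toReal_ofNat, one_div, ENNReal.rpow_ofNat]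
    rw [← ENNReal.rpow_ofNat, ← ENNReal.rpow_mul]
    simp
  have h1 : eLpNorm (fun h => F h - c) 1 ν ≤ eLpNorm (fun h => F h - c) 2 ν :=
    eLpNorm_le_eLpNorm_of_exponent_le (by norm_num) hFν
  by_cases hfin : eLpNorm (fun h => F h - c) 2 ν = ⊤
  · rw [h2, hfin]; simp
  have hint : Integrable (fun h => F h - c) ν :=
    memLp_one_iff_integrable.1 ⟨hFν, h1.trans_lt (lt_top_iff_ne_top.2 hfin)⟩
  have hFint : Integrable F ν := by
    have := hint.add (integrable_const c)
    rwa [show (fun h => F h - c) + (fun _ => c) = F from funext fun h => by simp] at this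
  have e3 : (∫ h, F h ∂ν) - c = ∫ h, (F h - c) ∂ν := by
    rw [integral_sub hFint (integrable_const c)]; simp
  rw [e3, h2]
  gcongr
  exact (enorm_integral_le_lintegral_enorm _).trans (by simpa [eLpNorm_one_eq_lintegral_enorm] using h1)

lemma aestronglyMeasurable_comp_sub {F : Type*} [TopologicalSpace F]
    [TopologicalSpace.PseudoMetrizableSpace F] {f : E d → F}
    (hf : AEStronglyMeasurable f volume) (x : E d) :
    AEStronglyMeasurable (fun h => f (x - h)) volume :=
  hf.comp_quasiMeasurePreserving (quasiMeasurePreserving_sub_left volume x)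

lemma aestronglyMeasurable_sub_prod {F : Type*} [TopologicalSpace F]
    [TopologicalSpace.PseudoMetrizableSpace F] {f : E d → F}
    (hf : AEStronglyMeasurable f volume) :
    AEStronglyMeasurable (fun z : E d × E d => f (z.1 - z.2)) (volume.prod volume) :=
  hf.comp_quasiMeasurePreserving (quasiMeasurePreserving_sub_of_right_invariant volume volume)

lemma IsDensity.lintegral_avg_sub_sq_le {k : E d → ℝ} (hk : IsDensity k) {f : E d → ℂ}
    (hf : AEStronglyMeasurable f volume) :
    ∫⁻ x, ‖(∫ h, (k h : ℂ) * f (x - h)) - f x‖ₑ ^ 2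
      ≤ ∫⁻ h, ENNReal.ofReal (k h) * ∫⁻ x, ‖f (x - h) - f x‖ₑ ^ 2 := by
  calc _ ≤ ∫⁻ x, ∫⁻ h, ENNReal.ofReal (k h) * ‖f (x - h) - f x‖ₑ ^ 2 :=
        lintegral_mono fun x => hk.enorm_avg_sub_sq_le (aestronglyMeasurable_comp_sub hf x) _
    _ = ∫⁻ h, ∫⁻ x, ENNReal.ofReal (k h) * ‖f (x - h) - f x‖ₑ ^ 2 := by
        refine lintegral_lintegral_swap ?_
        have h1 : AEMeasurable (fun z : E d × E d => ENNReal.ofReal (k z.2)) (volume.prod volume) :=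
          (hk.meas.ennreal_ofReal.comp measurable_snd).aemeasurable
        exact h1.mul (((aestronglyMeasurable_sub_prod hf).sub hf.comp_fst).enorm.pow_const 2)
    _ = _ := by
        refine lintegral_congr fun h => ?_
        rw [lintegral_const_mul'']
        exact ((hf.comp_quasiMeasurePreserving
          (measurePreserving_sub_right volume h).quasiMeasurePreserving).sub hf).enorm.pow_const 2

lemma eLpNorm_two_sq {α F : Type*} [MeasurableSpace α] {μ : Measure α} [NormedAddCommGroup F]
    (f : α → F) : eLpNorm f 2 μ ^ 2 = ∫⁻ x, ‖f x‖ₑ ^ 2 ∂μ := by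
  rw [eLpNorm_eq_lintegral_rpow_enorm_toReal (by norm_num) (by norm_num)]
  simp only [ENNReal.toReal_ofNat, one_div, ENNReal.rpow_ofNat]
  rw [← ENNReal.rpow_ofNat, ← ENNReal.rpow_mul]
  simp

/-- Translations are continuous in `L²`. -/
lemma exists_translation_le {f : E d → ℂ} (hf : MemLp f 2 volume) {ε : ℝ≥0∞} (hε : 0 < ε) :
    ∃ δ > 0, ∀ h : E d, ‖h‖ < δ → ∫⁻ x, ‖f (x - h) - f x‖ₑ ^ 2 ≤ ε := by
  let T : C(E d, C(E d, E d)) := ContinuousMap.curry ⟨fun z => z.2 - z.1, by fun_prop⟩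
  have hT : ∀ h, MeasurePreserving (T h) volume volume := fun h =>
    measurePreserving_sub_right volume h
  have hcont : Continuous fun h => Lp.compMeasurePreserving (T h) (hT h) (hf.toLp f) :=
    continuous_const.compMeasurePreservingLp T.continuous hT (by norm_num)
  have h0 : Tendsto (fun h => edist (Lp.compMeasurePreserving (T h) (hT h) (hf.toLp f))
      (hf.toLp f) ^ 2) (𝓝 0) (𝓝 0) := by
    have e0 : Lp.compMeasurePreserving (T 0) (hT 0) (hf.toLp f) = hf.toLp f := by
      rw [Lp.toLp_compMeasurePreserving]
      congr 1
      ext x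
      simp [T]
    have h1 := (hcont.edist (continuous_const (y := hf.toLp f))).tendsto 0
    simp only [e0, edist_self] at h1
    simpa [Function.comp_def] using (ENNReal.continuous_pow 2).continuousAt.tendsto.comp h1
  have h2 := h0.eventually (ge_mem_nhds hε)
  obtain ⟨δ, hδ, hh⟩ := Metric.eventually_nhds_iff.1 h2
  refine ⟨δ, hδ, fun h hn => ?_⟩
  have := hh (y := h) (by simpa using hn)
  rw [Lp.toLp_compMeasurePreserving, Lp.edist_toLp_toLp, eLpNorm_two_sq] at this
  simpa [T] using this

/-- Complex valued smooth functions with compact support. -/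
def IsTest (φ : E d → ℂ) : Prop := ContDiff ℝ ∞ φ ∧ HasCompactSupport φ

lemma isWeakPartial_of_contDiff (i : Fin d) {u : E d → ℂ} (hu : ContDiff ℝ 1 u) :
    IsWeakPartial i u (fun x => fderiv ℝ u x (EuclideanSpace.single i 1)) := by
  intro φ hφ hc
  set g : E d → ℂ := fun x => (φ x : ℂ) with hg
  have hgc : HasCompactSupport g := hc.comp_left (g := fun t : ℝ => (t : ℂ)) (by simp)
  have hgd : ContDiff ℝ ∞ g := Complex.ofRealCLM.contDiff.comp hφ
  have hfd : ∀ x, fderiv ℝ g x (EuclideanSpace.single i 1)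
      = ((fderiv ℝ φ x (EuclideanSpace.single i 1) : ℝ) : ℂ) := by
    intro x
    have := (Complex.ofRealCLM.hasFDerivAt.comp x
      (hφ.differentiable (by simp) x).hasFDerivAt).fderiv
    have e : fderiv ℝ g x = Complex.ofRealCLM.comp (fderiv ℝ φ x) := this
    rw [e]; rfl
  have c1 : Continuous fun x => fderiv ℝ u x (EuclideanSpace.single i 1) :=
    (hu.continuous_fderiv (by simp)).clm_apply continuous_const
  have c2 : Continuous fun x => fderiv ℝ g x (EuclideanSpace.single i 1) :=
    (hgd.continuous_fderiv (by simp)).clm_apply continuous_const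
  have key := integral_mul_fderiv_eq_neg_fderiv_mul_of_integrable (μ := (volume : Measure (E d)))
    (f := u) (g := g) (v := EuclideanSpace.single i 1)
    ((c1.mul hgd.continuous).integrable_of_hasCompactSupport hgc.mul_left)
    ((hu.continuous.mul c2).integrable_of_hasCompactSupport (hgc.fderiv_apply (𝕜 := ℝ) _).mul_left)
    ((hu.continuous.mul hgd.continuous).integrable_of_hasCompactSupport hgc.mul_left)
    (fun x _ => hu.differentiable (by simp) x) (fun x _ => hgd.differentiable (by simp) x)
  simpa only [hfd] using key

lemma IsTest.hasGrad {φ : E d → ℂ} (h : IsTest φ) :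
    HasGrad φ (fun i x => fderiv ℝ φ x (EuclideanSpace.single i 1)) :=
  ⟨h.1.continuous.memLp_of_hasCompactSupport h.2, fun i =>
    ⟨((h.1.continuous_fderiv (by simp)).clm_apply continuous_const).memLp_of_hasCompactSupport
      (h.2.fderiv_apply (𝕜 := ℝ) _), isWeakPartial_of_contDiff i (h.1.of_le (by simp))⟩⟩

lemma massSq_le_of_lintegral_le {f : E d → ℂ} {C : ℝ} (hC : 0 ≤ C)
    (hf : MemLp f 2 volume) (h : ∫⁻ x, ‖f x‖ₑ ^ 2 ≤ ENNReal.ofReal C) : massSq f ≤ C := by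
  rw [lintegral_enorm_sq hf] at h
  exact (ENNReal.ofReal_le_ofReal_iff hC).1 h

lemma memLp_two_of_lintegral_lt_top {f : E d → ℂ} (hf : AEStronglyMeasurable f volume)
    (h : ∫⁻ x, ‖f x‖ₑ ^ 2 < ⊤) : MemLp f 2 volume := by
  refine ⟨hf, ?_⟩
  rw [← eLpNorm_two_sq] at h
  exact lt_top_iff_ne_top.2 fun h' => by simp [h'] at h

/-- Mollification: an `H¹` function is approximated by smooth functions whose classical partial
derivatives are the mollified weak derivatives. -/
lemma MemH1.exists_smooth_approx {u : E d → ℂ} (hu : MemH1 u) {ε : ℝ} (hε : 0 < ε) :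
    ∃ v : E d → ℂ, ContDiff ℝ ∞ v ∧
      HasGrad v (fun i x => fderiv ℝ v x (EuclideanSpace.single i 1)) ∧
      massSq (v - u) ≤ ε ∧ ∀ i, massSq ((fun x => fderiv ℝ v x (EuclideanSpace.single i 1))
        - weakPartial i u) ≤ ε := by
  have hε' : 0 < ENNReal.ofReal ε := ENNReal.ofReal_pos.2 hε
  obtain ⟨δ₀, hδ₀, H₀⟩ := exists_translation_le hu.1 hε'
  have hG := hu.hasGrad
  choose δ₁ hδ₁ H₁ using fun i => exists_translation_le (hG.2 i).1 hε'
  obtain ⟨δ, hδ, hδle⟩ : ∃ δ > 0, δ ≤ δ₀ ∧ ∀ i, δ ≤ δ₁ i := by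
    rcases isEmpty_or_nonempty (Fin d) with h | h
    · exact ⟨δ₀, hδ₀, le_rfl, fun i => h.elim i⟩
    · exact ⟨min δ₀ (Finset.univ.inf' Finset.univ_nonempty δ₁),
        lt_min hδ₀ ((Finset.lt_inf'_iff _).2 fun i _ => hδ₁ i), min_le_left _ _,
        fun i => (min_le_right _ _).trans (Finset.inf'_le _ (Finset.mem_univ i))⟩
  let b : ContDiffBump (0 : E d) := ⟨δ / 2, δ, by positivity, by linarith⟩
  set k : E d → ℝ := b.normed volume with hkdef
  have kd : ContDiff ℝ ∞ k := b.contDiff_normed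
  have kc : HasCompactSupport k := b.hasCompactSupport_normed
  have hk : IsDensity k := by
    refine ⟨kd.continuous.measurable, b.nonneg_normed, ?_⟩
    rw [← ofReal_integral_eq_lintegral_ofReal
      (kd.continuous.integrable_of_hasCompactSupport kc) (ae_of_all _ b.nonneg_normed),
      b.integral_normed, ENNReal.ofReal_one]
  have hsupp : ∀ h, δ ≤ ‖h‖ → k h = 0 := by
    intro h hh
    have : h ∉ Function.support k := by
      rw [hkdef, b.support_normed_eq]; simpa [b] using hh
    simpa using this
  -- averaging with `k` moves an `L²` function by at most its modulus of continuity
  have avg : ∀ f : E d → ℂ, MemLp f 2 volume →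
      (∀ h : E d, ‖h‖ < δ → ∫⁻ x, ‖f (x - h) - f x‖ₑ ^ 2 ≤ ENNReal.ofReal ε) →
      ∫⁻ x, ‖(∫ h, (k h : ℂ) * f (x - h)) - f x‖ₑ ^ 2 ≤ ENNReal.ofReal ε := by
    intro f hf H
    refine (hk.lintegral_avg_sub_sq_le hf.1).trans ?_
    calc _ ≤ ∫⁻ h, ENNReal.ofReal (k h) * ENNReal.ofReal ε := by
          refine lintegral_mono fun h => ?_
          rcases lt_or_ge ‖h‖ δ with hh | hh
          · exact mul_le_mul_right (H h hh) _
          · simp [hsupp h hh]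
      _ = _ := by
          rw [lintegral_mul_const _ hk.meas.ennreal_ofReal, hk.lintegral_eq_one, one_mul]
  set L := ContinuousLinearMap.lsmul ℝ ℝ (E := ℂ) with hL
  set v : E d → ℂ := convolution k u L volume with hv
  have hul : LocallyIntegrable u volume := hu.1.locallyIntegrable (by norm_num)
  have vd : ContDiff ℝ ∞ v := kc.contDiff_convolution_left L kd hul
  have vf : ∀ x, v x = ∫ h, (k h : ℂ) * u (x - h) := fun x => by
    simp [hv, convolution_def, hL]
  have vg : ∀ i x, fderiv ℝ v x (EuclideanSpace.single i 1)
      = ∫ h, (k h : ℂ) * weakPartial i u (x - h) := by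
    intro i x
    have h1 := (kc.hasFDerivAt_convolution_left L (kd.of_le (by simp)) hul x).fderiv
    have hex : ConvolutionExistsAt (fderiv ℝ k) u x (L.precompL (E d)) volume :=
      (kc.fderiv ℝ).convolutionExists_left _ (kd.continuous_fderiv (by simp)) hul x
    rw [hv, h1, convolution_eq_swap, ContinuousLinearMap.integral_apply]
    · set φ : E d → ℝ := fun y => k (x - y) with hφ
      have hφd : ContDiff ℝ ∞ φ := by rw [hφ]; fun_prop
      have hφc : HasCompactSupport φ := kc.comp_homeomorph (Homeomorph.subLeft x)
      have e1 : ∀ y, fderiv ℝ φ y (EuclideanSpace.single i 1)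
          = - fderiv ℝ k (x - y) (EuclideanSpace.single i 1) := by
        intro y
        have a1 : HasFDerivAt (fun y : E d => x - y) (-ContinuousLinearMap.id ℝ (E d)) y :=
          (hasFDerivAt_id y).const_sub x
        have a2 := ((kd.differentiable (by simp) (x - y)).hasFDerivAt.comp y a1).fderiv
        have a3 : fderiv ℝ φ y = (fderiv ℝ k (x - y)).comp (-ContinuousLinearMap.id ℝ (E d)) := a2
        rw [a3]; simp
      have e2 := (hG.2 i).2 φ hφd hφc
      have e3 : ∫ y, (L.precompL (E d) (fderiv ℝ k (x - y)) (u y)) (EuclideanSpace.single i 1)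
          = - ∫ y, u y * ((fderiv ℝ φ y (EuclideanSpace.single i 1) : ℝ) : ℂ) := by
        rw [← integral_neg]
        refine integral_congr_ae (ae_of_all _ fun y => ?_)
        simp [e1, hL, ContinuousLinearMap.precompL_apply, mul_comm]
      rw [e3, e2, neg_neg, ← integral_sub_left_eq_self _ volume x]
      refine integral_congr_ae (ae_of_all _ fun y => ?_)
      simp [hφ, mul_comm]
    · exact hex.integrable_swap
  have hv0 := avg u hu.1 fun h hh => H₀ h (hh.trans_le hδle.1)
  have hv1 := fun i => avg _ (hG.2 i).1 fun h hh => H₁ i h (hh.trans_le (hδle.2 i))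
  simp only [← vf, ← vg] at hv0 hv1
  have m0 : MemLp (v - u) 2 volume :=
    memLp_two_of_lintegral_lt_top (vd.continuous.aestronglyMeasurable.sub hu.1.1)
      (hv0.trans_lt ENNReal.ofReal_lt_top)
  have c1 : ∀ i, Continuous fun x => fderiv ℝ v x (EuclideanSpace.single i 1) := fun i =>
    (vd.continuous_fderiv (by simp)).clm_apply continuous_const
  have m1 : ∀ i, MemLp ((fun x => fderiv ℝ v x (EuclideanSpace.single i 1))
      - weakPartial i u) 2 volume := fun i =>
    memLp_two_of_lintegral_lt_top ((c1 i).aestronglyMeasurable.sub (hG.2 i).1.1)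
      ((hv1 i).trans_lt ENNReal.ofReal_lt_top)
  refine ⟨v, vd, ⟨?_, fun i => ⟨?_, isWeakPartial_of_contDiff i (vd.of_le (by simp))⟩⟩,
    massSq_le_of_lintegral_le hε.le m0 hv0, fun i => massSq_le_of_lintegral_le hε.le (m1 i) (hv1 i)⟩
  · simpa using m0.add hu.1
  · simpa using (m1 i).add (hG.2 i).1

lemma norm_integral_mul_sq_le {u v : E d → ℂ} (hu : MemLp u 2 volume) (hv : MemLp v 2 volume) :
    (∫ x, ‖u x‖ * ‖v x‖) ≤ √(massSq u) * √(massSq v) := by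
  have h := integral_mul_le_Lp_mul_Lq_of_nonneg (μ := (volume : Measure (E d)))
    (f := fun x => ‖u x‖) (g := fun x => ‖v x‖) Real.HolderConjugate.two_two
    (ae_of_all _ fun _ => norm_nonneg _) (ae_of_all _ fun _ => norm_nonneg _)
    (by simpa using hu.norm) (by simpa using hv.norm)
  simpa [massSq, Real.sqrt_eq_rpow] using h

lemma tendsto_massSq_of_sub {ι : Type*} {l : Filter ι} {f : ι → E d → ℂ} {u : E d → ℂ}
    (hf : ∀ n, MemLp (f n) 2 volume) (hu : MemLp u 2 volume)
    (h : Tendsto (fun n => massSq (f n - u)) l (𝓝 0)) :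
    Tendsto (fun n => massSq (f n)) l (𝓝 (massSq u)) := by
  have e : ∀ n, |massSq (f n) - massSq u|
      ≤ massSq (f n - u) + 2 * (√(massSq u) * √(massSq (f n - u))) := by
    intro n
    have hs := (hf n).sub hu
    have h1 := massSq_add_eq hu hs
    have h2 : ‖∫ x, u x * conj ((f n - u) x)‖ ≤ √(massSq u) * √(massSq (f n - u)) := by
      refine (norm_integral_le_integral_norm _).trans ?_
      simpa only [norm_mul, RCLike.norm_conj] using norm_integral_mul_sq_le hu hs
    rw [add_sub_cancel] at h1
    rw [h1, add_assoc, add_sub_cancel_left]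
    refine (abs_add_le _ _).trans ?_
    rw [abs_of_nonneg (massSq_nonneg _), abs_mul, abs_two]
    gcongr
    exact (Complex.abs_re_le_norm _).trans h2
  rw [tendsto_iff_norm_sub_tendsto_zero]
  refine squeeze_zero (fun _ => norm_nonneg _) e ?_
  have h3 := (Real.continuous_sqrt.tendsto 0).comp h
  simp only [Real.sqrt_zero] at h3
  simpa using h.add ((h3.const_mul (√(massSq u))).const_mul 2)

lemma tendsto_gradSq_of_sub {ι : Type*} {l : Filter ι} {f : ι → E d → ℂ} {u : E d → ℂ}
    (hf : ∀ n, MemH1 (f n)) (hu : MemH1 u)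
    (h : Tendsto (fun n => gradSq (f n - u)) l (𝓝 0)) :
    Tendsto (fun n => gradSq (f n)) l (𝓝 (gradSq u)) := by
  refine tendsto_finsetSum _ fun i _ => ?_
  refine tendsto_massSq_of_sub (fun n => ((hf n).hasGrad.2 i).1) (hu.hasGrad.2 i).1 ?_
  refine squeeze_zero (fun _ => massSq_nonneg _) (fun n => ?_) h
  rw [((hf n).hasGrad.sub hu.hasGrad).gradSq_eq]
  exact Finset.single_le_sum (f := fun i => massSq (weakPartial i (f n) - weakPartial i u))
    (fun i _ => massSq_nonneg _) (Finset.mem_univ i)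

/-- Cutting off at a large radius. -/
lemma exists_test_approx_of_contDiff {v : E d → ℂ} (hv : ContDiff ℝ ∞ v)
    (hG : HasGrad v (fun i x => fderiv ℝ v x (EuclideanSpace.single i 1))) :
    ∃ φ : ℕ → E d → ℂ, (∀ n, IsTest (φ n)) ∧ Tendsto (fun n => massSq (φ n - v)) atTop (𝓝 0) ∧
      Tendsto (fun n => gradSq (φ n - v)) atTop (𝓝 0) := by
  let b : ContDiffBump (0 : E d) := ⟨1, 2, by norm_num, by norm_num⟩
  set χ : ℕ → E d → ℝ := fun n x => b (((n : ℝ) + 1)⁻¹ • x) with hχ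
  have hpos : ∀ n : ℕ, 0 < (n : ℝ) + 1 := fun n => by positivity
  have hbd : ContDiff ℝ ∞ (b : E d → ℝ) := b.contDiff
  have hχd : ∀ n, ContDiff ℝ ∞ (χ n) := fun n => hbd.comp (by fun_prop)
  have hχc : ∀ n, HasCompactSupport (χ n) := fun n =>
    b.hasCompactSupport.comp_homeomorph (Homeomorph.smulOfNeZero (((n : ℝ) + 1)⁻¹)
      (inv_ne_zero (hpos n).ne'))
  have hχ1 : ∀ x, ∀ᶠ n in atTop, χ n x = 1 := by
    intro x
    obtain ⟨N, hN⟩ := exists_nat_ge ‖x‖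
    filter_upwards [eventually_ge_atTop N] with n hn
    refine b.one_of_mem_closedBall ?_
    rw [mem_closedBall_zero_iff, norm_smul, norm_inv, Real.norm_of_nonneg (hpos n).le,
      inv_mul_le_iff₀ (hpos n)]
    have : (N : ℝ) ≤ n := by exact_mod_cast hn
    change ‖x‖ ≤ ((n : ℝ) + 1) * 1
    linarith
  have hχ01 : ∀ n x, 0 ≤ χ n x ∧ χ n x ≤ 1 := fun n x => ⟨b.nonneg, b.le_one⟩
  obtain ⟨C, hC⟩ : ∃ C, ∀ x, ‖fderiv ℝ (b : E d → ℝ) x‖ ≤ C :=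
    (b.hasCompactSupport.fderiv ℝ).exists_bound_of_continuous (hbd.continuous_fderiv (by simp))
  have hχf : ∀ n x, ‖fderiv ℝ (χ n) x‖ ≤ C * ((n : ℝ) + 1)⁻¹ := by
    intro n x
    have a1 : HasFDerivAt (fun y : E d => ((n : ℝ) + 1)⁻¹ • y)
        (((n : ℝ) + 1)⁻¹ • ContinuousLinearMap.id ℝ (E d)) x :=
      (((n : ℝ) + 1)⁻¹ • ContinuousLinearMap.id ℝ (E d)).hasFDerivAt
    have a2 : fderiv ℝ (χ n) x = (fderiv ℝ b (((n : ℝ) + 1)⁻¹ • x)).comp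
        (((n : ℝ) + 1)⁻¹ • ContinuousLinearMap.id ℝ (E d)) :=
      ((hbd.differentiable (by simp) _).hasFDerivAt.comp x a1).fderiv
    rw [a2]
    refine (ContinuousLinearMap.opNorm_comp_le _ _).trans ?_
    gcongr
    · exact (norm_nonneg _).trans (hC 0)
    · exact hC _
    · rw [norm_smul, norm_inv, Real.norm_of_nonneg (hpos n).le]
      exact mul_le_of_le_one_right (inv_nonneg.2 (hpos n).le) ContinuousLinearMap.norm_id_le
  set φ : ℕ → E d → ℂ := fun n x => χ n x • v x with hφ
  have hφt : ∀ n, IsTest (φ n) := fun n => ⟨(hχd n).smul hv, (hχc n).smul_right⟩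
  have hφf : ∀ n (i : Fin d) x, fderiv ℝ (φ n) x (EuclideanSpace.single i 1)
      = χ n x • fderiv ℝ v x (EuclideanSpace.single i 1)
        + fderiv ℝ (χ n) x (EuclideanSpace.single i 1) • v x := by
    intro n i x
    have := ((hχd n).differentiable (by simp) x).hasFDerivAt.smul
      (hv.differentiable (by simp) x).hasFDerivAt
    have e := this.fderiv
    rw [show φ n = χ n • v from rfl, e]
    simp
  -- dominated convergence for the cut-off of a single `L²` function
  have key : ∀ f : E d → ℂ, MemLp f 2 volume →
      Tendsto (fun n => massSq (fun x => χ n x • f x - f x)) atTop (𝓝 0) := by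
    intro f hf
    have h0 : (0 : ℝ) = ∫ x : E d, (0 : ℝ) := by simp
    rw [h0]
    refine tendsto_integral_of_dominated_convergence (fun x => ‖f x‖ ^ 2) (fun n => ?_)
      (integrable_sq_of_memLp hf) (fun n => ae_of_all _ fun x => ?_) (ae_of_all _ fun x => ?_)
    · exact ((((hχd n).continuous.aestronglyMeasurable.smul hf.1).sub hf.1).norm.pow 2)
    · have : χ n x • f x - f x = (χ n x - 1) • f x := by rw [sub_smul, one_smul]
      have h1 : ‖χ n x - 1‖ ≤ 1 := by
        rw [Real.norm_eq_abs, abs_le]; constructor <;> linarith [(hχ01 n x).1, (hχ01 n x).2]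
      have h2 : ‖χ n x • f x - f x‖ ≤ ‖f x‖ := by
        rw [this, norm_smul]
        exact mul_le_of_le_one_left (norm_nonneg _) h1
      rw [Real.norm_of_nonneg (by positivity)]
      exact pow_le_pow_left₀ (norm_nonneg _) h2 2
    · refine tendsto_const_nhds.congr' ?_
      filter_upwards [hχ1 x] with n hn
      simp [hn]
  refine ⟨φ, hφt, key v hG.1, ?_⟩
  have hsum : ∀ n, gradSq (φ n - v) = ∑ i, massSq ((fun x => fderiv ℝ (φ n) x
      (EuclideanSpace.single i 1)) - fun x => fderiv ℝ v x (EuclideanSpace.single i 1)) :=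
    fun n => ((hφt n).hasGrad.sub hG).gradSq_eq
  simp only [hsum]
  rw [show (0 : ℝ) = ∑ i : Fin d, (0 : ℝ) by simp]
  refine tendsto_finsetSum _ fun i _ => ?_
  have hle : ∀ n, massSq ((fun x => fderiv ℝ (φ n) x
      (EuclideanSpace.single i 1)) - fun x => fderiv ℝ v x (EuclideanSpace.single i 1))
      ≤ 2 * massSq (fun x => χ n x • fderiv ℝ v x (EuclideanSpace.single i 1)
          - fderiv ℝ v x (EuclideanSpace.single i 1))
        + 2 * ((C * ((n : ℝ) + 1)⁻¹) ^ 2 * massSq v) := by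
    intro n
    set f1 : E d → ℂ := fun x => χ n x • fderiv ℝ v x (EuclideanSpace.single i 1)
          - fderiv ℝ v x (EuclideanSpace.single i 1) with hf1
    set f2 : E d → ℂ := fun x => fderiv ℝ (χ n) x (EuclideanSpace.single i 1) • v x with hf2
    have e : ((fun x => fderiv ℝ (φ n) x
      (EuclideanSpace.single i 1)) - fun x => fderiv ℝ v x (EuclideanSpace.single i 1))
        = f1 + f2 := by
      funext x
      simp only [Pi.sub_apply, Pi.add_apply, hφf, hf1, hf2]
      ring
    have c1 : Continuous fun x => fderiv ℝ (χ n) x (EuclideanSpace.single i 1) :=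
      ((hχd n).continuous_fderiv (by simp)).clm_apply continuous_const
    have cv : Continuous fun x => fderiv ℝ v x (EuclideanSpace.single i 1) :=
      (hv.continuous_fderiv (by simp)).clm_apply continuous_const
    have m1 : MemLp f1 2 volume := by
      refine MemLp.sub ?_ (hG.2 i).1
      exact (((hχd n).continuous.smul cv)).memLp_of_hasCompactSupport (hχc n).smul_right
    have m2 : MemLp f2 2 volume := (c1.smul hv.continuous).memLp_of_hasCompactSupport
      (((hχc n).fderiv_apply (𝕜 := ℝ) _).smul_right)
    rw [e]
    refine (massSq_add_le m1 m2).trans ?_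
    gcongr
    rw [massSq, massSq, ← integral_const_mul]
    refine integral_mono (integrable_sq_of_memLp m2) ((integrable_sq_of_memLp hG.1).const_mul _)
      fun x => ?_
    simp only [hf2, norm_smul, mul_pow _ ‖v x‖]
    gcongr
    refine (ContinuousLinearMap.le_opNorm _ _).trans ?_
    have : ‖(EuclideanSpace.single i 1 : E d)‖ = 1 := by simp
    rw [this, mul_one]
    exact hχf n x
  refine squeeze_zero (fun _ => massSq_nonneg _) hle ?_
  have hn : Tendsto (fun n : ℕ => ((n : ℝ) + 1)⁻¹) atTop (𝓝 0) := by
    simpa [one_div] using tendsto_one_div_add_atTop_nhds_zero_nat (𝕜 := ℝ)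
  have h1 := ((key _ (hG.2 i).1).const_mul 2).add
    ((((hn.const_mul C).pow 2).mul_const (massSq v)).const_mul 2)
  simpa using h1

/-- Test functions are dense in `H¹`; passing to a subsequence, the approximation also converges
almost everywhere. -/
lemma MemH1.exists_test_seq {u : E d → ℂ} (hu : MemH1 u) :
    ∃ φ : ℕ → E d → ℂ, (∀ n, IsTest (φ n)) ∧ Tendsto (fun n => massSq (φ n - u)) atTop (𝓝 0) ∧
      Tendsto (fun n => gradSq (φ n - u)) atTop (𝓝 0) ∧
      ∀ᵐ x, Tendsto (fun n => φ n x) atTop (𝓝 (u x)) := by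
  have step : ∀ n : ℕ, ∃ φ : E d → ℂ, IsTest φ ∧ massSq (φ - u) ≤ ((n : ℝ) + 1)⁻¹ ∧
      gradSq (φ - u) ≤ ((n : ℝ) + 1)⁻¹ := by
    intro n
    set ε : ℝ := ((n : ℝ) + 1)⁻¹ with hεd
    have hε : 0 < ε := by positivity
    have hd : 0 < ε / (4 * (d + 1)) := by positivity
    obtain ⟨v, vd, vG, v0, v1⟩ := hu.exists_smooth_approx hd
    obtain ⟨φ, φt, φ0, φ1⟩ := exists_test_approx_of_contDiff vd vG
    obtain ⟨m, hm0, hm1⟩ := ((φ0.eventually (ge_mem_nhds (by positivity : 0 < ε / 4))).and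
      (φ1.eventually (ge_mem_nhds (by positivity : 0 < ε / 4)))).exists
    have hvH := vG.memH1
    have hle : ε / (4 * (d + 1)) ≤ ε / 4 := by
      apply div_le_div_of_nonneg_left hε.le (by norm_num)
      have : (0 : ℝ) ≤ d := by positivity
      linarith
    have e : φ m - u = (φ m - v) + (v - u) := by abel
    have gv : gradSq (v - u) ≤ ε / 4 := by
      rw [(vG.sub hu.hasGrad).gradSq_eq]
      calc _ ≤ ∑ i : Fin d, ε / (4 * (d + 1)) := Finset.sum_le_sum fun i _ => v1 i
        _ = d * (ε / (4 * (d + 1))) := by simp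
        _ ≤ ε / 4 := by
          rw [mul_div_assoc', div_le_div_iff₀ (by positivity) (by norm_num)]
          nlinarith
    refine ⟨φ m, φt m, ?_, ?_⟩
    · rw [e]
      have := massSq_add_le ((φt m).hasGrad.memH1.sub hvH).1 (hvH.sub hu).1
      linarith
    · rw [e]
      have := gradSq_add_le ((φt m).hasGrad.memH1.sub hvH) (hvH.sub hu)
      linarith
  choose φ hφt hφ0 hφ1 using step
  have hn : Tendsto (fun n : ℕ => ((n : ℝ) + 1)⁻¹) atTop (𝓝 0) := by
    simpa [one_div] using tendsto_one_div_add_atTop_nhds_zero_nat (𝕜 := ℝ)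
  have t0 : Tendsto (fun n => massSq (φ n - u)) atTop (𝓝 0) :=
    squeeze_zero (fun _ => massSq_nonneg _) hφ0 hn
  have t1 : Tendsto (fun n => gradSq (φ n - u)) atTop (𝓝 0) :=
    squeeze_zero (fun _ => gradSq_nonneg _) hφ1 hn
  have hm : ∀ n, MemLp (φ n - u) 2 volume := fun n => ((hφt n).hasGrad.memH1.sub hu).1
  have tm : TendstoInMeasure volume φ atTop u := by
    refine tendstoInMeasure_of_tendsto_eLpNorm (p := 2) (by norm_num)
      (fun n => (hφt n).1.continuous.aestronglyMeasurable) hu.1.1 ?_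
    have e : ∀ n, eLpNorm (φ n - u) 2 volume = (ENNReal.ofReal (massSq (φ n - u))) ^ (1 / 2 : ℝ) := by
      intro n
      rw [← lintegral_enorm_sq (hm n), ← eLpNorm_two_sq, ← ENNReal.rpow_ofNat, ← ENNReal.rpow_mul]
      simp
    simp only [e]
    have := (ENNReal.continuous_rpow_const (y := (1 / 2 : ℝ))).tendsto 0
    have h2 := this.comp (by simpa using ENNReal.tendsto_ofReal t0)
    simpa [Function.comp_def] using h2
  obtain ⟨ns, hns, hae⟩ := tm.exists_seq_tendsto_ae
  exact ⟨fun n => φ (ns n), fun n => hφt _, t0.comp hns.tendsto_atTop, t1.comp hns.tendsto_atTop, hae⟩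

/-! ### Sobolev and Hölder inequalities -/

lemma lintegral_le_of_ae_tendsto {α : Type*} [MeasurableSpace α] {μ : Measure α}
    {F : ℕ → α → ℝ≥0∞} {f : α → ℝ≥0∞} (hF : ∀ n, AEMeasurable (F n) μ)
    (hlim : ∀ᵐ x ∂μ, Tendsto (fun n => F n x) atTop (𝓝 (f x))) {B : ℕ → ℝ≥0∞} {b : ℝ≥0∞}
    (hB : ∀ n, ∫⁻ x, F n x ∂μ ≤ B n) (hb : Tendsto B atTop (𝓝 b)) : ∫⁻ x, f x ∂μ ≤ b := by
  calc ∫⁻ x, f x ∂μ = ∫⁻ x, liminf (fun n => F n x) atTop ∂μ :=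
        lintegral_congr_ae (hlim.mono fun x hx => hx.liminf_eq.symm)
    _ ≤ liminf (fun n => ∫⁻ x, F n x ∂μ) atTop := lintegral_liminf_le' hF
    _ ≤ liminf B atTop := liminf_le_liminf (Eventually.of_forall hB)
    _ = b := hb.liminf_eq

lemma norm_clm_sq_le (L : E d →L[ℝ] ℂ) :
    ‖L‖ ^ 2 ≤ d * ∑ i, ‖L (EuclideanSpace.single i 1)‖ ^ 2 := by
  have h1 : ‖L‖ ≤ ∑ i, ‖L (EuclideanSpace.single i 1)‖ := by
    refine L.opNorm_le_bound (Finset.sum_nonneg fun _ _ => norm_nonneg _) fun x => ?_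
    have hx : x = ∑ i, x i • (EuclideanSpace.single i 1 : E d) := by
      have := (EuclideanSpace.basisFun (Fin d) ℝ).sum_repr x
      simpa using this.symm
    conv_lhs => rw [hx]
    rw [map_sum, Finset.sum_mul]
    refine (norm_sum_le _ _).trans (Finset.sum_le_sum fun i _ => ?_)
    rw [map_smul, norm_smul, mul_comm]
    gcongr
    exact PiLp.norm_apply_le x i
  calc ‖L‖ ^ 2 ≤ (∑ i, ‖L (EuclideanSpace.single i 1)‖) ^ 2 := by gcongr
    _ ≤ _ := by
      have := sq_sum_le_card_mul_sum_sq (s := (Finset.univ : Finset (Fin d)))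
        (f := fun i => ‖L (EuclideanSpace.single i 1)‖)
      simpa using this

/-- The Sobolev inequality `‖u‖²_{L^{2d/(d-2)}} ≤ C ‖∇u‖²` on `H¹`. -/
lemma exists_sobolev (hd : 3 ≤ d) : ∃ C : NNReal, ∀ u : E d → ℂ, MemH1 u →
    ∫⁻ x, ‖u x‖ₑ ^ (2 * d / ((d : ℝ) - 2)) ≤
      (C * ENNReal.ofReal (gradSq u)) ^ ((d : ℝ) / ((d : ℝ) - 2)) := by
  have hd' : (3 : ℝ) ≤ d := by exact_mod_cast hd
  have hd2 : (0 : ℝ) < (d : ℝ) - 2 := by linarith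
  set q : ℝ := 2 * d / ((d : ℝ) - 2) with hq
  have hq0 : 0 < q := by positivity
  obtain ⟨qn, hqn⟩ : ∃ qn : NNReal, (qn : ℝ) = q := ⟨⟨q, hq0.le⟩, rfl⟩
  set K := SNormLESNormFDerivOfEqConst ℂ (volume : Measure (E d)) 2
  refine ⟨K ^ 2 * d, ?_⟩
  have test : ∀ φ : E d → ℂ, IsTest φ → ∫⁻ x, ‖φ x‖ₑ ^ q ≤
      (((K ^ 2 * d : NNReal) : ℝ≥0∞) * ENNReal.ofReal (gradSq φ)) ^ ((d : ℝ) / ((d : ℝ) - 2)) := by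
    intro φ hφ
    have h := eLpNorm_le_eLpNorm_fderiv_of_eq (volume : Measure (E d)) (u := φ)
      (hφ.1.of_le (by simp)) hφ.2 (p := 2) (p' := qn) (by norm_num) (by simp; omega)
      (by
        simp only [hqn, finrank_euclideanSpace, Fintype.card_fin, hq]
        push_cast
        field_simp)
    have h2 : ∫⁻ x, ‖fderiv ℝ φ x‖ₑ ^ 2 ≤ d * ENNReal.ofReal (gradSq φ) := by
      rw [hφ.hasGrad.gradSq_eq, ENNReal.ofReal_sum_of_nonneg fun i _ => massSq_nonneg _]
      simp only [← lintegral_enorm_sq (hφ.hasGrad.2 _).1]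
      have cf := hφ.1.continuous_fderiv (by simp)
      rw [← lintegral_finsetSum, ← lintegral_const_mul]
      · refine lintegral_mono fun x => ?_
        have := ENNReal.ofReal_le_ofReal (norm_clm_sq_le (fderiv ℝ φ x))
        rw [ENNReal.ofReal_mul (by positivity), ENNReal.ofReal_pow (norm_nonneg _),
          ofReal_norm, ENNReal.ofReal_sum_of_nonneg fun i _ => by positivity] at this
        simpa [ENNReal.ofReal_pow (norm_nonneg _)] using this
      · exact Finset.measurable_fun_sum _ fun i _ =>
          (cf.clm_apply continuous_const).measurable.enorm.pow_const 2
      · exact fun i _ => (cf.clm_apply continuous_const).measurable.enorm.pow_const 2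
    have h3 : eLpNorm φ qn volume = (∫⁻ x, ‖φ x‖ₑ ^ q) ^ (1 / q) := by
      rw [eLpNorm_eq_lintegral_rpow_enorm_toReal (by
        simpa [← NNReal.coe_eq_zero, hqn] using hq0.ne') ENNReal.coe_ne_top]
      simp [hqn]
    rw [h3] at h
    have h4 : ((∫⁻ x, ‖φ x‖ₑ ^ q) ^ (1 / q)) ^ q ≤
        ((K : ℝ≥0∞) * eLpNorm (fderiv ℝ φ) 2 volume) ^ q := by
      refine ENNReal.rpow_le_rpow ?_ hq0.le
      simpa using h
    rw [← ENNReal.rpow_mul, one_div_mul_cancel hq0.ne', ENNReal.rpow_one] at h4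
    refine h4.trans ?_
    have e : q = 2 * ((d : ℝ) / ((d : ℝ) - 2)) := by rw [hq]; ring
    rw [e, ENNReal.rpow_mul, ENNReal.rpow_ofNat, mul_pow, eLpNorm_two_sq]
    refine ENNReal.rpow_le_rpow ?_ (by positivity)
    push_cast
    rw [mul_assoc]
    gcongr
  intro u hu
  obtain ⟨φ, hφt, -, hφ1, hae⟩ := hu.exists_test_seq
  refine lintegral_le_of_ae_tendsto (F := fun n x => ‖φ n x‖ₑ ^ q)
    (fun n => ((hφt n).1.continuous.measurable.enorm.pow_const q).aemeasurable) ?_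
    (fun n => test _ (hφt n)) ?_
  · filter_upwards [hae] with x hx
    exact (ENNReal.continuous_rpow_const.tendsto _).comp ((continuous_enorm.tendsto _).comp hx)
  · have := tendsto_gradSq_of_sub (fun n => (hφt n).hasGrad.memH1) hu hφ1
    exact (ENNReal.continuous_rpow_const.tendsto _).comp
      (ENNReal.Tendsto.const_mul (ENNReal.tendsto_ofReal this) (Or.inr ENNReal.coe_ne_top))

/-- Hölder's inequality combined with Sobolev's:
`∫ |V| |u|² ≤ C ‖V‖_{L^{d/2}} ‖∇u‖²`. -/
lemma exists_hoelder_sobolev (hd : 3 ≤ d) : ∃ C : NNReal, ∀ (V : E d → ℝ) (u : E d → ℂ),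
    AEMeasurable V volume → MemH1 u →
    ∫⁻ x, ‖V x‖ₑ * ‖u x‖ₑ ^ 2 ≤
      C * eLpNorm V ((d : ℝ≥0∞) / 2) volume * ENNReal.ofReal (gradSq u) := by
  have hd' : (3 : ℝ) ≤ d := by exact_mod_cast hd
  have hd2 : (0 : ℝ) < (d : ℝ) - 2 := by linarith
  obtain ⟨C, hC⟩ := exists_sobolev hd
  refine ⟨C, fun V u hV hu => ?_⟩
  have hpq : ((d : ℝ) / 2).HolderConjugate ((d : ℝ) / ((d : ℝ) - 2)) := by
    rw [Real.holderConjugate_iff]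
    constructor
    · linarith
    · field_simp; ring
  have h := ENNReal.lintegral_mul_le_Lp_mul_Lq volume hpq hV.enorm (hu.1.1.enorm.pow_const 2)
  have e1 : (∫⁻ x, ‖V x‖ₑ ^ ((d : ℝ) / 2)) ^ (1 / ((d : ℝ) / 2))
      = eLpNorm V ((d : ℝ≥0∞) / 2) volume := by
    rw [eLpNorm_eq_lintegral_rpow_enorm_toReal]
    · simp
    · simp; omega
    · simp [ENNReal.div_eq_top]
  have e2 : ∀ x, (‖u x‖ₑ ^ 2) ^ ((d : ℝ) / ((d : ℝ) - 2)) = ‖u x‖ₑ ^ (2 * d / ((d : ℝ) - 2)) := by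
    intro x
    rw [← ENNReal.rpow_ofNat, ← ENNReal.rpow_mul]
    congr 1
    ring
  rw [e1] at h
  simp only [e2] at h
  refine h.trans ?_
  rw [mul_comm (C : ℝ≥0∞), mul_assoc]
  gcongr
  calc _ ≤ ((C * ENNReal.ofReal (gradSq u)) ^ ((d : ℝ) / ((d : ℝ) - 2)))
        ^ (1 / ((d : ℝ) / ((d : ℝ) - 2))) :=
        ENNReal.rpow_le_rpow (hC u hu) (by positivity)
    _ = _ := by
      rw [← ENNReal.rpow_mul, mul_one_div_cancel (by positivity), ENNReal.rpow_one]

lemma gradSq_pos (hd : 3 ≤ d) {u : E d → ℂ} (hu : NonzeroH1 u) : 0 < gradSq u := by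
  have hd' : (3 : ℝ) ≤ d := by exact_mod_cast hd
  have hd2 : (0 : ℝ) < (d : ℝ) - 2 := by linarith
  refine lt_of_le_of_ne (gradSq_nonneg u) fun h => hu.2 ?_
  obtain ⟨C, hC⟩ := exists_sobolev hd
  have := hC u hu.1
  rw [← h, ENNReal.ofReal_zero, mul_zero, ENNReal.zero_rpow_of_pos (by positivity),
    nonpos_iff_eq_zero, lintegral_eq_zero_iff' (hu.1.1.1.enorm.pow_const _)] at this
  filter_upwards [this] with x hx
  have hq : 0 < 2 * (d : ℝ) / ((d : ℝ) - 2) := by positivity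
  simpa [ENNReal.rpow_eq_zero_iff, hq, hq.not_gt] using hx

/-! ### The heat kernel -/

/-- The heat kernel `(4πt)^{-d/2} exp(-|x|²/(4t))`. -/
def heat (t : ℝ) (x : E d) : ℝ :=
  (4 * Real.pi * t) ^ (-((d : ℝ) / 2)) * Real.exp (-(1 / (4 * t)) * ‖x‖ ^ 2)

lemma heat_nonneg {t : ℝ} (ht : 0 < t) (x : E d) : 0 ≤ heat t x := by
  unfold heat; positivity

lemma measurable_heat : Measurable fun z : ℝ × E d => heat z.1 z.2 := by
  unfold heat; fun_prop

lemma measurable_heat_right (t : ℝ) : Measurable (heat t : E d → ℝ) :=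
  measurable_heat.comp (measurable_const.prodMk measurable_id)

lemma integrable_exp_neg_mul_sq {b : ℝ} (hb : 0 < b) (c : E d) :
    Integrable fun x : E d => Real.exp (-b * ‖x - c‖ ^ 2) := by
  have h : Integrable fun x : E d => Real.exp (-b * ‖x‖ ^ 2) := by
    by_contra h
    have := integral_undef h
    rw [GaussianFourier.integral_rexp_neg_mul_sq_norm hb] at this
    have : 0 < (Real.pi / b) ^ ((Module.finrank ℝ (E d) : ℝ) / 2) := by positivity
    linarith
  exact h.comp_sub_right c

lemma integral_exp_neg_mul_sq_sub {b : ℝ} (hb : 0 < b) (c : E d) :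
    ∫ x : E d, Real.exp (-b * ‖x - c‖ ^ 2) = (Real.pi / b) ^ ((d : ℝ) / 2) := by
  rw [integral_sub_right_eq_self (fun x : E d => Real.exp (-b * ‖x‖ ^ 2)) c,
    GaussianFourier.integral_rexp_neg_mul_sq_norm hb]
  simp

lemma integrable_heat {t : ℝ} (ht : 0 < t) : Integrable (heat t : E d → ℝ) := by
  have := integrable_exp_neg_mul_sq (d := d) (b := 1 / (4 * t)) (by positivity) 0
  simp only [sub_zero] at this
  exact this.const_mul _

lemma integral_heat {t : ℝ} (ht : 0 < t) : ∫ x : E d, heat t x = 1 := by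
  have := integral_exp_neg_mul_sq_sub (d := d) (b := 1 / (4 * t)) (by positivity) 0
  simp only [sub_zero] at this
  unfold heat
  rw [integral_const_mul, this, Real.rpow_neg (by positivity)]
  rw [show Real.pi / (1 / (4 * t)) = 4 * Real.pi * t by field_simp]
  exact inv_mul_cancel₀ (by positivity)

lemma isDensity_heat {t : ℝ} (ht : 0 < t) : IsDensity (heat t : E d → ℝ) := by
  refine ⟨measurable_heat_right t, heat_nonneg ht, ?_⟩
  rw [← ofReal_integral_eq_lintegral_ofReal (integrable_heat ht) (ae_of_all _ (heat_nonneg ht)),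
    integral_heat ht, ENNReal.ofReal_one]

lemma heat_memLp_two {t : ℝ} (ht : 0 < t) (x : E d) :
    MemLp (fun y => ((heat t (x - y) : ℝ) : ℂ)) 2 volume := by
  have hb : ∀ y : E d, heat t y ≤ (4 * Real.pi * t) ^ (-((d : ℝ) / 2)) := fun y => by
    unfold heat
    refine mul_le_of_le_one_right (by positivity) ?_
    rw [Real.exp_le_one_iff, neg_mul]
    have : 0 ≤ 1 / (4 * t) * ‖y‖ ^ 2 := by positivity
    linarith
  have h1 : MemLp (heat t : E d → ℝ) 2 volume := by
    rw [memLp_two_iff_integrable_sq (measurable_heat_right t).aestronglyMeasurable]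
    refine ((integrable_heat ht).const_mul ((4 * Real.pi * t) ^ (-((d : ℝ) / 2)))).mono'
      ((measurable_heat_right t).pow_const 2).aestronglyMeasurable (ae_of_all _ fun y => ?_)
    rw [Real.norm_of_nonneg (by positivity), sq]
    exact mul_le_mul_of_nonneg_right (hb y) (heat_nonneg ht y)
  exact (h1.comp_measurePreserving (Measure.measurePreserving_sub_left volume x)).ofReal

/-- The semigroup property of the heat kernel. -/
lemma lintegral_heat_mul_heat {t s : ℝ} (ht : 0 < t) (hs : 0 < s) (x z : E d) :
    ∫⁻ y, ENNReal.ofReal (heat t (x - y)) * ENNReal.ofReal (heat s (y - z))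
      = ENNReal.ofReal (heat (t + s) (x - z)) := by
  have hts : 0 < t + s := by positivity
  set b : ℝ := (t + s) / (4 * t * s) with hb
  have hb0 : 0 < b := by positivity
  set c : E d := z + (s / (t + s)) • (x - z) with hc
  -- completing the square
  have key : ∀ y : E d, heat t (x - y) * heat s (y - z) =
      ((4 * Real.pi * t) ^ (-((d : ℝ) / 2)) * (4 * Real.pi * s) ^ (-((d : ℝ) / 2))
        * Real.exp (-(1 / (4 * (t + s))) * ‖x - z‖ ^ 2)) * Real.exp (-b * ‖y - c‖ ^ 2) := by
    intro y
    have e : -(1 / (4 * t)) * ‖x - y‖ ^ 2 + -(1 / (4 * s)) * ‖y - z‖ ^ 2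
        = -(1 / (4 * (t + s))) * ‖x - z‖ ^ 2 + -b * ‖y - c‖ ^ 2 := by
      have e1 : x - y = (x - z) - (y - z) := by abel
      have e2 : y - c = (y - z) - (s / (t + s)) • (x - z) := by rw [hc]; abel
      rw [e1, e2, norm_sub_sq_real (x - z), norm_sub_sq_real (y - z), norm_smul, inner_smul_right,
        real_inner_comm (x - z) (y - z), Real.norm_of_nonneg (by positivity), hb]
      field_simp
      ring
    unfold heat
    rw [mul_mul_mul_comm, ← Real.exp_add, e, Real.exp_add]
    ring
  simp_rw [← ENNReal.ofReal_mul (heat_nonneg ht _), key]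
  rw [← ofReal_integral_eq_lintegral_ofReal ((integrable_exp_neg_mul_sq hb0 c).const_mul _)
    (ae_of_all _ fun y => by positivity), integral_const_mul, integral_exp_neg_mul_sq_sub hb0]
  congr 1
  unfold heat
  have e3 : Real.pi / b = (4 * Real.pi * t) * (4 * Real.pi * s) * (4 * Real.pi * (t + s))⁻¹ := by
    rw [hb]; field_simp
  have e4 : ∀ A B D : ℝ, 0 < A → 0 < B → 0 < D → A ^ (-((d : ℝ) / 2)) * B ^ (-((d : ℝ) / 2)) *
      (A * B * D⁻¹) ^ ((d : ℝ) / 2) = D ^ (-((d : ℝ) / 2)) := by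
    intro A B D hA hB hD
    rw [Real.mul_rpow (by positivity) (by positivity), Real.mul_rpow hA.le hB.le,
      Real.inv_rpow hD.le, Real.rpow_neg hA.le, Real.rpow_neg hB.le, Real.rpow_neg hD.le]
    have h1 : A ^ ((d : ℝ) / 2) ≠ 0 := by positivity
    have h2 : B ^ ((d : ℝ) / 2) ≠ 0 := by positivity
    field_simp
  rw [e3, ← e4 (4 * Real.pi * t) (4 * Real.pi * s) (4 * Real.pi * (t + s)) (by positivity)
    (by positivity) (by positivity)]
  ring

/-- The heat kernel integrates in time to the fundamental solution `C_d |x|^{2-d}` of `-Δ`. -/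
lemma lintegral_heat_time (hd : 3 ≤ d) {x : E d} (hx : x ≠ 0) :
    ∫⁻ s in Set.Ioi (0 : ℝ), ENNReal.ofReal (heat s x)
      = ENNReal.ofReal (newtonConst d) / ‖x‖ₑ ^ (d - 2) := by
  have hd' : (3 : ℝ) ≤ d := by exact_mod_cast hd
  have hr : 0 < ‖x‖ := norm_pos_iff.2 hx
  set a : ℝ := (d : ℝ) / 2 - 1 with ha
  have ha0 : 0 < a := by rw [ha]; linarith
  set g : ℝ → ℝ := fun y => (4 * Real.pi) ^ (-((d : ℝ) / 2)) *
    (y ^ (a - 1) * Real.exp (-(‖x‖ ^ 2 / 4 * y))) with hg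
  have hgi : ∫ y in Set.Ioi (0 : ℝ), g y = (4 * Real.pi) ^ (-((d : ℝ) / 2)) *
      ((1 / (‖x‖ ^ 2 / 4)) ^ a * Real.Gamma a) := by
    rw [hg, integral_const_mul, Real.integral_rpow_mul_exp_neg_mul_Ioi ha0 (by positivity)]
  have hgp : 0 < ∫ y in Set.Ioi (0 : ℝ), g y := by
    have := Real.Gamma_pos_of_pos ha0
    rw [hgi]; positivity
  have hgint : IntegrableOn g (Set.Ioi 0) := by
    by_contra h
    have := integral_undef h
    linarith
  have e : Set.EqOn (fun s : ℝ => (|(-1 : ℝ)| * s ^ ((-1 : ℝ) - 1)) • g (s ^ (-1 : ℝ)))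
      (fun s => heat s x) (Set.Ioi 0) := by
    intro s hs
    have hs0 : 0 < s := hs
    simp only [hg, heat, abs_neg, abs_one, one_mul, smul_eq_mul]
    rw [← Real.rpow_mul hs0.le, Real.mul_rpow (by positivity) hs0.le, Real.rpow_neg_one]
    have e1 : s ^ (-((d : ℝ) / 2)) = s ^ ((-1 : ℝ) - 1) * s ^ (-1 * (a - 1)) := by
      rw [← Real.rpow_add hs0, ha]; congr 1; ring
    rw [e1]
    have e2 : -(‖x‖ ^ 2 / 4 * s⁻¹) = -(1 / (4 * s)) * ‖x‖ ^ 2 := by field_simp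
    rw [e2]; ring
  have hint : IntegrableOn (fun s => heat s x) (Set.Ioi 0) := by
    refine IntegrableOn.congr_fun ?_ e measurableSet_Ioi
    exact (integrableOn_Ioi_comp_rpow_iff g (by norm_num)).2 hgint
  have hval : ∫ s in Set.Ioi (0 : ℝ), heat s x = ∫ y in Set.Ioi (0 : ℝ), g y := by
    rw [← integral_comp_rpow_Ioi g (p := -1) (by norm_num)]
    exact (setIntegral_congr_fun measurableSet_Ioi e).symm
  rw [← ofReal_integral_eq_lintegral_ofReal hint
    ((ae_restrict_iff' measurableSet_Ioi).2 (ae_of_all _ fun s hs => heat_nonneg hs x)), hval, hgi]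
  have hc : (4 * Real.pi) ^ (-((d : ℝ) / 2)) * ((1 / (‖x‖ ^ 2 / 4)) ^ a * Real.Gamma a)
      = newtonConst d / ‖x‖ ^ (d - 2) := by
    have hG : Real.Gamma ((d : ℝ) / 2) = a * Real.Gamma a := by
      rw [← Real.Gamma_add_one ha0.ne']; congr 1; rw [ha]; ring
    have h4 : (4 : ℝ) ^ ((d : ℝ) / 2) = 4 ^ a * 4 := by
      rw [← Real.rpow_add_one (by norm_num)]; congr 1; rw [ha]; ring
    have hx2 : (‖x‖ ^ 2) ^ a = ‖x‖ ^ (d - 2) := by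
      rw [← Real.rpow_natCast ‖x‖ 2, ← Real.rpow_mul hr.le, ← Real.rpow_natCast ‖x‖ (d - 2)]
      congr 1
      push_cast [Nat.cast_sub (by omega : 2 ≤ d)]
      rw [ha]; ring
    rw [one_div_div, Real.div_rpow (by norm_num) (by positivity), hx2, newtonConst, hG,
      Real.rpow_neg (by positivity), Real.mul_rpow (by norm_num) Real.pi_pos.le, h4]
    have h5 : (d : ℝ) - 2 = 2 * a := by rw [ha]; ring
    rw [h5]
    have h6 : (4 : ℝ) ^ a ≠ 0 := by positivity
    have h7 : Real.pi ^ ((d : ℝ) / 2) ≠ 0 := by positivity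
    field_simp
    ring
  rw [hc, ENNReal.ofReal_div_of_pos (by positivity), ENNReal.ofReal_pow hr.le, ofReal_norm]

lemma one_add_sq_div_two_le_cosh (x : ℝ) : 1 + x ^ 2 / 2 ≤ Real.cosh x := by
  have h1 := Real.cosh_two_mul (x / 2)
  rw [mul_div_cancel₀ x (two_ne_zero)] at h1
  have h2 : |x / 2| ≤ |Real.sinh (x / 2)| := by
    rw [Real.abs_sinh]; exact Real.self_le_sinh_iff.2 (abs_nonneg _)
  have h3 := sq_le_sq.2 h2
  have h4 := Real.cosh_sq (x / 2)
  nlinarith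

/-- The second moments of the heat kernel are at most those of a centred Gaussian vector with
covariance `2t`; the bound is read off from its Laplace transform. -/
lemma lintegral_heat_mul_inner_sq_le {t : ℝ} (ht : 0 < t) (a : E d) :
    ∫⁻ h, ENNReal.ofReal (heat t h) * ENNReal.ofReal (inner ℝ a h ^ 2)
      ≤ ENNReal.ofReal (2 * t * ‖a‖ ^ 2) := by
  set b : ℝ := 1 / (4 * t) with hb
  have hb0 : 0 < b := by positivity
  have lap : ∀ c : ℝ, ∫⁻ h : E d, ENNReal.ofReal (heat t h * Real.exp (c * inner ℝ a h))
      = ENNReal.ofReal (Real.exp (c ^ 2 * (t * ‖a‖ ^ 2))) := by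
    intro c
    -- completing the square
    have key : ∀ h : E d, heat t h * Real.exp (c * inner ℝ a h) =
        ((4 * Real.pi * t) ^ (-((d : ℝ) / 2)) * Real.exp (c ^ 2 * (t * ‖a‖ ^ 2)))
          * Real.exp (-b * ‖h - (2 * t * c) • a‖ ^ 2) := by
      intro h
      unfold heat
      rw [mul_assoc (_ ^ _), mul_assoc (_ ^ _), ← Real.exp_add, ← Real.exp_add]
      congr 2
      rw [norm_sub_sq_real, inner_smul_right, norm_smul, mul_pow, Real.norm_eq_abs, sq_abs,
        real_inner_comm, hb]
      field_simp
      ring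
    simp_rw [key]
    rw [← ofReal_integral_eq_lintegral_ofReal ((integrable_exp_neg_mul_sq hb0 _).const_mul _)
      (ae_of_all _ fun y => by positivity), integral_const_mul, integral_exp_neg_mul_sq_sub hb0]
    congr 1
    rw [show Real.pi / b = 4 * Real.pi * t by rw [hb]; field_simp, Real.rpow_neg (by positivity)]
    have h1 : (4 * Real.pi * t) ^ ((d : ℝ) / 2) ≠ 0 := by positivity
    field_simp
  set M := ∫⁻ h, ENNReal.ofReal (heat t h) * ENNReal.ofReal (inner ℝ a h ^ 2) with hM
  set K : ℝ := t * ‖a‖ ^ 2 with hK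
  have hK0 : 0 ≤ K := by positivity
  have hmeas : Measurable fun h : E d => ENNReal.ofReal (heat t h) :=
    (measurable_heat_right t).ennreal_ofReal
  have step : ∀ c : ℝ, 0 < c → 2 + ENNReal.ofReal (c ^ 2) * M
      ≤ ENNReal.ofReal (2 * Real.exp (c ^ 2 * K)) := by
    intro c hc
    have h1 := lap c
    have h2 := lap (-c)
    rw [neg_sq] at h2
    have e : ENNReal.ofReal (2 * Real.exp (c ^ 2 * K)) =
        ∫⁻ h : E d, (ENNReal.ofReal (heat t h * Real.exp (c * inner ℝ a h))
          + ENNReal.ofReal (heat t h * Real.exp (-c * inner ℝ a h))) := by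
      rw [lintegral_add_left, h1, h2, ← ENNReal.ofReal_add (by positivity) (by positivity), two_mul]
      exact ((measurable_heat_right t).mul (by fun_prop)).ennreal_ofReal
    have e2 : 2 + ENNReal.ofReal (c ^ 2) * M = ∫⁻ h : E d, (2 * ENNReal.ofReal (heat t h)
        + ENNReal.ofReal (c ^ 2) * (ENNReal.ofReal (heat t h) * ENNReal.ofReal (inner ℝ a h ^ 2)))
        := by
      rw [lintegral_add_left (hmeas.const_mul 2), lintegral_const_mul _ hmeas,
        (isDensity_heat ht).lintegral_eq_one, lintegral_const_mul, mul_one]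
      exact hmeas.mul (by fun_prop)
    rw [e, e2]
    refine lintegral_mono fun h => ?_
    have hh := heat_nonneg ht h
    rw [← ENNReal.ofReal_mul hh, ← ENNReal.ofReal_mul (by positivity),
      show 2 * ENNReal.ofReal (heat t h) = ENNReal.ofReal (2 * heat t h) by
        rw [ENNReal.ofReal_mul (by norm_num)]; simp,
      ← ENNReal.ofReal_add (by positivity) (by positivity),
      ← ENNReal.ofReal_add (by positivity) (by positivity)]
    refine ENNReal.ofReal_le_ofReal ?_
    have hcosh := one_add_sq_div_two_le_cosh (c * inner ℝ a h)
    rw [Real.cosh_eq] at hcosh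
    rw [neg_mul]
    nlinarith
  have hMfin : M ≠ ⊤ := by
    intro h
    have := step 1 one_pos
    rw [h] at this
    simp only [one_pow, ENNReal.ofReal_one, one_mul, add_top, top_le_iff] at this
    exact ENNReal.ofReal_ne_top this
  rw [← ENNReal.ofReal_toReal hMfin]
  refine ENNReal.ofReal_le_ofReal ?_
  refine le_of_forall_pos_le_add fun ε hε => ?_
  set σ : ℝ := min (1 / (K + 1)) (ε / (2 * K ^ 2 + 1)) with hσ
  have hσ0 : 0 < σ := by positivity
  have hs := step (√σ) (Real.sqrt_pos.2 hσ0)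
  rw [Real.sq_sqrt hσ0.le, ← ENNReal.ofReal_toReal hMfin, ← ENNReal.ofReal_mul hσ0.le,
    show (2 : ℝ≥0∞) = ENNReal.ofReal 2 by simp,
    ← ENNReal.ofReal_add (by norm_num) (by positivity),
    ENNReal.ofReal_le_ofReal_iff (by positivity)] at hs
  have hσK : σ * K ≤ 1 := by
    calc σ * K ≤ 1 / (K + 1) * K := by gcongr; exact min_le_left _ _
      _ ≤ 1 := by rw [div_mul_eq_mul_div, one_mul, div_le_one (by positivity)]; linarith
  have hexp := Real.abs_exp_sub_one_sub_id_le (x := σ * K) (by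
    rw [abs_of_nonneg (by positivity)]; exact hσK)
  have h3 := (abs_le.1 hexp).2
  have h4 : σ * M.toReal ≤ σ * (2 * K + 2 * σ * K ^ 2) := by nlinarith
  have h5 := le_of_mul_le_mul_left h4 hσ0
  have h6 : 2 * σ * K ^ 2 ≤ ε := by
    have : σ ≤ ε / (2 * K ^ 2 + 1) := min_le_right _ _
    rw [le_div_iff₀ (by positivity)] at this
    nlinarith
  linarith

/-! ### The heat semigroup against the Dirichlet energy -/

lemma lintegral_heat_mul_enorm_clm_sq_le {t : ℝ} (ht : 0 < t) (L : E d →L[ℝ] ℂ) :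
    ∫⁻ h, ENNReal.ofReal (heat t h) * ‖L h‖ₑ ^ 2
      ≤ ENNReal.ofReal (2 * t) * ∑ i, ‖L (EuclideanSpace.single i 1)‖ₑ ^ 2 := by
  -- the vectors representing the real and the imaginary part of `L`
  set a : E d := WithLp.toLp 2 fun i => (L (EuclideanSpace.single i 1)).re with ha
  set b : E d := WithLp.toLp 2 fun i => (L (EuclideanSpace.single i 1)).im with hb
  have hL : ∀ h : E d, L h = ∑ i, (h i : ℂ) * L (EuclideanSpace.single i 1) := by
    intro h
    have hx : h = ∑ i, h i • (EuclideanSpace.single i 1 : E d) := by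
      have := (EuclideanSpace.basisFun (Fin d) ℝ).sum_repr h
      simpa using this.symm
    conv_lhs => rw [hx]
    simp [map_sum]
  have e : ∀ h : E d, ‖L h‖ₑ ^ 2
      = ENNReal.ofReal (inner ℝ a h ^ 2) + ENNReal.ofReal (inner ℝ b h ^ 2) := by
    intro h
    rw [← ENNReal.ofReal_add (by positivity) (by positivity), ← ofReal_norm,
      ← ENNReal.ofReal_pow (norm_nonneg _), ← Complex.normSq_eq_norm_sq, Complex.normSq_apply]
    congr 1
    have h1 : (L h).re = inner ℝ a h := by
      rw [hL]; simp [ha, PiLp.inner_apply]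
    have h2 : (L h).im = inner ℝ b h := by
      rw [hL]; simp [hb, PiLp.inner_apply]
    rw [h1, h2]; ring
  have e2 : ENNReal.ofReal (2 * t * ‖a‖ ^ 2) + ENNReal.ofReal (2 * t * ‖b‖ ^ 2)
      = ENNReal.ofReal (2 * t) * ∑ i, ‖L (EuclideanSpace.single i 1)‖ₑ ^ 2 := by
    rw [← ENNReal.ofReal_add (by positivity) (by positivity), ← mul_add,
      ENNReal.ofReal_mul (by positivity)]
    congr 1
    rw [EuclideanSpace.norm_sq_eq, EuclideanSpace.norm_sq_eq, ← Finset.sum_add_distrib,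
      ENNReal.ofReal_sum_of_nonneg fun i _ => by positivity]
    refine Finset.sum_congr rfl fun i _ => ?_
    rw [← ofReal_norm, ← ENNReal.ofReal_pow (norm_nonneg _), ← Complex.normSq_eq_norm_sq,
      Complex.normSq_apply]
    simp [ha, hb, sq]
  rw [← e2]
  simp only [e, mul_add]
  rw [lintegral_add_left]
  · exact add_le_add (lintegral_heat_mul_inner_sq_le ht a) (lintegral_heat_mul_inner_sq_le ht b)
  · exact (measurable_heat_right t).ennreal_ofReal.mul (by fun_prop)

/-- `‖u(· - h) - u‖_{L²} ≤ ‖h · ∇u‖_{L²}`. -/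
lemma IsTest.lintegral_translation_le {u : E d → ℂ} (hu : IsTest u) (h : E d) :
    ∫⁻ x, ‖u (x - h) - u x‖ₑ ^ 2 ≤ ∫⁻ x, ‖fderiv ℝ u x h‖ₑ ^ 2 := by
  have hc : Continuous fun x => fderiv ℝ u x h :=
    (hu.1.continuous_fderiv (by simp)).clm_apply continuous_const
  have hc2 : Continuous fun z : E d × ℝ => fderiv ℝ u (z.1 - z.2 • h) h :=
    hc.comp (by fun_prop)
  have pt : ∀ x, ‖u (x - h) - u x‖ₑ ^ 2
      ≤ ∫⁻ s in Set.Ioc (0 : ℝ) 1, ‖fderiv ℝ u (x - s • h) h‖ₑ ^ 2 := by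
    intro x
    have hd : ∀ s : ℝ, HasDerivAt (fun s : ℝ => u (x - s • h)) (-(fderiv ℝ u (x - s • h) h)) s := by
      intro s
      have h1 : HasDerivAt (fun s : ℝ => x - s • h) (-h) s := by
        simpa using ((hasDerivAt_id s).smul_const h).const_sub x
      have := ((hu.1.differentiable (by simp) (x - s • h)).hasFDerivAt.comp_hasDerivAt s h1)
      simpa [Function.comp_def] using this
    have hcx : Continuous fun s : ℝ => fderiv ℝ u (x - s • h) h := hc.comp (by fun_prop)
    have ftc := intervalIntegral.integral_eq_sub_of_hasDerivAt (a := 0) (b := 1)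
      (fun s _ => hd s) (hcx.neg.intervalIntegrable _ _)
    rw [one_smul, zero_smul, sub_zero] at ftc
    rw [← ftc, intervalIntegral.integral_of_le zero_le_one]
    have hm : AEStronglyMeasurable (fun s : ℝ => -(fderiv ℝ u (x - s • h) h))
        (volume.restrict (Set.Ioc (0 : ℝ) 1)) := hcx.neg.aestronglyMeasurable
    have : IsProbabilityMeasure (volume.restrict (Set.Ioc (0 : ℝ) 1)) := ⟨by simp⟩
    have h12 := eLpNorm_le_eLpNorm_of_exponent_le (p := 1) (q := 2) (by norm_num) hm
    rw [eLpNorm_one_eq_lintegral_enorm] at h12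
    have h3 := (enorm_integral_le_lintegral_enorm (μ := volume.restrict (Set.Ioc (0 : ℝ) 1))
      (fun s : ℝ => -(fderiv ℝ u (x - s • h) h))).trans h12
    have h4 : ∫⁻ s in Set.Ioc (0 : ℝ) 1, ‖fderiv ℝ u (x - s • h) h‖ₑ ^ 2
        = eLpNorm (fun s : ℝ => -(fderiv ℝ u (x - s • h) h)) 2
          (volume.restrict (Set.Ioc (0 : ℝ) 1)) ^ 2 := by
      rw [eLpNorm_two_sq]; simp only [enorm_neg]
    rw [h4]
    gcongr
  calc _ ≤ ∫⁻ x, ∫⁻ s in Set.Ioc (0 : ℝ) 1, ‖fderiv ℝ u (x - s • h) h‖ₑ ^ 2 := lintegral_mono pt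
    _ = ∫⁻ s in Set.Ioc (0 : ℝ) 1, ∫⁻ x, ‖fderiv ℝ u (x - s • h) h‖ₑ ^ 2 :=
        lintegral_lintegral_swap (hc2.measurable.enorm.pow_const 2).aemeasurable
    _ = ∫⁻ s in Set.Ioc (0 : ℝ) 1, ∫⁻ x, ‖fderiv ℝ u x h‖ₑ ^ 2 := by
        refine lintegral_congr fun s => ?_
        exact lintegral_sub_right_eq_self (fun x => ‖fderiv ℝ u x h‖ₑ ^ 2) (s • h)
    _ = _ := by simp

lemma aemeasurable_heat_mul_diff (t : ℝ) {u : E d → ℂ} (hu : AEStronglyMeasurable u volume) :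
    AEMeasurable (fun z : E d × E d => ENNReal.ofReal (heat t z.2)
      * ‖u (z.1 - z.2) - u z.1‖ₑ ^ 2) (volume.prod volume) :=
  ((measurable_heat_right t).ennreal_ofReal.comp measurable_snd).aemeasurable.mul
    (((aestronglyMeasurable_sub_prod hu).sub hu.comp_fst).enorm.pow_const 2)

lemma IsTest.lintegral_heat_diff_le {φ : E d → ℂ} (hφ : IsTest φ) {t : ℝ} (ht : 0 < t) :
    ∫⁻ z : E d × E d, ENNReal.ofReal (heat t z.2) * ‖φ (z.1 - z.2) - φ z.1‖ₑ ^ 2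
      ∂(volume.prod volume) ≤ ENNReal.ofReal (2 * t * gradSq φ) := by
  have hcφ := hφ.1.continuous
  have hcf := hφ.1.continuous_fderiv (by simp)
  rw [lintegral_prod_symm _ (aemeasurable_heat_mul_diff t hcφ.aestronglyMeasurable)]
  calc _ = ∫⁻ h, ENNReal.ofReal (heat t h) * ∫⁻ x, ‖φ (x - h) - φ x‖ₑ ^ 2 := by
        refine lintegral_congr fun h => ?_
        dsimp only
        refine lintegral_const_mul (f := fun x => ‖φ (x - h) - φ x‖ₑ ^ 2) _ ?_
        exact ((hcφ.comp (continuous_id.sub continuous_const)).sub hcφ).measurable.enorm.pow_const 2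
    _ ≤ ∫⁻ h, ENNReal.ofReal (heat t h) * ∫⁻ x, ‖fderiv ℝ φ x h‖ₑ ^ 2 := by
        exact lintegral_mono fun h => mul_le_mul_right (hφ.lintegral_translation_le h) _
    _ = ∫⁻ h, ∫⁻ x, ENNReal.ofReal (heat t h) * ‖fderiv ℝ φ x h‖ₑ ^ 2 := by
        refine lintegral_congr fun h => ?_
        refine (lintegral_const_mul _ ?_).symm
        exact (hcf.clm_apply continuous_const).measurable.enorm.pow_const 2
    _ = ∫⁻ x, ∫⁻ h, ENNReal.ofReal (heat t h) * ‖fderiv ℝ φ x h‖ₑ ^ 2 := by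
        refine lintegral_lintegral_swap (Measurable.aemeasurable ?_)
        refine ((measurable_heat_right t).ennreal_ofReal.comp measurable_fst).mul ?_
        exact ((hcf.comp continuous_snd).clm_apply continuous_fst).measurable.enorm.pow_const 2
    _ ≤ ∫⁻ x, ENNReal.ofReal (2 * t) * ∑ i, ‖fderiv ℝ φ x (EuclideanSpace.single i 1)‖ₑ ^ 2 :=
        lintegral_mono fun x => lintegral_heat_mul_enorm_clm_sq_le ht _
    _ = ENNReal.ofReal (2 * t * gradSq φ) := by
        have hm : ∀ i : Fin d, Measurable fun x => ‖fderiv ℝ φ x (EuclideanSpace.single i 1)‖ₑ ^ 2 :=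
          fun i => (hcf.clm_apply continuous_const).measurable.enorm.pow_const 2
        rw [lintegral_const_mul _ (Finset.measurable_fun_sum _ fun i _ => hm i),
          lintegral_finsetSum _ fun i _ => hm i,
          ENNReal.ofReal_mul (p := 2 * t) (by positivity), hφ.hasGrad.gradSq_eq,
          ENNReal.ofReal_sum_of_nonneg fun i _ => massSq_nonneg _]
        congr 1
        exact Finset.sum_congr rfl fun i _ => lintegral_enorm_sq (hφ.hasGrad.2 i).1

lemma ae_tendsto_comp_sub_prod {φ : ℕ → E d → ℂ} {u : E d → ℂ}
    (h : ∀ᵐ x, Tendsto (fun n => φ n x) atTop (𝓝 (u x))) :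
    ∀ᵐ z : E d × E d ∂(volume.prod volume),
      Tendsto (fun n => φ n (z.1 - z.2) - φ n z.1) atTop (𝓝 (u (z.1 - z.2) - u z.1)) := by
  have h1 := (quasiMeasurePreserving_sub_of_right_invariant (volume : Measure (E d)) volume).ae h
  have h2 := (Measure.quasiMeasurePreserving_fst (μ := (volume : Measure (E d)))
    (ν := (volume : Measure (E d)))).ae h
  filter_upwards [h1, h2] with z hz1 hz2 using hz1.sub hz2

/-- The Dirichlet form of the heat semigroup is bounded by the Dirichlet energy:
`∬ p_t(h) |u(x-h) - u(x)|² ≤ 2t ‖∇u‖²`. The constant is sharp as `t → 0`. -/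
lemma MemH1.lintegral_heat_diff_le {u : E d → ℂ} (hu : MemH1 u) {t : ℝ} (ht : 0 < t) :
    ∫⁻ z : E d × E d, ENNReal.ofReal (heat t z.2) * ‖u (z.1 - z.2) - u z.1‖ₑ ^ 2
      ∂(volume.prod volume) ≤ ENNReal.ofReal (2 * t * gradSq u) := by
  obtain ⟨φ, hφt, -, hφ1, hae⟩ := hu.exists_test_seq
  have hlim := (tendsto_gradSq_of_sub (fun n => (hφt n).hasGrad.memH1) hu hφ1).const_mul (2 * t)
  have hpt : ∀ᵐ z : E d × E d ∂(volume.prod volume),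
      Tendsto (fun n => ENNReal.ofReal (heat t z.2) * ‖φ n (z.1 - z.2) - φ n z.1‖ₑ ^ 2) atTop
        (𝓝 (ENNReal.ofReal (heat t z.2) * ‖u (z.1 - z.2) - u z.1‖ₑ ^ 2)) := by
    filter_upwards [ae_tendsto_comp_sub_prod hae] with z hz
    exact ENNReal.Tendsto.const_mul (((ENNReal.continuous_pow 2).tendsto _).comp
      ((continuous_enorm.tendsto _).comp hz)) (Or.inr ENNReal.ofReal_ne_top)
  exact lintegral_le_of_ae_tendsto
    (fun n => aemeasurable_heat_mul_diff t (hφt n).1.continuous.aestronglyMeasurable) hpt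
    (fun n => (hφt n).lintegral_heat_diff_le ht) (ENNReal.tendsto_ofReal hlim)

/-! ### Local compactness -/

/-- Rellich's theorem: a sequence bounded in `H¹` that converges weakly to `0` in `L²` converges
to `0` in `L²` of every ball. -/
lemma tendsto_setLIntegral_ball_of_weak {v : ℕ → E d → ℂ} (hv : ∀ n, MemH1 (v n)) {C : ℝ}
    (hm : ∀ n, massSq (v n) ≤ C) (hg : ∀ n, gradSq (v n) ≤ C)
    (hw : ∀ ψ : E d → ℂ, MemLp ψ 2 volume → Tendsto (fun n => ∫ x, v n x * ψ x) atTop (𝓝 0))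
    (R : ℝ) :
    Tendsto (fun n => ∫⁻ x in Metric.ball 0 R, ‖v n x‖ₑ ^ 2) atTop (𝓝 0) := by
  have hC : 0 ≤ C := (massSq_nonneg _).trans (hm 0)
  rw [ENNReal.tendsto_nhds_zero]
  intro ε hε
  obtain ⟨e, he0, heε⟩ : ∃ e : ℝ, 0 < e ∧ ENNReal.ofReal e ≤ ε := by
    rcases eq_or_ne ε ⊤ with h | h
    · exact ⟨1, one_pos, by simp [h]⟩
    · exact ⟨ε.toReal, ENNReal.toReal_pos hε.ne' h, ENNReal.ofReal_toReal_le⟩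
  set t : ℝ := e / (8 * (C + 1)) with ht
  have ht0 : 0 < t := by positivity
  set A : ℕ → E d → ℂ := fun n x => ∫ h, (heat t h : ℂ) * v n (x - h) with hA
  have hAeq : ∀ n x, A n x = ∫ y, v n y * (heat t (x - y) : ℂ) := by
    intro n x
    rw [hA, ← integral_sub_left_eq_self _ volume x]
    refine integral_congr_ae (ae_of_all _ fun y => ?_)
    simp [mul_comm]
  have hAlim : ∀ x, Tendsto (fun n => A n x) atTop (𝓝 0) := by
    intro x
    simp only [hAeq]
    exact hw _ (heat_memLp_two ht0 x)
  have hAmeas : ∀ n, AEStronglyMeasurable (A n) volume := by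
    intro n
    have h1 : AEStronglyMeasurable (fun z : E d × E d => (heat t z.2 : ℂ) * v n (z.1 - z.2))
        (volume.prod volume) :=
      ((Complex.measurable_ofReal.comp (measurable_heat_right t)).comp
        measurable_snd).aestronglyMeasurable.mul (aestronglyMeasurable_sub_prod (hv n).1.1)
    exact h1.integral_prod_right'
  have hAbd : ∃ M : ℝ, ∀ n x, ‖A n x‖ ≤ M := by
    refine ⟨√C * √(massSq fun y : E d => (heat t y : ℂ)), fun n x => ?_⟩
    rw [hAeq]
    refine (norm_integral_le_integral_norm _).trans ?_
    simp only [norm_mul]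
    refine (norm_integral_mul_sq_le (hv n).1 (heat_memLp_two ht0 x)).trans ?_
    have e1 : massSq (fun y : E d => ((heat t (x - y) : ℝ) : ℂ))
        = massSq fun y : E d => (heat t y : ℂ) :=
      integral_sub_left_eq_self (fun y : E d => ‖(heat t y : ℂ)‖ ^ 2) volume x
    rw [e1]
    exact mul_le_mul_of_nonneg_right (Real.sqrt_le_sqrt (hm n)) (Real.sqrt_nonneg _)
  obtain ⟨M, hM⟩ := hAbd
  have hlimA : Tendsto (fun n => ∫⁻ x in Metric.ball (0 : E d) R, ‖A n x‖ₑ ^ 2) atTop (𝓝 0) := by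
    have h0 : (0 : ℝ≥0∞) = ∫⁻ x in Metric.ball (0 : E d) R, 0 := by simp
    rw [h0]
    refine tendsto_lintegral_of_dominated_convergence' (fun _ => ENNReal.ofReal M ^ 2)
      (fun n => ((hAmeas n).enorm.pow_const 2).restrict) (fun n => ae_of_all _ fun x => ?_) ?_
      (ae_of_all _ fun x => ?_)
    · change ‖A n x‖ₑ ^ 2 ≤ ENNReal.ofReal M ^ 2
      gcongr
      rw [← ofReal_norm]
      exact ENNReal.ofReal_le_ofReal (hM n x)
    · rw [lintegral_const]
      refine ENNReal.mul_ne_top (by simp) ?_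
      simpa using (measure_ball_lt_top (μ := volume) (x := (0 : E d)) (r := R)).ne
    · have := ((ENNReal.continuous_pow 2).tendsto _).comp
        ((continuous_enorm.tendsto _).comp (hAlim x))
      simpa [Function.comp_def] using this
  have hev := (ENNReal.tendsto_nhds_zero.1 hlimA) (ENNReal.ofReal (e / 4))
    (ENNReal.ofReal_pos.2 (by positivity))
  filter_upwards [hev] with n hn
  have pt : ∀ x, ‖v n x‖ₑ ^ 2 ≤ 2 * ‖A n x‖ₑ ^ 2 + 2 * ‖A n x - v n x‖ₑ ^ 2 := by
    intro x
    have h1 : ‖v n x‖ ^ 2 ≤ 2 * ‖A n x‖ ^ 2 + 2 * ‖A n x - v n x‖ ^ 2 := by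
      have := norm_sub_le (A n x) (A n x - v n x)
      rw [sub_sub_cancel] at this
      nlinarith [norm_nonneg (v n x), sq_nonneg (‖A n x‖ - ‖A n x - v n x‖)]
    have h2 := ENNReal.ofReal_le_ofReal h1
    rw [ENNReal.ofReal_add (by positivity) (by positivity), ENNReal.ofReal_mul (by positivity),
      ENNReal.ofReal_mul (by positivity), ENNReal.ofReal_pow (norm_nonneg _),
      ENNReal.ofReal_pow (norm_nonneg _), ENNReal.ofReal_pow (norm_nonneg _)] at h2
    simpa [ofReal_norm] using h2
  have hdiff : ∫⁻ x, ‖A n x - v n x‖ₑ ^ 2 ≤ ENNReal.ofReal (e / 4) := by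
    refine ((isDensity_heat ht0).lintegral_avg_sub_sq_le (hv n).1.1).trans ?_
    have h1 := (hv n).lintegral_heat_diff_le ht0
    rw [lintegral_prod_symm _ (aemeasurable_heat_mul_diff t (hv n).1.1)] at h1
    have h2 : ∫⁻ h, ENNReal.ofReal (heat t h) * ∫⁻ x, ‖v n (x - h) - v n x‖ₑ ^ 2
        = ∫⁻ h, ∫⁻ x, ENNReal.ofReal (heat t h) * ‖v n (x - h) - v n x‖ₑ ^ 2 := by
      refine lintegral_congr fun h => ?_
      refine (lintegral_const_mul'' _ ?_).symm
      exact (((hv n).1.1.comp_quasiMeasurePreserving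
          (measurePreserving_sub_right volume h).quasiMeasurePreserving).sub
            (hv n).1.1).enorm.pow_const 2
    rw [h2]
    refine h1.trans (ENNReal.ofReal_le_ofReal ?_)
    calc 2 * t * gradSq (v n) ≤ 2 * t * (C + 1) := by
          gcongr; linarith [hg n]
      _ = e / 4 := by rw [ht]; field_simp; norm_num
  calc _ ≤ ∫⁻ x in Metric.ball 0 R, (2 * ‖A n x‖ₑ ^ 2 + 2 * ‖A n x - v n x‖ₑ ^ 2) :=
        lintegral_mono pt
    _ = 2 * (∫⁻ x in Metric.ball 0 R, ‖A n x‖ₑ ^ 2)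
        + 2 * ∫⁻ x in Metric.ball 0 R, ‖A n x - v n x‖ₑ ^ 2 := by
      have m1 : AEMeasurable (fun x => ‖A n x‖ₑ ^ 2) (volume.restrict (Metric.ball 0 R)) :=
        ((hAmeas n).enorm.pow_const 2).restrict
      have m2 : AEMeasurable (fun x => ‖A n x - v n x‖ₑ ^ 2)
          (volume.restrict (Metric.ball 0 R)) :=
        (((hAmeas n).sub (hv n).1.1).enorm.pow_const 2).restrict
      rw [lintegral_add_left' (m1.const_mul 2), lintegral_const_mul'' _ m1,
        lintegral_const_mul'' _ m2]
    _ ≤ 2 * ENNReal.ofReal (e / 4) + 2 * ENNReal.ofReal (e / 4) := by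
      gcongr
      exact (setLIntegral_le_lintegral _ _).trans hdiff
    _ = ENNReal.ofReal e := by
      rw [← ENNReal.ofReal_ofNat 2, ← ENNReal.ofReal_mul (by norm_num),
        ← ENNReal.ofReal_add (by positivity) (by positivity)]
      congr 1; ring
    _ ≤ ε := heε

/-! ### The form bound for Kato potentials -/

lemma HasGrad.gradSq_congr {u v : E d → ℂ} {G : Fin d → E d → ℂ} (hu : HasGrad u G)
    (huv : u =ᵐ[volume] v) : gradSq v = gradSq u := by
  rw [hu.gradSq_eq, (hu.congr huv).gradSq_eq]

/-- The heat average `∫ p_t(h) f(x - h) dh`. -/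
def heatAvg (t : ℝ) (f : E d → ℝ≥0∞) (x : E d) : ℝ≥0∞ :=
  ∫⁻ h, ENNReal.ofReal (heat t h) * f (x - h)

lemma heatAvg_eq (t : ℝ) (f : E d → ℝ≥0∞) (x : E d) :
    heatAvg t f x = ∫⁻ y, ENNReal.ofReal (heat t (x - y)) * f y := by
  rw [heatAvg, ← lintegral_sub_left_eq_self _ x]
  simp

lemma measurable_heatAvg {f : E d → ℝ≥0∞} (hf : Measurable f) :
    Measurable fun z : ℝ × E d => heatAvg z.1 f z.2 := by
  unfold heatAvg
  refine Measurable.lintegral_prod_right' (f := fun p : (ℝ × E d) × E d =>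
    ENNReal.ofReal (heat p.1.1 p.2) * f (p.1.2 - p.2)) ?_
  refine Measurable.mul ?_ (hf.comp (by fun_prop))
  exact (measurable_heat.comp (by fun_prop :
    Measurable fun p : (ℝ × E d) × E d => (p.1.1, p.2))).ennreal_ofReal

lemma heatAvg_const {t : ℝ} (ht : 0 < t) (c : ℝ≥0∞) (x : E d) : heatAvg t (fun _ => c) x = c := by
  rw [heatAvg, lintegral_mul_const _ (measurable_heat_right t).ennreal_ofReal,
    (isDensity_heat ht).lintegral_eq_one, one_mul]

lemma measurable_heat_comp {α : Type*} [MeasurableSpace α] {t : α → ℝ} {x : α → E d}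
    (ht : Measurable t) (hx : Measurable x) :
    Measurable fun a => ENNReal.ofReal (heat (t a) (x a)) :=
  (measurable_heat.comp (ht.prodMk hx)).ennreal_ofReal

lemma measurable_heatAvg_comp {f : E d → ℝ≥0∞} (hf : Measurable f) {α : Type*}
    [MeasurableSpace α] {t : α → ℝ} {x : α → E d} (ht : Measurable t) (hx : Measurable x) :
    Measurable fun a => heatAvg (t a) f (x a) := by
  have h1 := measurable_heatAvg hf
  have h2 : Measurable fun a => (t a, x a) := ht.prodMk hx
  generalize heatAvg (d := d) = F at h1 ⊢
  exact h1.comp h2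

/-- The semigroup property of heat averages. -/
lemma heatAvg_heatAvg {t s : ℝ} (ht : 0 < t) (hs : 0 < s) {f : E d → ℝ≥0∞} (hf : Measurable f)
    (x : E d) : heatAvg t (heatAvg s f) x = heatAvg (t + s) f x := by
  have m1 : ∀ y : E d, Measurable fun z : E d => ENNReal.ofReal (heat s (y - z)) * f z := fun y =>
    (measurable_heat_comp measurable_const (by fun_prop)).mul hf
  have m2 : Measurable fun y : E d => ENNReal.ofReal (heat t (x - y)) :=
    measurable_heat_comp measurable_const (by fun_prop)
  have m3 : Measurable fun p : E d × E d => ENNReal.ofReal (heat t (x - p.1)) *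
      (ENNReal.ofReal (heat s (p.1 - p.2)) * f p.2) :=
    (measurable_heat_comp measurable_const (by fun_prop)).mul
      ((measurable_heat_comp measurable_const (by fun_prop)).mul (by fun_prop))
  have m4 : ∀ z : E d, Measurable fun y : E d =>
      ENNReal.ofReal (heat t (x - y)) * ENNReal.ofReal (heat s (y - z)) := fun z =>
    (measurable_heat_comp measurable_const (by fun_prop)).mul
      (measurable_heat_comp measurable_const (by fun_prop))
  have e1 : heatAvg t (heatAvg s f) x = ∫⁻ y, ∫⁻ z, ENNReal.ofReal (heat t (x - y)) *
      (ENNReal.ofReal (heat s (y - z)) * f z) := by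
    rw [heatAvg_eq]
    refine lintegral_congr fun y => ?_
    rw [heatAvg_eq, lintegral_const_mul _ (m1 y)]
  rw [e1, lintegral_lintegral_swap m3.aemeasurable, heatAvg_eq]
  refine lintegral_congr fun z => ?_
  rw [← lintegral_heat_mul_heat ht hs, ← lintegral_mul_const _ (m4 z)]
  exact lintegral_congr fun y => (mul_assoc _ _ _).symm

section Kernel

variable {k : E d → ℝ≥0∞} {f g : E d → ℝ≥0∞}

lemma lintegral_prod_kernel_mul (hk : Measurable k) (hf : Measurable f) (hg : Measurable g) :
    ∫⁻ z : E d × E d, k z.2 * (f z.1 * g (z.1 - z.2)) ∂(volume.prod volume)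
      = ∫⁻ x, f x * ∫⁻ h, k h * g (x - h) := by
  have m : Measurable fun z : E d × E d => k z.2 * (f z.1 * g (z.1 - z.2)) := by fun_prop
  rw [lintegral_prod _ m.aemeasurable]
  refine lintegral_congr fun x => ?_
  have m2 : Measurable fun h => k h * g (x - h) := by fun_prop
  rw [← lintegral_const_mul _ m2]
  exact lintegral_congr fun h => by ring

lemma lintegral_prod_kernel_mul' (hk : Measurable k) (hf : Measurable f) (hg : Measurable g)
    (hke : ∀ h, k (-h) = k h) :
    ∫⁻ z : E d × E d, k z.2 * (f (z.1 - z.2) * g z.1) ∂(volume.prod volume)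
      = ∫⁻ x, f x * ∫⁻ h, k h * g (x - h) := by
  have m1 : Measurable fun z : E d × E d => k z.2 * (f (z.1 - z.2) * g z.1) := by fun_prop
  have m2 : Measurable fun z : E d × E d => k z.2 * (f z.1 * g (z.1 + z.2)) := by fun_prop
  rw [lintegral_prod_symm' _ m1]
  have e : ∀ h, ∫⁻ x, k h * (f (x - h) * g x) = ∫⁻ x, k h * (f x * g (x + h)) := fun h => by
    rw [← lintegral_add_right_eq_self _ h]
    simp
  simp only [e]
  rw [← lintegral_lintegral_swap (f := fun x h => k h * (f x * g (x + h))) m2.aemeasurable]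
  refine lintegral_congr fun x => ?_
  have m3 : Measurable fun h => k h * g (x - h) := by fun_prop
  rw [← lintegral_neg_eq_self, ← lintegral_const_mul _ m3]
  refine lintegral_congr fun h => ?_
  rw [hke, ← sub_eq_add_neg]
  ring

lemma lintegral_prod_kernel_fst (hk : Measurable k) (hk1 : ∫⁻ h, k h = 1) (hf : Measurable f) :
    ∫⁻ z : E d × E d, k z.2 * f z.1 ∂(volume.prod volume) = ∫⁻ x, f x := by
  simpa [hk1] using lintegral_prod_kernel_mul (g := fun _ => 1) hk hf measurable_const

lemma lintegral_prod_kernel_sub (hk : Measurable k) (hk1 : ∫⁻ h, k h = 1) (hf : Measurable f)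
    (hke : ∀ h, k (-h) = k h) :
    ∫⁻ z : E d × E d, k z.2 * f (z.1 - z.2) ∂(volume.prod volume) = ∫⁻ x, f x := by
  simpa [hk1] using lintegral_prod_kernel_mul' (g := fun _ => 1) hk hf measurable_const hke

end Kernel

/-- The Newton potential `∫₀^∞ e^{sΔ} w ds`. -/
def newtonPot (w : E d → ℝ≥0∞) (x : E d) : ℝ≥0∞ := ∫⁻ s in Set.Ioi (0 : ℝ), heatAvg s w x

/-- The part `∫₀^t e^{sΔ} w ds` of the Newton potential. -/
def newtonPotUpTo (t : ℝ) (w : E d → ℝ≥0∞) (x : E d) : ℝ≥0∞ :=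
  ∫⁻ s in Set.Ioc (0 : ℝ) t, heatAvg s w x

lemma measurable_newtonPot {w : E d → ℝ≥0∞} (hw : Measurable w) : Measurable (newtonPot w) :=
  Measurable.lintegral_prod_left' (measurable_heatAvg hw)

lemma measurable_newtonPotUpTo (t : ℝ) {w : E d → ℝ≥0∞} (hw : Measurable w) :
    Measurable (newtonPotUpTo t w) :=
  Measurable.lintegral_prod_left' (measurable_heatAvg hw)

/-- Integrating the heat kernel in time bounds the Newton potential by the Kato supremum. -/
lemma newtonPot_le (hd : 3 ≤ d) {w : E d → ℝ≥0∞} (hw : Measurable w) (x : E d) :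
    newtonPot w x ≤ ENNReal.ofReal (newtonConst d) * ⨆ x : E d, ∫⁻ y, w y / ‖x - y‖ₑ ^ (d - 2) := by
  have m : Measurable fun p : ℝ × E d => ENNReal.ofReal (heat p.1 (x - p.2)) * w p.2 :=
    (measurable_heat_comp measurable_fst (by fun_prop)).mul (by fun_prop)
  have : Nontrivial (E d) := by
    have : Nonempty (Fin d) := ⟨⟨0, by omega⟩⟩
    infer_instance
  have h0 : ∀ᵐ y : E d, y ≠ x := Measure.ae_ne volume x
  calc newtonPot w x = ∫⁻ s in Set.Ioi (0 : ℝ), ∫⁻ y, ENNReal.ofReal (heat s (x - y)) * w y := by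
        simp only [newtonPot, heatAvg_eq]
    _ = ∫⁻ y, ∫⁻ s in Set.Ioi (0 : ℝ), ENNReal.ofReal (heat s (x - y)) * w y :=
        lintegral_lintegral_swap m.aemeasurable
    _ = ∫⁻ y, ENNReal.ofReal (newtonConst d) * (w y / ‖x - y‖ₑ ^ (d - 2)) := by
        refine lintegral_congr_ae ?_
        filter_upwards [h0] with y hy
        rw [lintegral_mul_const, lintegral_heat_time hd (sub_ne_zero.2 hy.symm)]
        · simp only [div_eq_mul_inv]; ring
        · exact measurable_heat_comp measurable_id measurable_const
    _ = ENNReal.ofReal (newtonConst d) * ∫⁻ y, w y / ‖x - y‖ₑ ^ (d - 2) :=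
        lintegral_const_mul _ (hw.div (by fun_prop))
    _ ≤ _ := by
        gcongr
        exact le_iSup (fun x : E d => ∫⁻ y, w y / ‖x - y‖ₑ ^ (d - 2)) x

/-- The Newton potential is a supersolution of the heat semigroup, with defect its part up to
time `t`. -/
lemma newtonPot_eq {t : ℝ} (ht : 0 < t) {w : E d → ℝ≥0∞} (hw : Measurable w) (x : E d) :
    newtonPot w x = newtonPotUpTo t w x + heatAvg t (newtonPot w) x := by
  have e : heatAvg t (newtonPot w) x = ∫⁻ s in Set.Ioi t, heatAvg s w x := by
    have m : Measurable fun p : E d × ℝ => ENNReal.ofReal (heat t p.1) * heatAvg p.2 w (x - p.1) :=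
      (measurable_heat_comp measurable_const measurable_fst).mul
        (measurable_heatAvg_comp hw measurable_snd (by fun_prop))
    have m2 : ∀ h, Measurable fun s => heatAvg s w (x - h) := fun h =>
      measurable_heatAvg_comp hw measurable_id measurable_const
    have m3 : Measurable fun s => heatAvg s w x :=
      measurable_heatAvg_comp hw measurable_id measurable_const
    have e1 : heatAvg t (newtonPot w) x = ∫⁻ h, ∫⁻ s in Set.Ioi (0 : ℝ),
        ENNReal.ofReal (heat t h) * heatAvg s w (x - h) := by
      rw [heatAvg]
      refine lintegral_congr fun h => ?_
      rw [newtonPot, lintegral_const_mul _ (m2 h)]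
    have e2 := (measurePreserving_add_left (volume : Measure ℝ) t).setLIntegral_comp_preimage
      (measurableSet_Ioi (a := t)) m3
    have e3 : (fun s => t + s) ⁻¹' Set.Ioi t = Set.Ioi 0 := by ext s; simp
    rw [e1, lintegral_lintegral_swap m.aemeasurable, ← e2, e3]
    exact setLIntegral_congr_fun measurableSet_Ioi fun s hs => heatAvg_heatAvg ht hs hw x
  rw [e, newtonPot, newtonPotUpTo, ← lintegral_union measurableSet_Ioi
    (Set.Ioc_disjoint_Ioi le_rfl), Set.Ioc_union_Ioi_eq_Ioi ht.le]

/-- The pointwise form of the ground state transform, from `(|a| q - |b| p)² ≥ 0`. -/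
lemma sq_add_sq_le_jacobi (a b : ℂ) {p q : ℝ≥0∞} (hp : p ≠ 0) (hp' : p ≠ ⊤) (hq : q ≠ 0)
    (hq' : q ≠ ⊤) :
    ‖a‖ₑ ^ 2 + ‖b‖ₑ ^ 2 ≤ ‖b - a‖ₑ ^ 2 + ‖a‖ₑ ^ 2 / p * q + ‖b‖ₑ ^ 2 / q * p := by
  lift p to NNReal using hp'
  lift q to NNReal using hq'
  have hp0 : p ≠ 0 := by simpa using hp
  have hq0 : q ≠ 0 := by simpa using hq
  have hpp : (0 : ℝ) < p := by positivity
  have hqp : (0 : ℝ) < q := by positivity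
  simp only [enorm_eq_nnnorm]
  rw [← ENNReal.coe_pow, ← ENNReal.coe_pow, ← ENNReal.coe_pow, ← ENNReal.coe_div hp0,
    ← ENNReal.coe_div hq0]
  norm_cast
  rw [← NNReal.coe_le_coe]
  push_cast
  have h1 : (‖a‖ - ‖b‖) ^ 2 ≤ ‖b - a‖ ^ 2 := by
    rw [sq_le_sq, abs_of_nonneg (norm_nonneg (b - a)), norm_sub_rev]
    exact abs_norm_sub_norm_le a b
  have h2 : 2 * ‖a‖ * ‖b‖ ≤ ‖a‖ ^ 2 / p * q + ‖b‖ ^ 2 / q * p := by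
    have : ‖a‖ ^ 2 / p * q + ‖b‖ ^ 2 / q * p - 2 * ‖a‖ * ‖b‖
        = (‖a‖ * q - ‖b‖ * p) ^ 2 / (p * q) := by
      field_simp; ring
    have h3 : 0 ≤ (‖a‖ * q - ‖b‖ * p) ^ 2 / (p * q : ℝ) := by positivity
    linarith
  nlinarith

/-- The ground state transform for an even probability kernel: summing the pointwise inequality
with weights `p = φ(x)` and `q = φ(x - h)` leaves the defect `q` of the supersolution `φ`. -/
lemma lintegral_mul_div_le_of_kernel_supersolution {k : E d → ℝ≥0∞} (hkm : Measurable k)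
    (hk1 : ∫⁻ h, k h = 1) (hke : ∀ h, k (-h) = k h) {u : E d → ℂ} (hum : Measurable u)
    (hu : ∫⁻ x, ‖u x‖ₑ ^ 2 ≠ ⊤) {φ q : E d → ℝ≥0∞} (hφ : Measurable φ) (hq : Measurable q)
    (hφ0 : ∀ x, φ x ≠ 0) (hφt : ∀ x, φ x ≠ ⊤) (h : ∀ x, φ x = q x + ∫⁻ h, k h * φ (x - h)) :
    2 * ∫⁻ x, ‖u x‖ₑ ^ 2 / φ x * q x ≤
      ∫⁻ z : E d × E d, k z.2 * ‖u (z.1 - z.2) - u z.1‖ₑ ^ 2 ∂(volume.prod volume) := by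
  have hum2 : Measurable fun x => ‖u x‖ₑ ^ 2 := hum.enorm.pow_const 2
  have hf : Measurable fun x => ‖u x‖ₑ ^ 2 / φ x := hum2.div hφ
  have m1 : Measurable fun z : E d × E d => k z.2 * ‖u z.1‖ₑ ^ 2 := by fun_prop
  have m2 : Measurable fun z : E d × E d =>
      k z.2 * ((fun x => ‖u x‖ₑ ^ 2 / φ x) z.1 * φ (z.1 - z.2)) := by fun_prop
  have m3 : Measurable fun z : E d × E d =>
      k z.2 * ((fun x => ‖u x‖ₑ ^ 2 / φ x) (z.1 - z.2) * φ z.1) := by fun_prop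
  have m4 : Measurable fun x => ‖u x‖ₑ ^ 2 / φ x * q x := by fun_prop
  have hX1 := lintegral_prod_kernel_mul hkm hf hφ
  have hX2 := lintegral_prod_kernel_mul' hkm hf hφ hke
  have hY1 := lintegral_prod_kernel_fst hkm hk1 hum2
  have hY2 := lintegral_prod_kernel_sub hkm hk1 hum2 hke
  have hmain : ∫⁻ z : E d × E d, (k z.2 * ‖u z.1‖ₑ ^ 2 + k z.2 * ‖u (z.1 - z.2)‖ₑ ^ 2)
      ∂(volume.prod volume) ≤
      ∫⁻ z : E d × E d, (k z.2 * ‖u (z.1 - z.2) - u z.1‖ₑ ^ 2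
        + k z.2 * ((fun x => ‖u x‖ₑ ^ 2 / φ x) z.1 * φ (z.1 - z.2))
        + k z.2 * ((fun x => ‖u x‖ₑ ^ 2 / φ x) (z.1 - z.2) * φ z.1)) ∂(volume.prod volume) := by
    refine lintegral_mono fun z => ?_
    rw [← mul_add, ← mul_add, ← mul_add]
    exact mul_le_mul_right (sq_add_sq_le_jacobi (u z.1) (u (z.1 - z.2)) (hφ0 _) (hφt _) (hφ0 _)
      (hφt _)) _
  rw [lintegral_add_left m1, lintegral_add_right _ m3, lintegral_add_right _ m2, hX1, hX2, hY1,
    hY2] at hmain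
  set X := ∫⁻ x, (‖u x‖ₑ ^ 2 / φ x) * ∫⁻ h, k h * φ (x - h) with hX
  set Y := ∫⁻ x, ‖u x‖ₑ ^ 2 / φ x * q x with hY
  have hXY : Y + X = ∫⁻ x, ‖u x‖ₑ ^ 2 := by
    rw [hX, hY, ← lintegral_add_left m4]
    refine lintegral_congr fun x => ?_
    rw [← mul_add, ← h, ENNReal.div_mul_cancel (hφ0 x) (hφt x)]
  have hXfin : X ≠ ⊤ := ne_top_of_le_ne_top hu (hXY ▸ le_add_self)
  rw [← hXY] at hmain
  have h2X : X + X ≠ ⊤ := ENNReal.add_ne_top.2 ⟨hXfin, hXfin⟩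
  refine (ENNReal.add_le_add_iff_right h2X).1 ?_
  calc _ = Y + X + (Y + X) := by ring
    _ ≤ _ := hmain
    _ = _ := by ring

/-- A positive supersolution `φ = q + e^{tΔ} φ` of the heat semigroup bounds its Dirichlet form
from below (the ground state transform). -/
lemma lintegral_mul_div_le_of_supersolution {t : ℝ} (ht : 0 < t) {u : E d → ℂ} (hum : Measurable u)
    (hu : ∫⁻ x, ‖u x‖ₑ ^ 2 ≠ ⊤) {φ q : E d → ℝ≥0∞} (hφ : Measurable φ) (hq : Measurable q)
    (hφ0 : ∀ x, φ x ≠ 0) (hφt : ∀ x, φ x ≠ ⊤) (h : ∀ x, φ x = q x + heatAvg t φ x) :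
    2 * ∫⁻ x, ‖u x‖ₑ ^ 2 / φ x * q x ≤
      ∫⁻ z : E d × E d, ENNReal.ofReal (heat t z.2) * ‖u (z.1 - z.2) - u z.1‖ₑ ^ 2
        ∂(volume.prod volume) := by
  have hkm : Measurable fun h : E d => ENNReal.ofReal (heat t h) :=
    (measurable_heat_right t).ennreal_ofReal
  have hk1 : ∫⁻ h : E d, ENNReal.ofReal (heat t h) = 1 := (isDensity_heat ht).lintegral_eq_one
  have hke : ∀ h : E d, ENNReal.ofReal (heat t (-h)) = ENNReal.ofReal (heat t h) :=
    fun h => by simp [heat]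
  exact lintegral_mul_div_le_of_kernel_supersolution hkm hk1 hke hum hu hφ hq hφ0 hφt h

/-- Comparison of `∫ w |u|²` with its average against a translation kernel. -/
lemma lintegral_mul_sq_le_kernel {k : E d → ℝ≥0∞} (hkm : Measurable k)
    (hk1 : ∫⁻ h, k h = 1) (hke : ∀ h, k (-h) = k h) {u : E d → ℂ} (hum : Measurable u)
    {w : E d → ℝ≥0∞} (hw : Measurable w) {M : ℝ}
    (hM : ∀ x, w x ≤ ENNReal.ofReal M) {η : ℝ} (hη : 0 < η) :
    ∫⁻ x, w x * ‖u x‖ₑ ^ 2 ≤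
      ENNReal.ofReal (1 + η) * (∫⁻ x, ‖u x‖ₑ ^ 2 * ∫⁻ h, k h * w (x - h))
      + ENNReal.ofReal ((1 + 1 / η) * M) *
        ∫⁻ z : E d × E d, k z.2 * ‖u (z.1 - z.2) - u z.1‖ₑ ^ 2 ∂(volume.prod volume) := by
  have hum2 : Measurable fun x => ‖u x‖ₑ ^ 2 := hum.enorm.pow_const 2
  have hAm : Measurable fun x => w x * ‖u x‖ₑ ^ 2 := hw.mul hum2
  have e1 := lintegral_prod_kernel_fst hkm hk1 hAm
  have e2 := lintegral_prod_kernel_mul' hkm hum2 hw hke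
  have mB : Measurable fun z : E d × E d => k z.2 * (‖u (z.1 - z.2)‖ₑ ^ 2 * w z.1) := by fun_prop
  have mD : Measurable fun z : E d × E d => k z.2 * ‖u (z.1 - z.2) - u z.1‖ₑ ^ 2 := by fun_prop
  have pt : ∀ z : E d × E d, k z.2 * (w z.1 * ‖u z.1‖ₑ ^ 2) ≤
      ENNReal.ofReal (1 + η) * (k z.2 * (‖u (z.1 - z.2)‖ₑ ^ 2 * w z.1))
      + ENNReal.ofReal ((1 + 1 / η) * M) * (k z.2 * ‖u (z.1 - z.2) - u z.1‖ₑ ^ 2) := by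
    intro z
    have h1 : ‖u z.1‖ ^ 2 ≤ (1 + η) * ‖u (z.1 - z.2)‖ ^ 2
        + (1 + 1 / η) * ‖u (z.1 - z.2) - u z.1‖ ^ 2 := by
      have h2 := norm_sub_le (u (z.1 - z.2)) (u (z.1 - z.2) - u z.1)
      rw [sub_sub_cancel] at h2
      set a := ‖u (z.1 - z.2)‖
      set b := ‖u (z.1 - z.2) - u z.1‖
      have h3 : (1 + η) * a ^ 2 + (1 + 1 / η) * b ^ 2 - (a + b) ^ 2
          = (η * a - b) ^ 2 / η := by field_simp; ring
      have h4 : 0 ≤ (η * a - b) ^ 2 / η := by positivity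
      have h5 : ‖u z.1‖ ^ 2 ≤ (a + b) ^ 2 := by gcongr
      linarith
    have h2 := ENNReal.ofReal_le_ofReal h1
    rw [ENNReal.ofReal_add (by positivity) (by positivity), ENNReal.ofReal_mul (by positivity),
      ENNReal.ofReal_mul (by positivity), ENNReal.ofReal_pow (norm_nonneg _),
      ENNReal.ofReal_pow (norm_nonneg _), ENNReal.ofReal_pow (norm_nonneg _)] at h2
    simp only [ofReal_norm] at h2
    calc _ ≤ k z.2 * (w z.1 * (ENNReal.ofReal (1 + η) * ‖u (z.1 - z.2)‖ₑ ^ 2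
          + ENNReal.ofReal (1 + 1 / η) * ‖u (z.1 - z.2) - u z.1‖ₑ ^ 2)) := by gcongr
      _ = ENNReal.ofReal (1 + η) * (k z.2 * (‖u (z.1 - z.2)‖ₑ ^ 2 * w z.1))
          + ENNReal.ofReal (1 + 1 / η) * w z.1 * (k z.2 * ‖u (z.1 - z.2) - u z.1‖ₑ ^ 2) := by ring
      _ ≤ _ := by
          rw [ENNReal.ofReal_mul (by positivity)]
          gcongr
          exact hM _
  rw [← e1, ← e2, ← lintegral_const_mul _ mB, ← lintegral_const_mul _ mD,
    ← lintegral_add_left (mB.const_mul _)]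
  exact lintegral_mono pt

/-- The form bound behind the Kato class: a bounded weight with Newton potential at most `K`
satisfies `∫ w |u|² ≤ K ‖∇u‖²`. -/
lemma lintegral_mul_le_of_newtonPot_le {w : E d → ℝ≥0∞} (hw : Measurable w) {M : ℝ}
    (hM0 : 0 ≤ M) (hM : ∀ x, w x ≤ ENNReal.ofReal M) {K : ℝ} (hK0 : 0 ≤ K)
    (hK : ∀ x, newtonPot w x ≤ ENNReal.ofReal K) {u : E d → ℂ} (hum : Measurable u)
    (hu : MemH1 u) : ∫⁻ x, w x * ‖u x‖ₑ ^ 2 ≤ ENNReal.ofReal (K * gradSq u) := by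
  have hum2 : Measurable fun x => ‖u x‖ₑ ^ 2 := hum.enorm.pow_const 2
  have hu2 : ∫⁻ x, ‖u x‖ₑ ^ 2 ≠ ⊤ := by
    rw [lintegral_enorm_sq hu.1]; exact ENNReal.ofReal_ne_top
  set g := gradSq u with hg
  have hg0 : 0 ≤ g := gradSq_nonneg u
  -- the constant `δ` keeps the supersolution away from zero
  have hpotUpTo : ∀ δ > 0, ∀ t > 0, ∫⁻ x, ‖u x‖ₑ ^ 2 * newtonPotUpTo t w x
      ≤ ENNReal.ofReal ((K + δ) * (t * g)) := by
    intro δ hδ t ht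
    set φ : E d → ℝ≥0∞ := fun x => newtonPot w x + ENNReal.ofReal δ with hφ
    have hφm : Measurable φ := (measurable_newtonPot hw).add measurable_const
    have hφle : ∀ x, φ x ≤ ENNReal.ofReal (K + δ) := fun x => by
      rw [ENNReal.ofReal_add hK0 hδ.le]; exact add_le_add_left (hK x) _
    have hφ0 : ∀ x, φ x ≠ 0 := fun x => by
      have : ENNReal.ofReal δ ≠ 0 := (ENNReal.ofReal_pos.2 hδ).ne'
      simp only [hφ, ne_eq, add_eq_zero, this, and_false, not_false_eq_true]
    have hφt : ∀ x, φ x ≠ ⊤ := fun x => ne_top_of_le_ne_top ENNReal.ofReal_ne_top (hφle x)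
    have hsup : ∀ x, φ x = newtonPotUpTo t w x + heatAvg t φ x := by
      intro x
      have e : heatAvg t φ x = heatAvg t (newtonPot w) x + ENNReal.ofReal δ := by
        conv_rhs => rw [← heatAvg_const ht (ENNReal.ofReal δ) x]
        simp only [heatAvg, hφ, mul_add]
        have m1 := measurable_newtonPot hw
        have m2 := (measurable_heat_right (d := d) t).ennreal_ofReal
        have m3 : Measurable fun h : E d => ENNReal.ofReal (heat t h) * newtonPot w (x - h) := by
          fun_prop
        exact lintegral_add_left m3 _
      rw [e, ← add_assoc, ← newtonPot_eq ht hw]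
    have h1 := lintegral_mul_div_le_of_supersolution ht hum hu2 hφm
      (measurable_newtonPotUpTo t hw) hφ0 hφt hsup
    have h2 := h1.trans (hu.lintegral_heat_diff_le ht)
    have h3 : ∫⁻ x, ‖u x‖ₑ ^ 2 / φ x * newtonPotUpTo t w x ≤ ENNReal.ofReal (t * g) := by
      rw [mul_assoc, ENNReal.ofReal_mul (by norm_num), ENNReal.ofReal_ofNat] at h2
      exact (ENNReal.mul_le_mul_iff_right (by norm_num) (by norm_num)).1 h2
    calc _ ≤ ∫⁻ x, ENNReal.ofReal (K + δ) * (‖u x‖ₑ ^ 2 / φ x * newtonPotUpTo t w x) := by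
          refine lintegral_mono fun x => ?_
          rw [← mul_assoc]
          gcongr
          calc ‖u x‖ₑ ^ 2 = φ x * (‖u x‖ₑ ^ 2 / φ x) := (ENNReal.mul_div_cancel (hφ0 x) (hφt x)).symm
            _ ≤ _ := by gcongr; exact hφle x
      _ = ENNReal.ofReal (K + δ) * ∫⁻ x, ‖u x‖ₑ ^ 2 / φ x * newtonPotUpTo t w x :=
          lintegral_const_mul _ ((hum2.div hφm).mul (measurable_newtonPotUpTo t hw))
      _ ≤ _ := by
          rw [ENNReal.ofReal_mul (by positivity)]
          gcongr
  set A := ∫⁻ x, w x * ‖u x‖ₑ ^ 2 with hA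
  have hAm : Measurable fun x => w x * ‖u x‖ₑ ^ 2 := hw.mul hum2
  -- comparison of `w |u|²` with its heat average at a fixed time
  have hcompare : ∀ η > 0, ∀ s > 0, A ≤ ENNReal.ofReal (1 + η) * (∫⁻ x, ‖u x‖ₑ ^ 2 * heatAvg s w x)
      + ENNReal.ofReal ((1 + 1 / η) * M * (2 * s * g)) := by
    intro η hη s hs
    have e := lintegral_mul_sq_le_kernel (measurable_heat_right s).ennreal_ofReal
      (isDensity_heat hs).lintegral_eq_one (fun h => by simp [heat]) hum hw hM hη
    refine e.trans ?_
    rw [ENNReal.ofReal_mul (p := (1 + 1 / η) * M) (by positivity)]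
    gcongr ?_ + ENNReal.ofReal ((1 + 1 / η) * M) * ?_
    · exact le_rfl
    · exact hu.lintegral_heat_diff_le hs
  -- averaging over the times in `(0, t]`
  have haverage : ∀ η > 0, ∀ δ > 0, ∀ t > 0, A ≤ ENNReal.ofReal ((1 + η) * ((K + δ) * g)
      + (1 + 1 / η) * M * (2 * t * g)) := by
    intro η hη δ hδ t ht
    have h1 : ENNReal.ofReal t * A ≤ ∫⁻ s in Set.Ioc (0 : ℝ) t,
        (ENNReal.ofReal (1 + η) * (∫⁻ x, ‖u x‖ₑ ^ 2 * heatAvg s w x)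
          + ENNReal.ofReal ((1 + 1 / η) * M * (2 * t * g))) := by
      have : ENNReal.ofReal t * A = ∫⁻ s in Set.Ioc (0 : ℝ) t, A := by
        rw [setLIntegral_const, Real.volume_Ioc, sub_zero, mul_comm]
      rw [this]
      refine setLIntegral_mono' measurableSet_Ioc fun s hs => (hcompare η hη s hs.1).trans ?_
      gcongr
      exact hs.2
    have mE : Measurable fun p : ℝ × E d => ‖u p.2‖ₑ ^ 2 * heatAvg p.1 w p.2 :=
      (by fun_prop : Measurable fun p : ℝ × E d => ‖u p.2‖ₑ ^ 2).mul (measurable_heatAvg hw)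
    have mF : ∀ x, Measurable fun s => heatAvg s w x := fun x =>
      measurable_heatAvg_comp hw measurable_id measurable_const
    have mG : Measurable fun s => ∫⁻ x, ‖u x‖ₑ ^ 2 * heatAvg s w x := mE.lintegral_prod_right'
    have h2 : ∫⁻ s in Set.Ioc (0 : ℝ) t, ∫⁻ x, ‖u x‖ₑ ^ 2 * heatAvg s w x
        = ∫⁻ x, ‖u x‖ₑ ^ 2 * newtonPotUpTo t w x := by
      rw [lintegral_lintegral_swap mE.aemeasurable]
      refine lintegral_congr fun x => ?_
      rw [newtonPotUpTo, lintegral_const_mul _ (mF x)]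
    rw [lintegral_add_right _ measurable_const, lintegral_const_mul _ mG, h2,
      setLIntegral_const, Real.volume_Ioc, sub_zero] at h1
    have h3 : ENNReal.ofReal t * A ≤ ENNReal.ofReal t * ENNReal.ofReal ((1 + η) * ((K + δ) * g)
      + (1 + 1 / η) * M * (2 * t * g)) := by
      refine h1.trans ?_
      rw [← ENNReal.ofReal_mul ht.le]
      calc _ ≤ ENNReal.ofReal (1 + η) * ENNReal.ofReal ((K + δ) * (t * g))
            + ENNReal.ofReal ((1 + 1 / η) * M * (2 * t * g)) * ENNReal.ofReal t := by
            gcongr; exact hpotUpTo δ hδ t ht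
        _ = _ := by
            rw [← ENNReal.ofReal_mul (by positivity), ← ENNReal.ofReal_mul (by positivity),
              ← ENNReal.ofReal_add (by positivity) (by positivity)]
            congr 1; ring
    exact (ENNReal.mul_le_mul_iff_right (ENNReal.ofReal_pos.2 ht).ne' ENNReal.ofReal_ne_top).1 h3
  have hAfin : A ≠ ⊤ := ne_top_of_le_ne_top ENNReal.ofReal_ne_top (haverage 1 one_pos 1 one_pos 1 one_pos)
  rw [← ENNReal.ofReal_toReal hAfin]
  refine ENNReal.ofReal_le_ofReal ?_
  have hreal : ∀ η > 0, ∀ δ > 0, ∀ t > 0, A.toReal ≤ (1 + η) * ((K + δ) * g)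
      + (1 + 1 / η) * M * (2 * t * g) := fun η hη δ hδ t ht =>
    ENNReal.toReal_le_of_le_ofReal (by positivity) (haverage η hη δ hδ t ht)
  have hsmall_time : ∀ η > 0, ∀ δ > 0, A.toReal ≤ (1 + η) * ((K + δ) * g) := by
    intro η hη δ hδ
    have hc : Tendsto (fun t : ℝ => (1 + η) * ((K + δ) * g) + (1 + 1 / η) * M * (2 * t * g))
        (𝓝[>] 0) (𝓝 ((1 + η) * ((K + δ) * g) + (1 + 1 / η) * M * (2 * 0 * g))) :=
      (Continuous.tendsto (by fun_prop) 0).mono_left nhdsWithin_le_nhds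
    have := ge_of_tendsto hc (eventually_mem_nhdsWithin.mono fun t ht => hreal η hη δ hδ t ht)
    simpa using this
  have hc : Tendsto (fun t : ℝ => (1 + t) * ((K + t) * g)) (𝓝[>] 0) (𝓝 ((1 + 0) * ((K + 0) * g))) :=
    (Continuous.tendsto (by fun_prop) 0).mono_left nhdsWithin_le_nhds
  have := ge_of_tendsto hc (eventually_mem_nhdsWithin.mono fun t ht => hsmall_time t ht t ht)
  simpa using this

lemma newtonConst_pos (hd : 3 ≤ d) : 0 < newtonConst d := by
  have hd' : (3 : ℝ) ≤ d := by exact_mod_cast hd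
  have : 0 < Real.Gamma ((d : ℝ) / 2) := Real.Gamma_pos_of_pos (by linarith)
  have h2 : (0 : ℝ) < (d : ℝ) - 2 := by linarith
  unfold newtonConst; positivity

/-- `∫ |U| |u|² ≤ C_d ‖U‖_𝒦 ‖∇u‖²`. -/
lemma lintegral_mul_sq_le_katoNorm (hd : 3 ≤ d) {U : E d → ℝ} (hU : AEMeasurable U volume)
    (hK : katoNorm U ≠ ⊤) {u : E d → ℂ} (hu : MemH1 u) :
    ∫⁻ x, ‖U x‖ₑ * ‖u x‖ₑ ^ 2 ≤
      ENNReal.ofReal (newtonConst d * (katoNorm U).toReal * gradSq u) := by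
  have hN : 0 ≤ newtonConst d := (newtonConst_pos hd).le
  set w : E d → ℝ≥0∞ := fun x => ‖hU.mk U x‖ₑ with hw
  have hwm : Measurable w := hU.measurable_mk.enorm
  have hwe : ∀ᵐ x, ‖U x‖ₑ = w x := hU.ae_eq_mk.mono fun x hx => by rw [hw, hx]
  set v : E d → ℂ := hu.1.1.mk u with hv
  have hvm : Measurable v := hu.1.1.stronglyMeasurable_mk.measurable
  have huv : u =ᵐ[volume] v := hu.1.1.ae_eq_mk
  have hvH : MemH1 v := (hu.hasGrad.congr huv).memH1
  have hkat : ∀ x : E d, ∫⁻ y, w y / ‖x - y‖ₑ ^ (d - 2) ≤ katoNorm U := by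
    intro x
    refine le_trans (le_of_eq ?_) (le_iSup (fun x : E d => ∫⁻ y, ‖U y‖ₑ / ‖x - y‖ₑ ^ (d - 2)) x)
    exact lintegral_congr_ae (hwe.mono fun y hy => by simp only [hy])
  have e : ∫⁻ x, ‖U x‖ₑ * ‖u x‖ₑ ^ 2 = ∫⁻ x, w x * ‖v x‖ₑ ^ 2 := by
    refine lintegral_congr_ae ?_
    filter_upwards [hwe, huv] with x h1 h2
    rw [h1, h2]
  rw [e, ← hu.hasGrad.gradSq_congr huv]
  -- monotone convergence along the truncations `min w n`
  have hmono : ∫⁻ x, w x * ‖v x‖ₑ ^ 2 = ⨆ n : ℕ, ∫⁻ x, min (w x) n * ‖v x‖ₑ ^ 2 := by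
    rw [← lintegral_iSup]
    · refine lintegral_congr fun x => ?_
      rw [← ENNReal.iSup_mul]
      congr 1
      refine le_antisymm ?_ (iSup_le fun n => min_le_left _ _)
      obtain ⟨n, hn⟩ := ENNReal.exists_nat_gt (r := w x) (by simp [hw])
      exact le_iSup_of_le n (by rw [min_eq_left hn.le])
    · exact fun n => (hwm.min measurable_const).mul (hvm.enorm.pow_const 2)
    · intro m n hmn x
      dsimp only
      gcongr
  rw [hmono]
  refine iSup_le fun n => ?_
  refine lintegral_mul_le_of_newtonPot_le (hwm.min measurable_const) (M := n) (by positivity)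
    (fun x => ?_) (by positivity) (fun x => ?_) hvm hvH
  · rw [ENNReal.ofReal_natCast]; exact min_le_right _ _
  · refine (newtonPot_le hd (hwm.min measurable_const) x).trans ?_
    rw [ENNReal.ofReal_mul hN, ENNReal.ofReal_toReal hK]
    gcongr
    refine iSup_le fun x => le_trans (lintegral_mono fun y => ?_) (hkat x)
    gcongr
    exact min_le_left _ _

/-! ### The Hartree form -/

/-- The Riesz kernel `|z|^{-γ}`. -/
def rieszKernel (γ : ℝ) (z : E d) : ℝ := (‖z‖ ^ γ)⁻¹

lemma rieszKernel_nonneg (γ : ℝ) (z : E d) : 0 ≤ rieszKernel γ z := by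
  unfold rieszKernel; positivity

lemma rieszKernel_neg (γ : ℝ) (z : E d) : rieszKernel γ (-z) = rieszKernel γ z := by
  simp [rieszKernel]

lemma measurable_rieszKernel (γ : ℝ) : Measurable (rieszKernel (d := d) γ) := by
  unfold rieszKernel; fun_prop

lemma rieszKernel_le {γ L : ℝ} (hγ : 0 < γ) (hL : 0 < L) {z : E d} (hz : L ≤ ‖z‖) :
    rieszKernel γ z ≤ L ^ (-γ) := by
  rw [rieszKernel, Real.rpow_neg hL.le]
  gcongr

lemma lintegral_ball_rieszKernel_rpow_ne_top (hd : 0 < d) {γ a : ℝ} (ha : 0 ≤ a)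
    (h : a * γ < d) : ∫⁻ z in Metric.ball (0 : E d) 1, ‖rieszKernel γ z‖ₑ ^ a ≠ ⊤ := by
  have : Nontrivial (E d) := by
    have : Nonempty (Fin d) := ⟨⟨0, hd⟩⟩
    infer_instance
  have h1 : Integrable (fun z : E d => Set.indicator (Set.Iio 1) (fun r : ℝ => r ^ (-(a * γ))) ‖z‖)
      volume := by
    rw [integrable_fun_norm_addHaar]
    have e : (fun y : ℝ => y ^ (Module.finrank ℝ (E d) - 1) •
        Set.indicator (Set.Iio 1) (fun r : ℝ => r ^ (-(a * γ))) y)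
        = Set.indicator (Set.Iio 1) (fun y : ℝ => y ^ (Module.finrank ℝ (E d) - 1) *
          y ^ (-(a * γ))) := by
      ext y
      by_cases hy : y ∈ Set.Iio (1 : ℝ) <;> simp [hy]
    rw [e, IntegrableOn, integrable_indicator_iff measurableSet_Iio, IntegrableOn,
      Measure.restrict_restrict measurableSet_Iio]
    have h2 : IntervalIntegrable (fun y : ℝ => y ^ ((d : ℝ) - 1 - a * γ)) volume 0 1 :=
      intervalIntegral.intervalIntegrable_rpow' (by linarith)
    rw [intervalIntegrable_iff_integrableOn_Ioo_of_le zero_le_one] at h2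
    have e2 : Set.Iio (1 : ℝ) ∩ Set.Ioi 0 = Set.Ioo 0 1 := by ext; simp [and_comm]
    rw [e2]
    refine h2.congr_fun (fun y hy => ?_) measurableSet_Ioo
    have hy0 : (0 : ℝ) < y := hy.1
    simp only [finrank_euclideanSpace, Fintype.card_fin]
    rw [← Real.rpow_natCast, ← Real.rpow_add hy0]
    congr 1
    rw [Nat.cast_sub hd]; push_cast; ring
  have h3 := h1.hasFiniteIntegral
  rw [hasFiniteIntegral_iff_enorm] at h3
  refine ne_top_of_le_ne_top h3.ne ?_
  rw [← lintegral_indicator measurableSet_ball]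
  refine lintegral_mono fun z => ?_
  by_cases hz : z ∈ Metric.ball (0 : E d) 1
  · have hz' : ‖z‖ < 1 := by simpa using hz
    rw [Set.indicator_of_mem hz, Set.indicator_of_mem (by simpa using hz')]
    refine le_of_eq ?_
    rw [Real.enorm_of_nonneg (rieszKernel_nonneg _ _), Real.enorm_of_nonneg (by positivity),
      ENNReal.ofReal_rpow_of_nonneg (rieszKernel_nonneg _ _) ha, rieszKernel,
      Real.inv_rpow (by positivity), ← Real.rpow_mul (norm_nonneg _),
      Real.rpow_neg (norm_nonneg _), mul_comm γ a]
  · rw [Set.indicator_of_notMem hz]; exact zero_le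

/-- Young's inequality for the trilinear form `∬ F(x) G(y) K(x - y)`, with equal exponents
`p = 2a/(2a-1)` on `F` and `G`. -/
lemma lintegral_mul_mul_kernel_le {F G K : E d → ℝ≥0∞} (hF : AEMeasurable F volume)
    (hG : AEMeasurable G volume) (hK : Measurable K) {a p : ℝ} (ha : 1 ≤ a)
    (hp : p * (1 - 1 / (2 * a)) = 1) :
    ∫⁻ z : E d × E d, F z.1 * G z.2 * K (z.1 - z.2) ∂(volume.prod volume) ≤
      ((∫⁻ x, F x ^ p) * ∫⁻ x, G x ^ p) ^ (1 - 1 / (2 * a)) * (∫⁻ z, K z ^ a) ^ (1 / a) := by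
  have ha0 : 0 < a := by linarith
  set b := 1 / (2 * a) with hb
  have hb0 : 0 < b := by positivity
  have hb2 : b ≤ 1 / 2 := by rw [hb]; gcongr; linarith
  have hp0 : 0 < p := by
    by_contra h
    nlinarith
  set ρ := ∫⁻ z, K z ^ a with hρ
  have hFm : AEMeasurable (fun z : E d × E d => F z.1) (volume.prod volume) := hF.comp_fst
  have hGm : AEMeasurable (fun z : E d × E d => G z.2) (volume.prod volume) := hG.comp_snd
  have hKm : Measurable fun z : E d × E d => K (z.1 - z.2) := by fun_prop
  have I1 : ∫⁻ z : E d × E d, F z.1 ^ p * G z.2 ^ p ∂(volume.prod volume)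
      = (∫⁻ x, F x ^ p) * ∫⁻ x, G x ^ p := lintegral_prod_mul (hF.pow_const p) (hG.pow_const p)
  have I2 : ∫⁻ z : E d × E d, F z.1 ^ p * K (z.1 - z.2) ^ a ∂(volume.prod volume)
      = (∫⁻ x, F x ^ p) * ρ := by
    have mm : AEMeasurable (fun z : E d × E d => F z.1 ^ p * K (z.1 - z.2) ^ a)
      (volume.prod volume) := by fun_prop
    rw [lintegral_prod _ mm,
      ← lintegral_mul_const'' _ (hF.pow_const p)]
    refine lintegral_congr fun x => ?_
    have m : Measurable fun y => K (x - y) ^ a := by fun_prop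
    simp only
    rw [lintegral_const_mul _ m, lintegral_sub_left_eq_self (fun y => K y ^ a) x]
  have I3 : ∫⁻ z : E d × E d, G z.2 ^ p * K (z.1 - z.2) ^ a ∂(volume.prod volume)
      = (∫⁻ x, G x ^ p) * ρ := by
    have mm : AEMeasurable (fun z : E d × E d => G z.2 ^ p * K (z.1 - z.2) ^ a)
      (volume.prod volume) := by fun_prop
    rw [lintegral_prod_symm _ mm,
      ← lintegral_mul_const'' _ (hG.pow_const p)]
    refine lintegral_congr fun y => ?_
    have m : Measurable fun x => K (x - y) ^ a := by fun_prop
    simp only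
    rw [lintegral_const_mul _ m, lintegral_sub_right_eq_self (fun y => K y ^ a) y]
  have H := ENNReal.lintegral_prod_norm_pow_le (μ := (volume : Measure (E d)).prod volume)
    (Finset.univ : Finset (Fin 3))
    (f := ![fun z => F z.1 ^ p * G z.2 ^ p, fun z => F z.1 ^ p * K (z.1 - z.2) ^ a,
      fun z => G z.2 ^ p * K (z.1 - z.2) ^ a]) (p := ![1 - 2 * b, b, b])
    (by
      intro i _
      fin_cases i
      · exact (hFm.pow_const p).mul (hGm.pow_const p)
      · exact (hFm.pow_const p).mul (hKm.pow_const a).aemeasurable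
      · exact (hGm.pow_const p).mul (hKm.pow_const a).aemeasurable)
    (by simp [Fin.sum_univ_three]; ring)
    (by intro i _; fin_cases i <;> simp <;> linarith)
  simp only [Fin.prod_univ_three, Matrix.cons_val_zero, Matrix.cons_val_one, Matrix.cons_val,
    I1, I2, I3] at H
  have hb3 : a * b + a * b = 1 := by rw [hb]; field_simp; norm_num
  have hb4 : b + b = 1 / a := by rw [hb]; field_simp; norm_num
  have hb5 : p * (1 - 2 * b) + p * b = 1 := by linarith
  have e1 : ∀ X Y Z : ℝ≥0∞, (X ^ p * Y ^ p) ^ (1 - 2 * b) * (X ^ p * Z ^ a) ^ b *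
      (Y ^ p * Z ^ a) ^ b = X * Y * Z := by
    intro X Y Z
    have hx : ∀ X : ℝ≥0∞, X ^ (p * (1 - 2 * b)) * X ^ (p * b) = X := fun X => by
      rw [← ENNReal.rpow_add_of_nonneg _ _ (by nlinarith) (by positivity), hb5, ENNReal.rpow_one]
    have hz : Z ^ (a * b) * Z ^ (a * b) = Z := by
      rw [← ENNReal.rpow_add_of_nonneg _ _ (by positivity) (by positivity), hb3, ENNReal.rpow_one]
    rw [ENNReal.mul_rpow_of_nonneg _ _ (by linarith), ENNReal.mul_rpow_of_nonneg _ _ hb0.le,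
      ENNReal.mul_rpow_of_nonneg _ _ hb0.le, ← ENNReal.rpow_mul, ← ENNReal.rpow_mul,
      ← ENNReal.rpow_mul, ← ENNReal.rpow_mul, ← ENNReal.rpow_mul]
    calc _ = (X ^ (p * (1 - 2 * b)) * X ^ (p * b)) * (Y ^ (p * (1 - 2 * b)) * Y ^ (p * b)) *
          (Z ^ (a * b) * Z ^ (a * b)) := by ring
      _ = _ := by rw [hx, hx, hz]
  have e2 : ∀ X Y : ℝ≥0∞, (X * Y) ^ (1 - 2 * b) * (X * ρ) ^ b * (Y * ρ) ^ b
      = (X * Y) ^ (1 - b) * ρ ^ (1 / a) := by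
    intro X Y
    have hb6 : 1 - b = (1 - 2 * b) + b := by ring
    rw [← hb4, hb6, ENNReal.rpow_add_of_nonneg _ _ (by linarith) hb0.le,
      ENNReal.rpow_add_of_nonneg _ _ hb0.le hb0.le, ENNReal.mul_rpow_of_nonneg _ _ hb0.le,
      ENNReal.mul_rpow_of_nonneg _ _ hb0.le, ENNReal.mul_rpow_of_nonneg _ _ hb0.le]
    ring
  simp only [e1, e2] at H
  exact H

/-- The exponent `d/(d-2)`; for `u ∈ H¹`, the density `|u|²` lies in `L¹ ∩ L^{d/(d-2)}`. -/
def densExp (d : ℕ) : ℝ := (d : ℝ) / ((d : ℝ) - 2)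

/-- The size `∫ |f| + ∫ |f|^{d/(d-2)}` of a density. -/
def densNorm (f : E d → ℝ) : ℝ≥0∞ := (∫⁻ x, ‖f x‖ₑ) + ∫⁻ x, ‖f x‖ₑ ^ densExp d

/-- The densities for which the Hartree form is defined: `f ∈ L¹ ∩ L^{d/(d-2)}`. -/
def IsDens (f : E d → ℝ) : Prop := AEStronglyMeasurable f volume ∧ densNorm f ≠ ⊤

lemma exists_young_exponents (hd : 3 ≤ d) {γ : ℝ} (h : γ < min 4 (d : ℝ)) :
    ∃ a p : ℝ, 1 ≤ a ∧ a * γ < d ∧ p * (1 - 1 / (2 * a)) = 1 ∧ 1 ≤ p ∧ p ≤ densExp d := by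
  have hd' : (3 : ℝ) ≤ d := by exact_mod_cast hd
  have h4 := lt_of_lt_of_le h (min_le_left _ _)
  have h5 := lt_of_lt_of_le h (min_le_right _ _)
  have hd2 : (0 : ℝ) < (d : ℝ) - 2 := by linarith
  rcases le_or_gt 4 (d : ℝ) with h6 | h6
  · refine ⟨d / 4, d / (d - 2), by linarith, by nlinarith, ?_, ?_, le_rfl⟩
    · field_simp; ring
    · rw [le_div_iff₀ hd2]; linarith
  · refine ⟨1, 2, le_rfl, by linarith, by norm_num, by norm_num, ?_⟩
    rw [densExp, le_div_iff₀ hd2]; linarith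

lemma lintegral_rpow_le_densNorm {f : E d → ℝ} {p : ℝ} (hp : 1 ≤ p) (hp' : p ≤ densExp d)
    (hf : AEStronglyMeasurable f volume) : ∫⁻ x, ‖f x‖ₑ ^ p ≤ densNorm f := by
  rw [densNorm, ← lintegral_add_left' hf.enorm]
  refine lintegral_mono fun x => ?_
  rcases le_total ‖f x‖ₑ 1 with h | h
  · exact (ENNReal.rpow_le_rpow_of_exponent_ge h hp).trans (by simp)
  · exact (ENNReal.rpow_le_rpow_of_exponent_le h hp').trans le_add_self

/-- The Hartree form of two densities is controlled, up to a small error, by their local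
correlation `∫ |f(x)| ∫_{B(x,L)} |g|`: near the diagonal this is Young's inequality with an
integrable power of the kernel, and far from it the kernel is small. -/
lemma exists_lintegral_hartree_le (hd : 3 ≤ d) {γ : ℝ} (h0 : 0 < γ) (h : γ < min 4 (d : ℝ))
    {ε M : ℝ} (hε : 0 < ε) (hM : 0 ≤ M) :
    ∃ C L : ℝ, 0 ≤ C ∧ 0 < L ∧ ∀ f g : E d → ℝ, AEStronglyMeasurable f volume →
      AEStronglyMeasurable g volume → densNorm f ≤ ENNReal.ofReal M →
      densNorm g ≤ ENNReal.ofReal M →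
      ∫⁻ z : E d × E d, ‖f z.1‖ₑ * ‖g z.2‖ₑ * ‖rieszKernel γ (z.1 - z.2)‖ₑ ∂(volume.prod volume) ≤
        ENNReal.ofReal ε + ENNReal.ofReal C *
          ∫⁻ x, ‖f x‖ₑ * ∫⁻ y in Metric.ball x L, ‖g y‖ₑ := by
  obtain ⟨a, p, ha, haγ, hp, hp1, hp2⟩ := exists_young_exponents hd h
  have ha0 : 0 < a := by linarith
  have hfin := lintegral_ball_rieszKernel_rpow_ne_top (by omega : 0 < d) ha0.le haγ
  have hb : 0 ≤ 1 - 1 / (2 * a) := by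
    by_contra hc
    nlinarith
  set c : ℝ≥0∞ := (ENNReal.ofReal M * ENNReal.ofReal M) ^ (1 - 1 / (2 * a)) with hc
  have hc' : c ≠ ⊤ := ENNReal.rpow_ne_top_of_nonneg hb (by finiteness)
  -- a radius making the near part of the kernel small
  have hδ : ∃ δ > 0, δ ≤ 1 ∧ c * (∫⁻ z in Metric.ball (0 : E d) δ,
      ‖rieszKernel γ z‖ₑ ^ a) ^ (1 / a) ≤ ENNReal.ofReal (ε / 2) := by
    have hv : Tendsto (fun δ : ℝ => volume (Metric.ball (0 : E d) δ)) (𝓝[>] 0) (𝓝 0) := by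
      have : Nonempty (Fin d) := ⟨⟨0, by omega⟩⟩
      simp only [EuclideanSpace.volume_ball]
      have : Tendsto (fun δ : ℝ => ENNReal.ofReal δ ^ Fintype.card (Fin d) *
        ENNReal.ofReal (√Real.pi ^ Fintype.card (Fin d) /
          Real.Gamma ((Fintype.card (Fin d) : ℝ) / 2 + 1))) (𝓝[>] 0) (𝓝 (ENNReal.ofReal 0 ^ Fintype.card (Fin d) *
        ENNReal.ofReal (√Real.pi ^ Fintype.card (Fin d) /
          Real.Gamma ((Fintype.card (Fin d) : ℝ) / 2 + 1)))) := by
        refine ENNReal.Tendsto.mul_const ?_ (Or.inr ENNReal.ofReal_ne_top)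
        refine ENNReal.Tendsto.pow ?_
        exact (ENNReal.continuous_ofReal.tendsto 0).mono_left nhdsWithin_le_nhds
      have hd0 : d ≠ 0 := by omega
      simpa [hd0] using this
    have h1 : Tendsto (fun δ : ℝ => ∫⁻ z in Metric.ball (0 : E d) δ ∩ Metric.ball 0 1,
        ‖rieszKernel γ z‖ₑ ^ a) (𝓝[>] 0) (𝓝 0) := by
      have := tendsto_setLIntegral_zero (s := fun δ : ℝ => Metric.ball (0 : E d) δ) (l := 𝓝[>] 0)
        hfin (tendsto_of_tendsto_of_tendsto_of_le_of_le tendsto_const_nhds hv (fun _ => zero_le)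
          (fun δ => Measure.restrict_apply_le _ _))
      refine this.congr fun δ => ?_
      rw [Measure.restrict_restrict measurableSet_ball]
    have h2 : Tendsto (fun δ : ℝ => c * (∫⁻ z in Metric.ball (0 : E d) δ ∩ Metric.ball 0 1,
        ‖rieszKernel γ z‖ₑ ^ a) ^ (1 / a)) (𝓝[>] 0) (𝓝 0) := by
      have h3 := ENNReal.Tendsto.const_mul
        ((ENNReal.continuous_rpow_const (y := 1 / a)).tendsto _ |>.comp h1) (Or.inr hc')
      rw [ENNReal.zero_rpow_of_pos (by positivity), mul_zero] at h3
      exact h3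
    have h4 : ∀ᶠ δ : ℝ in 𝓝[>] 0, c * (∫⁻ z in Metric.ball (0 : E d) δ ∩ Metric.ball 0 1,
        ‖rieszKernel γ z‖ₑ ^ a) ^ (1 / a) < ENNReal.ofReal (ε / 2) :=
      h2.eventually_lt_const (ENNReal.ofReal_pos.2 (by positivity))
    obtain ⟨δ, h5, h6, h7⟩ := (h4.and (eventually_mem_nhdsWithin.and
      ((eventually_le_nhds (show (0 : ℝ) < 1 by norm_num)).filter_mono
        nhdsWithin_le_nhds))).exists
    refine ⟨δ, h6, h7, ?_⟩
    rw [Set.inter_eq_left.2 (Metric.ball_subset_ball h7)] at h5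
    exact h5.le
  obtain ⟨δ, hδ0, hδ1, hδ⟩ := hδ
  -- a radius making the far part of the kernel small
  obtain ⟨L, hL0, hL⟩ : ∃ L > 0, L ^ (-γ) * (M * M) ≤ ε / 2 := by
    have := (tendsto_rpow_neg_atTop h0).mul_const (M * M)
    rw [zero_mul] at this
    obtain ⟨L, h1, h2⟩ := ((this.eventually_lt_const (half_pos hε)).and
      (eventually_gt_atTop 0)).exists
    exact ⟨L, h2, h1.le⟩
  refine ⟨δ ^ (-γ), L, by positivity, hL0, fun f g hf hg hfM hgM => ?_⟩
  set Kδ : E d → ℝ≥0∞ := Set.indicator (Metric.ball 0 δ) (fun z => ‖rieszKernel γ z‖ₑ) with hKδ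
  have hKm : Measurable Kδ :=
    (measurable_rieszKernel γ).enorm.indicator measurableSet_ball
  set KL : E d → ℝ≥0∞ := Set.indicator (Metric.ball 0 L) 1 with hKL
  have hKLm : Measurable KL := measurable_one.indicator measurableSet_ball
  have hFm : AEMeasurable (fun z : E d × E d => ‖f z.1‖ₑ) (volume.prod volume) := hf.enorm.comp_fst
  have hGm : AEMeasurable (fun z : E d × E d => ‖g z.2‖ₑ) (volume.prod volume) := hg.enorm.comp_snd
  have hms : Measurable fun z : E d × E d => z.1 - z.2 := by fun_prop
  have pt : ∀ z : E d, ‖rieszKernel γ z‖ₑ ≤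
      Kδ z + ENNReal.ofReal (δ ^ (-γ)) * KL z + ENNReal.ofReal (L ^ (-γ)) := by
    intro z
    rw [Real.enorm_of_nonneg (rieszKernel_nonneg _ _)]
    by_cases h1 : ‖z‖ < δ
    · have : Kδ z = ENNReal.ofReal (rieszKernel γ z) := by
        rw [hKδ, Set.indicator_of_mem (by simpa using h1),
          Real.enorm_of_nonneg (rieszKernel_nonneg _ _)]
      rw [this, add_assoc]; exact le_self_add
    · by_cases h2 : ‖z‖ < L
      · have : KL z = 1 := by rw [hKL, Set.indicator_of_mem (by simpa using h2)]; rfl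
        rw [this, mul_one]
        refine le_trans ?_ le_self_add
        exact (ENNReal.ofReal_le_ofReal (rieszKernel_le h0 hδ0 (not_lt.1 h1))).trans le_add_self
      · exact (ENNReal.ofReal_le_ofReal (rieszKernel_le h0 hL0 (not_lt.1 h2))).trans le_add_self
  have mF : AEMeasurable (fun z : E d × E d => ‖f z.1‖ₑ * ‖g z.2‖ₑ) (volume.prod volume) :=
    hFm.mul hGm
  have mL : AEMeasurable (fun z : E d × E d => ‖f z.1‖ₑ * ‖g z.2‖ₑ * KL (z.1 - z.2))
      (volume.prod volume) := mF.mul (hKLm.comp hms).aemeasurable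
  have mδ : AEMeasurable (fun z : E d × E d => ‖f z.1‖ₑ * ‖g z.2‖ₑ * Kδ (z.1 - z.2))
      (volume.prod volume) := mF.mul (hKm.comp hms).aemeasurable
  have mc : AEMeasurable (fun z : E d × E d => ‖f z.1‖ₑ * ‖g z.2‖ₑ * ENNReal.ofReal (L ^ (-γ)))
      (volume.prod volume) := mF.mul_const _
  have near : ∫⁻ z : E d × E d, ‖f z.1‖ₑ * ‖g z.2‖ₑ * Kδ (z.1 - z.2) ∂(volume.prod volume)
      ≤ ENNReal.ofReal (ε / 2) := by
    refine (lintegral_mul_mul_kernel_le hf.enorm hg.enorm hKm ha hp).trans (le_trans ?_ hδ)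
    rw [hc]
    gcongr ?_ ^ (1 - 1 / (2 * a)) * ?_ ^ (1 / a)
    · gcongr
      · exact (lintegral_rpow_le_densNorm hp1 hp2 hf).trans hfM
      · exact (lintegral_rpow_le_densNorm hp1 hp2 hg).trans hgM
    · rw [← lintegral_indicator measurableSet_ball]
      refine le_of_eq (lintegral_congr fun z => ?_)
      by_cases hz : z ∈ Metric.ball (0 : E d) δ
      · rw [hKδ, Set.indicator_of_mem hz, Set.indicator_of_mem hz]
      · rw [hKδ, Set.indicator_of_notMem hz, Set.indicator_of_notMem hz,
          ENNReal.zero_rpow_of_pos ha0]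
  have mid : ∫⁻ z : E d × E d, ‖f z.1‖ₑ * ‖g z.2‖ₑ * KL (z.1 - z.2) ∂(volume.prod volume)
      = ∫⁻ x, ‖f x‖ₑ * ∫⁻ y in Metric.ball x L, ‖g y‖ₑ := by
    rw [lintegral_prod _ mL]
    refine lintegral_congr fun x => ?_
    have m : AEMeasurable (fun y => ‖g y‖ₑ * KL (x - y)) volume :=
      hg.enorm.mul (hKLm.comp (by fun_prop)).aemeasurable
    simp only [mul_assoc]
    rw [lintegral_const_mul'' _ m, ← lintegral_indicator measurableSet_ball]
    congr 1
    refine lintegral_congr fun y => ?_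
    by_cases hy : y ∈ Metric.ball x L
    · rw [Set.indicator_of_mem hy, hKL, Set.indicator_of_mem, Pi.one_apply, mul_one]
      rw [mem_ball_zero_iff, ← dist_eq_norm, dist_comm]; exact hy
    · rw [Set.indicator_of_notMem hy, hKL, Set.indicator_of_notMem, mul_zero]
      rw [mem_ball_zero_iff, ← dist_eq_norm, dist_comm]; exact hy
  have far : ∫⁻ z : E d × E d, ‖f z.1‖ₑ * ‖g z.2‖ₑ * ENNReal.ofReal (L ^ (-γ))
      ∂(volume.prod volume) ≤ ENNReal.ofReal (ε / 2) := by
    rw [lintegral_mul_const'' _ mF, lintegral_prod_mul hf.enorm hg.enorm, mul_comm]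
    calc _ ≤ ENNReal.ofReal (L ^ (-γ)) * (ENNReal.ofReal M * ENNReal.ofReal M) := by
          gcongr
          · exact le_self_add.trans hfM
          · exact le_self_add.trans hgM
      _ = ENNReal.ofReal (L ^ (-γ) * (M * M)) := by
          rw [ENNReal.ofReal_mul (by positivity), ENNReal.ofReal_mul hM]
      _ ≤ _ := ENNReal.ofReal_le_ofReal hL
  calc _ ≤ ∫⁻ z : E d × E d, (‖f z.1‖ₑ * ‖g z.2‖ₑ * Kδ (z.1 - z.2)
        + ENNReal.ofReal (δ ^ (-γ)) * (‖f z.1‖ₑ * ‖g z.2‖ₑ * KL (z.1 - z.2))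
        + ‖f z.1‖ₑ * ‖g z.2‖ₑ * ENNReal.ofReal (L ^ (-γ))) ∂(volume.prod volume) := by
        refine lintegral_mono fun z => ?_
        refine (mul_le_mul_right (pt (z.1 - z.2)) _).trans (le_of_eq ?_)
        ring
    _ = _ := by
        rw [lintegral_add_right' _ mc, lintegral_add_left' mδ, lintegral_const_mul'' _ mL]
    _ ≤ ENNReal.ofReal (ε / 2) + ENNReal.ofReal (δ ^ (-γ)) *
        (∫⁻ x, ‖f x‖ₑ * ∫⁻ y in Metric.ball x L, ‖g y‖ₑ) + ENNReal.ofReal (ε / 2) := by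
        rw [mid]; gcongr
    _ = _ := by
        rw [add_right_comm, ← ENNReal.ofReal_add (by positivity) (by positivity), add_halves]

/-- The range of parameters: `d ≥ 3` and `2 < γ < min {4, d}`. -/
structure IsExponent (d : ℕ) (γ : ℝ) : Prop where
  dim : 3 ≤ d
  two_lt : 2 < γ
  lt_min : γ < min 4 (d : ℝ)

lemma IsExponent.pos {γ : ℝ} (hγ : IsExponent d γ) : 0 < γ := by linarith [hγ.two_lt]

lemma IsExponent.lt_four {γ : ℝ} (hγ : IsExponent d γ) : γ < 4 :=
  lt_of_lt_of_le hγ.lt_min (min_le_left _ _)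

lemma one_le_densExp (hd : 3 ≤ d) : 1 ≤ densExp d := by
  have hd' : (3 : ℝ) ≤ d := by exact_mod_cast hd
  rw [densExp, le_div_iff₀ (by linarith)]; linarith

lemma densNorm_mono {f g : E d → ℝ} (hd : 3 ≤ d) (h : ∀ x, ‖g x‖ ≤ ‖f x‖) :
    densNorm g ≤ densNorm f := by
  have h1 := one_le_densExp hd
  have h2 : ∀ x, ‖g x‖ₑ ≤ ‖f x‖ₑ := fun x => enorm_le_iff_norm_le.2 (h x)
  unfold densNorm
  gcongr with x x
  · exact h2 x
  · exact h2 x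

lemma IsDens.mono (hd : 3 ≤ d) {f g : E d → ℝ} (hf : IsDens f) (hg : AEStronglyMeasurable g volume)
    (h : ∀ x, ‖g x‖ ≤ ‖f x‖) : IsDens g :=
  ⟨hg, ne_top_of_le_ne_top hf.2 (densNorm_mono hd h)⟩

lemma densNorm_add_le (hd : 3 ≤ d) {f g : E d → ℝ} (hf : AEStronglyMeasurable f volume) :
    densNorm (f + g) ≤ 2 ^ densExp d * (densNorm f + densNorm g) := by
  have h1 := one_le_densExp hd
  have h2 : (1 : ℝ≥0∞) ≤ 2 ^ densExp d := ENNReal.one_le_rpow (by norm_num) (by linarith)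
  have e1 : ∫⁻ x, ‖(f + g) x‖ₑ ≤ 2 ^ densExp d * (∫⁻ x, ‖f x‖ₑ) + 2 ^ densExp d * ∫⁻ x, ‖g x‖ₑ := by
    calc _ ≤ ∫⁻ x, (‖f x‖ₑ + ‖g x‖ₑ) := lintegral_mono fun x => enorm_add_le _ _
      _ = (∫⁻ x, ‖f x‖ₑ) + ∫⁻ x, ‖g x‖ₑ := lintegral_add_left' hf.enorm _
      _ ≤ _ := by
          gcongr <;> exact le_mul_of_one_le_left zero_le h2
  have e2 : ∫⁻ x, ‖(f + g) x‖ₑ ^ densExp d ≤ 2 ^ densExp d * (∫⁻ x, ‖f x‖ₑ ^ densExp d)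
      + 2 ^ densExp d * ∫⁻ x, ‖g x‖ₑ ^ densExp d := by
    have ht : (2 : ℝ≥0∞) ^ densExp d ≠ ⊤ := ENNReal.rpow_ne_top_of_nonneg (by linarith) (by simp)
    rw [← lintegral_const_mul' _ _ ht, ← lintegral_const_mul' _ _ ht,
      ← lintegral_add_left' ((hf.enorm.pow_const _).const_mul _)]
    refine lintegral_mono fun x => ?_
    calc ‖(f + g) x‖ₑ ^ densExp d ≤ (‖f x‖ₑ + ‖g x‖ₑ) ^ densExp d := by
          gcongr; exact enorm_add_le _ _
      _ ≤ 2 ^ (densExp d - 1) * (‖f x‖ₑ ^ densExp d + ‖g x‖ₑ ^ densExp d) :=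
          ENNReal.rpow_add_le_mul_rpow_add_rpow _ _ h1
      _ ≤ 2 ^ densExp d * (‖f x‖ₑ ^ densExp d + ‖g x‖ₑ ^ densExp d) := by
          gcongr
          · norm_num
          · linarith
      _ = _ := mul_add _ _ _
  calc _ ≤ _ := add_le_add e1 e2
    _ = _ := by unfold densNorm; ring

lemma IsDens.add (hd : 3 ≤ d) {f g : E d → ℝ} (hf : IsDens f) (hg : IsDens g) : IsDens (f + g) := by
  have h1 := one_le_densExp hd
  refine ⟨hf.1.add hg.1, ne_top_of_le_ne_top ?_ (densNorm_add_le hd hf.1)⟩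
  exact ENNReal.mul_ne_top (ENNReal.rpow_ne_top_of_nonneg (by linarith) (by simp))
    (ENNReal.add_ne_top.2 ⟨hf.2, hg.2⟩)

lemma densNorm_const_mul_le (hd : 3 ≤ d) (c : ℝ) (f : E d → ℝ) :
    densNorm (fun x => c * f x) ≤ (‖c‖ₑ + ‖c‖ₑ ^ densExp d) * densNorm f := by
  have h1 := one_le_densExp hd
  have ht : ‖c‖ₑ ^ densExp d ≠ ⊤ := ENNReal.rpow_ne_top_of_nonneg (by linarith) (by simp)
  simp only [densNorm, enorm_mul, ENNReal.mul_rpow_of_nonneg _ _ (by linarith : 0 ≤ densExp d)]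
  rw [lintegral_const_mul' _ _ (by simp), lintegral_const_mul' _ _ ht, mul_add]
  gcongr
  · exact le_self_add
  · exact le_add_self

lemma IsDens.const_mul (hd : 3 ≤ d) {f : E d → ℝ} (hf : IsDens f) (c : ℝ) :
    IsDens (fun x => c * f x) := by
  have h1 := one_le_densExp hd
  refine ⟨hf.1.const_mul c, ne_top_of_le_ne_top ?_ (densNorm_const_mul_le hd c f)⟩
  refine ENNReal.mul_ne_top (ENNReal.add_ne_top.2 ⟨by simp, ?_⟩) hf.2
  exact ENNReal.rpow_ne_top_of_nonneg (by linarith) (by simp)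

/-- Sobolev's inequality bounds the size of the density `|u|²` on bounded subsets of `H¹`. -/
lemma exists_densNorm_sq_le (hd : 3 ≤ d) (C : ℝ) : ∃ M : ℝ, 0 ≤ M ∧ ∀ u : E d → ℂ, MemH1 u →
    gradSq u ≤ C → massSq u ≤ C → densNorm (fun x => ‖u x‖ ^ 2) ≤ ENNReal.ofReal M := by
  have h1 := one_le_densExp hd
  have hd' : (3 : ℝ) ≤ d := by exact_mod_cast hd
  obtain ⟨K, hK⟩ := exists_sobolev hd
  set M : ℝ≥0∞ := ENNReal.ofReal C + (K * ENNReal.ofReal C) ^ densExp d with hM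
  have hMt : M ≠ ⊤ := by
    refine ENNReal.add_ne_top.2 ⟨by simp, ENNReal.rpow_ne_top_of_nonneg (by linarith) ?_⟩
    finiteness
  refine ⟨M.toReal, ENNReal.toReal_nonneg, fun u hu hg hm => ?_⟩
  rw [ENNReal.ofReal_toReal hMt, densNorm, hM]
  have e : ∀ x, ‖(‖u x‖ ^ 2 : ℝ)‖ₑ = ‖u x‖ₑ ^ 2 := fun x => by simp
  simp only [e]
  refine add_le_add ?_ ?_
  · rw [lintegral_enorm_sq hu.1]; exact ENNReal.ofReal_le_ofReal hm
  · have e2 : ∀ x, (‖u x‖ₑ ^ 2) ^ densExp d = ‖u x‖ₑ ^ (2 * d / ((d : ℝ) - 2)) := fun x => by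
      rw [← ENNReal.rpow_ofNat, ← ENNReal.rpow_mul, densExp, mul_div_assoc]
    simp only [e2]
    refine (hK u hu).trans ?_
    rw [← densExp]
    gcongr

lemma MemH1.isDens_sq (hd : 3 ≤ d) {u : E d → ℂ} (hu : MemH1 u) :
    IsDens (fun x => ‖u x‖ ^ 2) := by
  obtain ⟨M, _, hM⟩ := exists_densNorm_sq_le hd (max (gradSq u) (massSq u))
  exact ⟨hu.1.1.norm.pow 2, ne_top_of_le_ne_top ENNReal.ofReal_ne_top
    (hM u hu (le_max_left _ _) (le_max_right _ _))⟩

lemma MemH1.isDens_of_norm_le (hd : 3 ≤ d) {u v : E d → ℂ} (hu : MemH1 u) (hv : MemH1 v)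
    {f : E d → ℝ} (hf : AEStronglyMeasurable f volume) (h : ∀ x, ‖f x‖ ≤ ‖u x‖ * ‖v x‖) :
    IsDens f := by
  refine ((hu.isDens_sq hd).add hd (hv.isDens_sq hd)).mono hd hf fun x => (h x).trans ?_
  simp only [Pi.add_apply]
  rw [Real.norm_of_nonneg (by positivity)]
  nlinarith [sq_nonneg (‖u x‖ - ‖v x‖), sq_nonneg (‖u x‖), sq_nonneg (‖v x‖)]

lemma MemH1.isDens_re (hd : 3 ≤ d) {u v : E d → ℂ} (hu : MemH1 u) (hv : MemH1 v) :
    IsDens (fun x => (u x * conj (v x)).re) := by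
  refine hu.isDens_of_norm_le hd hv ?_ fun x => ?_
  · exact Complex.continuous_re.comp_aestronglyMeasurable (hu.1.1.mul hv.1.star.1)
  · exact (Complex.abs_re_le_norm _).trans (by simp)

/-- The Hartree form `∬ f(x) g(y) |x - y|^{-γ} dx dy`. -/
def hartreeForm (γ : ℝ) (f g : E d → ℝ) : ℝ :=
  ∫ z : E d × E d, f z.1 * g z.2 * rieszKernel γ (z.1 - z.2) ∂(volume.prod volume)

lemma exists_enorm_hartreeForm_le {γ : ℝ} (hγ : IsExponent d γ) {ε M : ℝ} (hε : 0 < ε)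
    (hM : 0 ≤ M) :
    ∃ C L : ℝ, 0 ≤ C ∧ 0 < L ∧ ∀ f g : E d → ℝ, AEStronglyMeasurable f volume →
      AEStronglyMeasurable g volume → densNorm f ≤ ENNReal.ofReal M →
      densNorm g ≤ ENNReal.ofReal M →
      ‖hartreeForm γ f g‖ₑ ≤ ENNReal.ofReal ε + ENNReal.ofReal C *
          ∫⁻ x, ‖f x‖ₑ * ∫⁻ y in Metric.ball x L, ‖g y‖ₑ := by
  obtain ⟨C, L, hC, hL, H⟩ := exists_lintegral_hartree_le hγ.dim hγ.pos hγ.lt_min hε hM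
  refine ⟨C, L, hC, hL, fun f g hf hg hfM hgM => le_trans ?_ (H f g hf hg hfM hgM)⟩
  refine (enorm_integral_le_lintegral_enorm _).trans (le_of_eq ?_)
  simp only [enorm_mul]

lemma IsDens.integrable_hartree {γ : ℝ} (hγ : IsExponent d γ) {f g : E d → ℝ} (hf : IsDens f)
    (hg : IsDens g) : Integrable (fun z : E d × E d => f z.1 * g z.2 * rieszKernel γ (z.1 - z.2))
      (volume.prod volume) := by
  have hm : Measurable fun z : E d × E d => rieszKernel γ (z.1 - z.2) :=
    (measurable_rieszKernel γ).comp (by fun_prop)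
  refine ⟨(hf.1.comp_fst.mul hg.1.comp_snd).mul hm.aestronglyMeasurable, ?_⟩
  set M := max (densNorm f).toReal (densNorm g).toReal with hMd
  have hM : 0 ≤ M := le_max_of_le_left ENNReal.toReal_nonneg
  have hfM : densNorm f ≤ ENNReal.ofReal M := by
    rw [← ENNReal.ofReal_toReal hf.2]; exact ENNReal.ofReal_le_ofReal (le_max_left _ _)
  have hgM : densNorm g ≤ ENNReal.ofReal M := by
    rw [← ENNReal.ofReal_toReal hg.2]; exact ENNReal.ofReal_le_ofReal (le_max_right _ _)
  obtain ⟨C, L, hC, hL, H⟩ := exists_lintegral_hartree_le hγ.dim hγ.pos hγ.lt_min one_pos hM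
  have h1 := H f g hf.1 hg.1 hfM hgM
  rw [hasFiniteIntegral_iff_enorm]
  simp only [enorm_mul]
  refine lt_of_le_of_lt h1 ?_
  have h2 : ∫⁻ x, ‖f x‖ₑ * ∫⁻ y in Metric.ball x L, ‖g y‖ₑ ≤ densNorm f * densNorm g := by
    calc _ ≤ ∫⁻ x, ‖f x‖ₑ * densNorm g := by
          refine lintegral_mono fun x => ?_
          gcongr
          exact (setLIntegral_le_lintegral _ _).trans le_self_add
      _ = (∫⁻ x, ‖f x‖ₑ) * densNorm g := lintegral_mul_const' _ _ hg.2
      _ ≤ _ := by gcongr; exact le_self_add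
  have h3 : ENNReal.ofReal C * (∫⁻ x, ‖f x‖ₑ * ∫⁻ y in Metric.ball x L, ‖g y‖ₑ) ≠ ⊤ :=
    ENNReal.mul_ne_top ENNReal.ofReal_ne_top
      (ne_top_of_le_ne_top (ENNReal.mul_ne_top hf.2 hg.2) h2)
  exact ENNReal.add_lt_top.2 ⟨ENNReal.ofReal_lt_top, lt_top_iff_ne_top.2 h3⟩

lemma hartreeForm_comm (γ : ℝ) (f g : E d → ℝ) : hartreeForm γ f g = hartreeForm γ g f := by
  rw [hartreeForm, ← integral_prod_swap, hartreeForm]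
  refine integral_congr_ae (ae_of_all _ fun z => ?_)
  simp only [Prod.fst_swap, Prod.snd_swap]
  rw [← rieszKernel_neg, neg_sub]
  ring

lemma hartreeForm_add_left {γ : ℝ} (hγ : IsExponent d γ) {f g h : E d → ℝ} (hf : IsDens f)
    (hg : IsDens g) (hh : IsDens h) :
    hartreeForm γ (f + g) h = hartreeForm γ f h + hartreeForm γ g h := by
  simp only [hartreeForm]
  rw [← integral_add (hf.integrable_hartree hγ hh) (hg.integrable_hartree hγ hh)]
  refine integral_congr_ae (ae_of_all _ fun z => ?_)
  simp only [Pi.add_apply]; ring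

lemma hartreeForm_add_right {γ : ℝ} (hγ : IsExponent d γ) {f g h : E d → ℝ} (hf : IsDens f)
    (hg : IsDens g) (hh : IsDens h) :
    hartreeForm γ f (g + h) = hartreeForm γ f g + hartreeForm γ f h := by
  rw [hartreeForm_comm, hartreeForm_add_left hγ hg hh hf, hartreeForm_comm γ g,
    hartreeForm_comm γ h]

lemma hartreeForm_const_mul_left (γ c : ℝ) (f g : E d → ℝ) :
    hartreeForm γ (fun x => c * f x) g = c * hartreeForm γ f g := by
  simp only [hartreeForm]
  rw [← integral_const_mul]
  refine integral_congr_ae (ae_of_all _ fun z => ?_)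
  ring

lemma hartreeForm_const_mul_right (γ c : ℝ) (f g : E d → ℝ) :
    hartreeForm γ f (fun x => c * g x) = c * hartreeForm γ f g := by
  rw [hartreeForm_comm, hartreeForm_const_mul_left, hartreeForm_comm]

lemma hartreePotential_eq (γ : ℝ) (u : E d → ℂ) (x : E d) :
    hartreePotential γ u x = ∫ y, ‖u y‖ ^ 2 * rieszKernel γ (x - y) := by
  simp only [hartreePotential, rieszKernel, div_eq_mul_inv]

lemma hartreePotential_mul (γ : ℝ) (u : E d → ℂ) (f : E d → ℝ) (x : E d) :
    f x * hartreePotential γ u x = ∫ y, f x * ‖u y‖ ^ 2 * rieszKernel γ (x - y) := by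
  rw [hartreePotential_eq, ← integral_const_mul]
  simp only [mul_assoc]

lemma integrable_mul_hartreePotential {γ : ℝ} (hγ : IsExponent d γ) {f : E d → ℝ} (hf : IsDens f)
    {u : E d → ℂ} (hu : MemH1 u) : Integrable (fun x => f x * hartreePotential γ u x) := by
  simp only [hartreePotential_mul]
  exact (hf.integrable_hartree hγ (hu.isDens_sq hγ.dim)).integral_prod_left

lemma hartreeForm_sq_right {γ : ℝ} (hγ : IsExponent d γ) {f : E d → ℝ} (hf : IsDens f)
    {u : E d → ℂ} (hu : MemH1 u) :
    hartreeForm γ f (fun x => ‖u x‖ ^ 2) = ∫ x, f x * hartreePotential γ u x := by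
  simp only [hartreePotential_mul]
  exact integral_prod _ (hf.integrable_hartree hγ (hu.isDens_sq hγ.dim))

lemma P_eq_hartreeForm {γ : ℝ} (hγ : IsExponent d γ) {u : E d → ℂ} (hu : MemH1 u) :
    P γ u = hartreeForm γ (fun x => ‖u x‖ ^ 2) (fun x => ‖u x‖ ^ 2) := by
  rw [hartreeForm_sq_right hγ (hu.isDens_sq hγ.dim) hu, P]
  simp only [mul_comm]

lemma P_nonneg (γ : ℝ) (u : E d → ℂ) : 0 ≤ P γ u := by
  refine integral_nonneg fun x => mul_nonneg (integral_nonneg fun y => ?_) (by positivity)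
  positivity

/-- `P` is positive on nonzero functions: a vanishing double integral would force
`|u(x)|² |u(y)|² = 0` almost everywhere, hence zero mass. -/
lemma P_pos {γ : ℝ} (hγ : IsExponent d γ) {u : E d → ℂ} (hu : NonzeroH1 u) : 0 < P γ u := by
  have : Nontrivial (E d) := by
    have : Nonempty (Fin d) := ⟨⟨0, by have := hγ.dim; omega⟩⟩
    infer_instance
  refine lt_of_le_of_ne (P_nonneg γ u) fun h0 => ?_
  rw [P_eq_hartreeForm hγ hu.1, hartreeForm] at h0
  have hD := hu.1.isDens_sq hγ.dim
  have h1 := (integral_eq_zero_iff_of_nonneg (fun z : E d × E d => by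
    have := rieszKernel_nonneg γ (z.1 - z.2)
    positivity) (hD.integrable_hartree hγ hD)).1 h0.symm
  have h2 : ∀ᵐ z : E d × E d ∂(volume.prod volume), z.1 - z.2 ≠ 0 := by
    have hS : MeasurableSet {z : E d × E d | z.1 - z.2 = 0} :=
      (by fun_prop : Measurable fun z : E d × E d => z.1 - z.2) (measurableSet_singleton 0)
    rw [ae_iff]
    simp only [ne_eq, not_not]
    rw [Measure.measure_prod_null hS]
    refine ae_of_all _ fun x => ?_
    have : Prod.mk x ⁻¹' {z : E d × E d | z.1 - z.2 = 0} = {x} := by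
      ext y; simp [sub_eq_zero, eq_comm]
    simp only [this]; simp
  have h3 : ∫ z : E d × E d, ‖u z.1‖ ^ 2 * ‖u z.2‖ ^ 2 ∂(volume.prod volume) = 0 := by
    refine integral_eq_zero_of_ae ?_
    filter_upwards [h1, h2] with z hz hz'
    have hk : rieszKernel γ (z.1 - z.2) ≠ 0 := by
      unfold rieszKernel
      have := norm_pos_iff.2 hz'
      positivity
    simpa [hk] using hz
  rw [integral_prod_mul (fun x => ‖u x‖ ^ 2) (fun x => ‖u x‖ ^ 2)] at h3
  have h4 := massSq_pos hu
  rw [massSq] at h4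
  nlinarith

lemma P_smul (γ : ℝ) (c : ℂ) (u : E d → ℂ) : P γ (c • u) = ‖c‖ ^ 4 * P γ u := by
  have : ∀ x, hartreePotential γ (c • u) x = ‖c‖ ^ 2 * hartreePotential γ u x := fun x => by
    simp only [hartreePotential, ← integral_const_mul]
    refine integral_congr_ae (ae_of_all _ fun y => ?_)
    simp only [Pi.smul_apply, norm_smul]; ring
  simp only [P, this, ← integral_const_mul]
  refine integral_congr_ae (ae_of_all _ fun y => ?_)
  simp only [Pi.smul_apply, norm_smul]; ring

lemma P_comp_affine (γ : ℝ) (u : E d → ℂ) {r : ℝ} (hr : 0 < r) (b : E d) :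
    P γ (fun x => u (r • x + b)) = (r ^ d)⁻¹ * ((r ^ d)⁻¹ * (r ^ γ * P γ u)) := by
  have h1 : ∀ x, hartreePotential γ (fun x => u (r • x + b)) x
      = (r ^ d)⁻¹ * (r ^ γ * hartreePotential γ u (r • x + b)) := by
    intro x
    have e := integral_comp_affine (fun y => ‖u y‖ ^ 2 / ‖r • x + b - y‖ ^ γ) hr b
    rw [smul_eq_mul] at e
    simp only [hartreePotential]
    rw [← mul_assoc, mul_comm _ (r ^ γ), mul_assoc, ← e, ← integral_const_mul]
    refine integral_congr_ae (ae_of_all _ fun y => ?_)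
    have : r • x + b - (r • y + b) = r • (x - y) := by rw [smul_sub]; abel
    simp only [this, norm_smul, Real.norm_of_nonneg hr.le]
    rw [Real.mul_rpow hr.le (norm_nonneg _)]
    have : r ^ γ ≠ 0 := (Real.rpow_pos_of_pos hr γ).ne'
    rw [mul_div_assoc', mul_div_mul_left _ _ this]
  have e := integral_comp_affine (fun x => hartreePotential γ u x * ‖u x‖ ^ 2) hr b
  rw [smul_eq_mul] at e
  simp only [P, h1]
  rw [← mul_assoc (r ^ d)⁻¹ (r ^ γ), mul_comm (r ^ d)⁻¹ (r ^ γ), mul_left_comm, mul_assoc, ← e,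
    ← integral_const_mul, ← integral_const_mul]
  refine integral_congr_ae (ae_of_all _ fun y => ?_)
  simp only; ring

lemma hartreeForm_congr_ae {γ : ℝ} {f f' g g' : E d → ℝ} (hf : f =ᵐ[volume] f')
    (hg : g =ᵐ[volume] g') : hartreeForm γ f g = hartreeForm γ f' g' := by
  refine integral_congr_ae ?_
  have h1 := Measure.quasiMeasurePreserving_fst (μ := (volume : Measure (E d)))
    (ν := (volume : Measure (E d))) |>.ae hf
  have h2 := Measure.quasiMeasurePreserving_snd (μ := (volume : Measure (E d)))
    (ν := (volume : Measure (E d))) |>.ae hg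
  filter_upwards [h1, h2] with z e1 e2
  rw [e1, e2]

/-- The Hartree form is small on densities bounded in `L¹ ∩ L^{d/(d-2)}` one of which is small
in `L¹`. -/
lemma tendsto_hartreeForm_of_lintegral {γ : ℝ} (hγ : IsExponent d γ) {f g : ℕ → E d → ℝ} {M : ℝ}
    (hM : 0 ≤ M) (hf : ∀ n, AEStronglyMeasurable (f n) volume)
    (hg : ∀ n, AEStronglyMeasurable (g n) volume) (hfM : ∀ n, densNorm (f n) ≤ ENNReal.ofReal M)
    (hgM : ∀ n, densNorm (g n) ≤ ENNReal.ofReal M)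
    (h : Tendsto (fun n => ∫⁻ x, ‖f n x‖ₑ) atTop (𝓝 0)) :
    Tendsto (fun n => hartreeForm γ (f n) (g n)) atTop (𝓝 0) := by
  rw [tendsto_zero_iff_enorm_tendsto_zero, ENNReal.tendsto_nhds_zero]
  intro ε hε
  obtain ⟨η, hη0, hη⟩ : ∃ η : ℝ, 0 < η ∧ ENNReal.ofReal η + ENNReal.ofReal η ≤ ε := by
    obtain ⟨r, hr0, hr⟩ := ENNReal.lt_iff_exists_nnreal_btwn.1 hε
    have hr0' : (0 : ℝ) < r := by exact_mod_cast hr0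
    refine ⟨r / 2, by positivity, ?_⟩
    rw [← ENNReal.ofReal_add (by positivity) (by positivity), add_halves, ENNReal.ofReal_coe_nnreal]
    exact hr.le
  obtain ⟨C, L, hC, hL, H⟩ := exists_enorm_hartreeForm_le hγ hη0 hM
  have h1 : Tendsto (fun n => ENNReal.ofReal C * ((∫⁻ x, ‖f n x‖ₑ) * ENNReal.ofReal M)) atTop
      (𝓝 0) := by
    have := ENNReal.Tendsto.const_mul (a := ENNReal.ofReal C) (ENNReal.Tendsto.mul_const
      (b := ENNReal.ofReal M) h (Or.inr ENNReal.ofReal_ne_top)) (Or.inr ENNReal.ofReal_ne_top)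
    simpa using this
  filter_upwards [h1.eventually_le_const (ENNReal.ofReal_pos.2 hη0)] with n hn
  refine (H _ _ (hf n) (hg n) (hfM n) (hgM n)).trans (le_trans ?_ hη)
  gcongr
  refine le_trans ?_ hn
  gcongr
  rw [← lintegral_mul_const' _ _ ENNReal.ofReal_ne_top]
  gcongr with x
  exact (setLIntegral_le_lintegral _ _).trans (le_self_add.trans (hgM n))

/-- The Hartree form of a fixed density with a bounded, locally vanishing sequence tends
to zero. -/
lemma tendsto_hartreeForm_of_local {γ : ℝ} (hγ : IsExponent d γ) {f : E d → ℝ} {g : ℕ → E d → ℝ}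
    {M : ℝ} (hM : 0 ≤ M) (hf : AEStronglyMeasurable f volume)
    (hg : ∀ n, AEStronglyMeasurable (g n) volume) (hfM : densNorm f ≤ ENNReal.ofReal M)
    (hgM : ∀ n, densNorm (g n) ≤ ENNReal.ofReal M)
    (h : ∀ R : ℝ, Tendsto (fun n => ∫⁻ x in Metric.ball (0 : E d) R, ‖g n x‖ₑ) atTop (𝓝 0)) :
    Tendsto (fun n => hartreeForm γ f (g n)) atTop (𝓝 0) := by
  rw [tendsto_zero_iff_enorm_tendsto_zero, ENNReal.tendsto_nhds_zero]
  intro ε hε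
  obtain ⟨η, hη0, hη⟩ : ∃ η : ℝ, 0 < η ∧ ENNReal.ofReal η + ENNReal.ofReal η ≤ ε := by
    obtain ⟨r, hr0, hr⟩ := ENNReal.lt_iff_exists_nnreal_btwn.1 hε
    have hr0' : (0 : ℝ) < r := by exact_mod_cast hr0
    refine ⟨r / 2, by positivity, ?_⟩
    rw [← ENNReal.ofReal_add (by positivity) (by positivity), add_halves, ENNReal.ofReal_coe_nnreal]
    exact hr.le
  obtain ⟨C, L, hC, hL, H⟩ := exists_enorm_hartreeForm_le hγ hη0 hM
  have hmeas : ∀ n, AEMeasurable (fun x => ‖f x‖ₑ * ∫⁻ y in Metric.ball x L, ‖g n y‖ₑ) volume := by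
    intro n
    refine hf.enorm.mul (Measurable.aemeasurable ?_)
    set G := (hg n).mk (g n)
    have hG : Measurable G := (hg n).stronglyMeasurable_mk.measurable
    have e : ∀ x, ∫⁻ y in Metric.ball x L, ‖g n y‖ₑ
        = ∫⁻ y, Set.indicator {z : E d × E d | dist z.2 z.1 < L} (fun z => ‖G z.2‖ₑ) (x, y) := by
      intro x
      rw [← lintegral_indicator measurableSet_ball]
      refine lintegral_congr_ae ((hg n).ae_eq_mk.mono fun y hy => ?_)
      simp only [Set.indicator, Metric.mem_ball, Set.mem_ofPred_eq]
      rw [hy]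
    simp only [e]
    refine Measurable.lintegral_prod_right' (f := fun z : E d × E d =>
      Set.indicator {z : E d × E d | dist z.2 z.1 < L} (fun z => ‖G z.2‖ₑ) z) ?_
    refine (by fun_prop : Measurable fun z : E d × E d => ‖G z.2‖ₑ).indicator ?_
    exact measurableSet_lt (by fun_prop) (by fun_prop)
  have h0 : Tendsto (fun n => ∫⁻ x, ‖f x‖ₑ * ∫⁻ y in Metric.ball x L, ‖g n y‖ₑ) atTop (𝓝 0) := by
    have := tendsto_lintegral_of_dominated_convergence' (μ := (volume : Measure (E d)))
      (F := fun n x => ‖f x‖ₑ * ∫⁻ y in Metric.ball x L, ‖g n y‖ₑ) (f := fun _ => 0)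
      (fun x => ‖f x‖ₑ * ENNReal.ofReal M) hmeas
      (fun n => ae_of_all _ fun x => by
        refine mul_le_mul_right ?_ _
        exact (setLIntegral_le_lintegral _ _).trans (le_self_add.trans (hgM n)))
      (by
        rw [lintegral_mul_const' _ _ ENNReal.ofReal_ne_top]
        exact ENNReal.mul_ne_top (ne_top_of_le_ne_top ENNReal.ofReal_ne_top
          (le_self_add.trans hfM)) ENNReal.ofReal_ne_top)
      (ae_of_all _ fun x => by
        have h1 : Tendsto (fun n => ∫⁻ y in Metric.ball x L, ‖g n y‖ₑ) atTop (𝓝 0) := by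
          refine tendsto_of_tendsto_of_tendsto_of_le_of_le tendsto_const_nhds (h (‖x‖ + L))
            (fun _ => zero_le) fun n => ?_
          refine lintegral_mono_set (Metric.ball_subset_ball' ?_)
          rw [dist_zero_right, add_comm]
        have := ENNReal.Tendsto.const_mul (a := ‖f x‖ₑ) h1 (Or.inr enorm_ne_top)
        simpa using this)
    simpa using this
  have h1 : Tendsto (fun n => ENNReal.ofReal C * ∫⁻ x, ‖f x‖ₑ * ∫⁻ y in Metric.ball x L, ‖g n y‖ₑ)
      atTop (𝓝 0) := by
    simpa using ENNReal.Tendsto.const_mul (a := ENNReal.ofReal C) h0 (Or.inr ENNReal.ofReal_ne_top)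
  filter_upwards [h1.eventually_le_const (ENNReal.ofReal_pos.2 hη0)] with n hn
  refine (H _ _ hf (hg n) hfM (hgM n)).trans (le_trans ?_ hη)
  gcongr

/-! ### Weak limits of bounded sequences in `H¹` -/

/-- Weak sequential compactness of balls in a separable Hilbert space. -/
lemma exists_subseq_tendsto_inner {H : Type*} [NormedAddCommGroup H] [InnerProductSpace ℂ H]
    [CompleteSpace H] [TopologicalSpace.SeparableSpace H] {x : ℕ → H} {C : ℝ}
    (hx : ∀ n, ‖x n‖ ≤ C) : ∃ (φ : ℕ → ℕ) (x₀ : H), StrictMono φ ∧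
      ∀ y, Tendsto (fun n => inner ℂ (x (φ n)) y) atTop (𝓝 (inner ℂ x₀ y)) := by
  have hc := WeakDual.isSeqCompact_closedBall ℂ H 0 C
  obtain ⟨L, -, φ, hφ, hL⟩ := hc (x := fun n =>
    StrongDual.toWeakDual (InnerProductSpace.toDual ℂ H (x n))) (fun n => by
      simpa using hx n)
  refine ⟨φ, (InnerProductSpace.toDual ℂ H).symm (WeakDual.toStrongDual L), hφ, fun y => ?_⟩
  have := (WeakDual.eval_continuous (𝕜 := ℂ) y).tendsto L |>.comp hL
  simpa [Function.comp_def] using this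

lemma exists_subseq_weak_L2 {ι : Type*} [Fintype ι] {f : ℕ → ι → E d → ℂ}
    (hf : ∀ n i, MemLp (f n i) 2 volume) {C : ℝ} (hC : ∀ n i, massSq (f n i) ≤ C) :
    ∃ (φ : ℕ → ℕ) (g : ι → E d → ℂ), StrictMono φ ∧ (∀ i, MemLp (g i) 2 volume) ∧
      ∀ i (ψ : E d → ℂ), MemLp ψ 2 volume →
        Tendsto (fun n => ∫ x, f (φ n) i x * ψ x) atTop (𝓝 (∫ x, g i x * ψ x)) := by
  classical
  have hinner : ∀ (a : Lp ℂ 2 (volume : Measure (E d))) (b ψ : E d → ℂ)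
      (hψ : MemLp (fun x => conj (ψ x)) 2 volume),
      a =ᵐ[volume] b → conj (inner ℂ a (hψ.toLp (fun x => conj (ψ x)))) = ∫ x, b x * ψ x := by
    intro a b ψ hψ hab
    rw [L2.inner_def, ← integral_conj]
    refine integral_congr_ae ?_
    filter_upwards [hab, hψ.coeFn_toLp] with x h1 h2
    rw [h2, h1]
    simp [mul_comm]
  have : Fact ((2 : ℝ≥0∞) ≠ ⊤) := ⟨by simp⟩
  set X : ℕ → PiLp 2 (fun _ : ι => Lp ℂ 2 (volume : Measure (E d))) := fun n =>
    WithLp.toLp 2 fun i => (hf n i).toLp (f n i) with hX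
  have hXn : ∀ n, ‖X n‖ ≤ √(∑ _i : ι, C) := by
    intro n
    rw [PiLp.norm_eq_of_L2]
    refine Real.sqrt_le_sqrt (Finset.sum_le_sum fun i _ => le_trans (le_of_eq ?_) (hC n i))
    have h1 := @inner_self_eq_norm_sq ℂ _ _ _ _ ((hf n i).toLp (f n i))
    rw [hX]
    simp only
    rw [← h1, L2.inner_def, massSq]
    have h2 : ∫ a, inner ℂ ((hf n i).toLp (f n i) a) ((hf n i).toLp (f n i) a)
        = ∫ x, ((‖f n i x‖ ^ 2 : ℝ) : ℂ) := by
      refine integral_congr_ae ?_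
      filter_upwards [(hf n i).coeFn_toLp] with x hx
      rw [hx, inner_self_eq_norm_sq_to_K]
      simp
    rw [h2, integral_complex_ofReal]
    simp
  obtain ⟨φ, x₀, hφ, hlim⟩ := exists_subseq_tendsto_inner hXn
  refine ⟨φ, fun i => x₀ i, hφ, fun i => Lp.memLp (x₀ i), fun i ψ hψ' => ?_⟩
  have hψ : MemLp (fun x => conj (ψ x)) 2 volume := hψ'.star
  have h := hlim (WithLp.toLp 2 (Pi.single i (hψ.toLp (fun x => conj (ψ x)))))
  have e : ∀ z : PiLp 2 (fun _ : ι => Lp ℂ 2 (volume : Measure (E d))),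
      inner ℂ z (WithLp.toLp 2 (Pi.single i (hψ.toLp (fun x => conj (ψ x)))))
        = inner ℂ (z i) (hψ.toLp (fun x => conj (ψ x))) := by
    intro z
    rw [PiLp.inner_apply, Finset.sum_eq_single i]
    · simp
    · intro j _ hj; simp [hj]
    · simp
  simp only [e] at h
  have h2 := (Complex.continuous_conj.tendsto _).comp h
  rw [hinner (x₀ i) (x₀ i) ψ hψ (ae_of_all _ fun _ => rfl)] at h2
  refine h2.congr fun n => ?_
  exact hinner _ (f (φ n) i) ψ hψ ((hf (φ n) i).coeFn_toLp)

/-- A bounded sequence in `H¹` has a subsequence converging weakly in `H¹`. -/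
lemma exists_subseq_weak_H1 {u : ℕ → E d → ℂ} (hu : ∀ n, MemH1 (u n)) {C : ℝ}
    (hm : ∀ n, massSq (u n) ≤ C) (hg : ∀ n, gradSq (u n) ≤ C) :
    ∃ (φ : ℕ → ℕ) (w : E d → ℂ), StrictMono φ ∧ MemH1 w ∧
      (∀ ψ : E d → ℂ, MemLp ψ 2 volume →
        Tendsto (fun n => ∫ x, u (φ n) x * ψ x) atTop (𝓝 (∫ x, w x * ψ x))) ∧
      ∀ i (ψ : E d → ℂ), MemLp ψ 2 volume →
        Tendsto (fun n => ∫ x, weakPartial i (u (φ n)) x * ψ x) atTop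
          (𝓝 (∫ x, weakPartial i w x * ψ x)) := by
  obtain ⟨φ, G, hφ, hG, hlim⟩ := exists_subseq_weak_L2 (ι := Option (Fin d))
    (f := fun n i => i.elim (u n) (fun i => weakPartial i (u n)))
    (fun n i => by
      rcases i with _ | i
      · exact (hu n).1
      · exact ((hu n).hasGrad.2 i).1)
    (C := C) (fun n i => by
      rcases i with _ | i
      · exact hm n
      · refine le_trans ?_ (hg n)
        rw [gradSq_eq_sum]
        exact Finset.single_le_sum (f := fun i => massSq (weakPartial i (u n)))
          (fun i _ => massSq_nonneg _) (Finset.mem_univ i))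
  have hgrad : HasGrad (G none) (fun i => G (some i)) := by
    refine ⟨hG none, fun i => ⟨hG (some i), fun χ hχ hc => ?_⟩⟩
    have h1 := hlim none _ (testFun_fderiv_memLp hχ hc (EuclideanSpace.single i 1) 2)
    have h2 := (hlim (some i) _ (testFun_memLp hχ.continuous hc 2)).neg
    refine tendsto_nhds_unique h1 (h2.congr fun n => ?_)
    exact (((hu (φ n)).hasGrad.2 i).2 χ hχ hc).symm
  refine ⟨φ, G none, hφ, hgrad.memH1, hlim none, fun i ψ hψ => ?_⟩
  have h := hlim (some i) ψ hψ
  have e : ∫ x, weakPartial i (G none) x * ψ x = ∫ x, G (some i) x * ψ x := by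
    refine integral_congr_ae ?_
    filter_upwards [hgrad.weakPartial_ae i] with x hx
    rw [hx]
  rw [e]
  exact h

lemma tendsto_massSq_sub_of_weak {u : ℕ → E d → ℂ} {w : E d → ℂ}
    (hu : ∀ n, MemLp (u n) 2 volume) (hw : MemLp w 2 volume)
    (h : ∀ ψ : E d → ℂ, MemLp ψ 2 volume →
        Tendsto (fun n => ∫ x, u n x * ψ x) atTop (𝓝 (∫ x, w x * ψ x))) :
    Tendsto (fun n => massSq (u n) - massSq (u n - w)) atTop (𝓝 (massSq w)) := by
  have hc : MemLp (fun x => conj (w x)) 2 volume := hw.star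
  have e : ∀ n, massSq (u n) - massSq (u n - w)
      = massSq w + 2 * (∫ x, u n x * conj (w x)).re - 2 * massSq w := by
    intro n
    have h1 := massSq_add_eq ((hu n).sub hw) hw
    rw [sub_add_cancel] at h1
    have h2 : ∫ x, (u n - w) x * conj (w x) = (∫ x, u n x * conj (w x)) - ∫ x, w x * conj (w x) := by
      rw [← integral_sub (integrable_mul_of_memLp (hu n) hc) (integrable_mul_of_memLp hw hc)]
      simp only [Pi.sub_apply, sub_mul]
    have h3 : ∫ x, w x * conj (w x) = (massSq w : ℂ) := by
      rw [massSq, ← integral_complex_ofReal]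
      refine integral_congr_ae (ae_of_all _ fun x => ?_)
      simp only [Complex.mul_conj, Complex.normSq_eq_norm_sq]
    rw [h2, h3, Complex.sub_re, Complex.ofReal_re] at h1
    linarith
  simp only [e]
  have h3 : ∫ x, w x * conj (w x) = (massSq w : ℂ) := by
    rw [massSq, ← integral_complex_ofReal]
    refine integral_congr_ae (ae_of_all _ fun x => ?_)
    simp only [Complex.mul_conj, Complex.normSq_eq_norm_sq]
  have h4 := (Complex.continuous_re.tendsto _).comp (h _ hc)
  rw [h3, Complex.ofReal_re] at h4
  have := ((h4.const_mul 2).const_add (massSq w)).sub_const (2 * massSq w)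
  refine this.trans (le_of_eq ?_)
  congr 1; ring

lemma enorm_mul_enorm_le (a b : ℂ) {t : ℝ} (ht : 0 < t) : ‖a‖ₑ * ‖b‖ₑ ≤
    ENNReal.ofReal t * ‖a‖ₑ ^ 2 + ENNReal.ofReal t⁻¹ * ‖b‖ₑ ^ 2 := by
  rw [← ofReal_norm, ← ofReal_norm, ← ENNReal.ofReal_pow (norm_nonneg _),
    ← ENNReal.ofReal_pow (norm_nonneg _), ← ENNReal.ofReal_mul (norm_nonneg _),
    ← ENNReal.ofReal_mul ht.le, ← ENNReal.ofReal_mul (by positivity),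
    ← ENNReal.ofReal_add (by positivity) (by positivity)]
  refine ENNReal.ofReal_le_ofReal ?_
  have h1 : t * ‖a‖ ^ 2 + t⁻¹ * ‖b‖ ^ 2 - 2 * (‖a‖ * ‖b‖) = (t * ‖a‖ - ‖b‖) ^ 2 / t := by
    field_simp; ring
  have h2 : 0 ≤ (t * ‖a‖ - ‖b‖) ^ 2 / t := by positivity
  have h3 : 0 ≤ ‖a‖ * ‖b‖ := by positivity
  linarith

/-- A bounded sequence which vanishes locally in `L²` decouples from every fixed `L²` function. -/
lemma tendsto_lintegral_mul_of_local {v : ℕ → E d → ℂ} {w : E d → ℂ}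
    (hv : ∀ n, MemLp (v n) 2 volume) (hw : MemLp w 2 volume) {C : ℝ} (hC : ∀ n, massSq (v n) ≤ C)
    (h : ∀ R : ℝ, Tendsto (fun n => ∫⁻ x in Metric.ball 0 R, ‖v n x‖ₑ ^ 2) atTop (𝓝 0)) :
    Tendsto (fun n => ∫⁻ x, ‖w x‖ₑ * ‖v n x‖ₑ) atTop (𝓝 0) := by
  rw [ENNReal.tendsto_nhds_zero]
  intro ε hε
  obtain ⟨e, he0, heε⟩ : ∃ e : ℝ, 0 < e ∧ ENNReal.ofReal e ≤ ε := by
    rcases eq_or_ne ε ⊤ with h | h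
    · exact ⟨1, one_pos, by simp [h]⟩
    · exact ⟨ε.toReal, ENNReal.toReal_pos hε.ne' h, ENNReal.ofReal_toReal_le⟩
  have hC0 : 0 ≤ C := (massSq_nonneg _).trans (hC 0)
  have hw0 := massSq_nonneg w
  set η : ℝ := e / (2 * (massSq w + C + 1)) with hη
  have hη0 : 0 < η := by positivity
  have hmw : AEMeasurable (fun x => ‖w x‖ₑ ^ 2) volume := hw.1.enorm.pow_const 2
  have hmv : ∀ n, AEMeasurable (fun x => ‖v n x‖ₑ ^ 2) volume := fun n => (hv n).1.enorm.pow_const 2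
  -- the tail of `w`
  obtain ⟨R, hR⟩ : ∃ R : ℝ, ENNReal.ofReal η⁻¹ * ∫⁻ x in (Metric.ball (0 : E d) R)ᶜ, ‖w x‖ₑ ^ 2
      ≤ ENNReal.ofReal (e / 4) := by
    have h1 : Tendsto (fun n : ℕ => ∫⁻ x in (Metric.ball (0 : E d) n)ᶜ, ‖w x‖ₑ ^ 2) atTop (𝓝 0) := by
      have := tendsto_setLIntegral_zero (μ := volume.withDensity fun x => ‖w x‖ₑ ^ 2)
        (f := fun _ : E d => 1) (l := atTop) (s := fun n : ℕ => (Metric.ball (0 : E d) n)ᶜ)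
        (by
          rw [lintegral_one, withDensity_apply _ MeasurableSet.univ, Measure.restrict_univ,
            lintegral_enorm_sq hw]
          exact ENNReal.ofReal_ne_top)
        (by
          have hempty : ⋂ n : ℕ, (Metric.ball (0 : E d) n)ᶜ = ∅ := by
            ext x
            simp only [Set.mem_iInter, Set.mem_compl_iff, mem_ball_zero_iff, not_lt,
              Set.mem_empty_iff_false, iff_false, not_forall, not_le]
            exact exists_nat_gt _
          have := tendsto_measure_iInter_atTop (μ := volume.withDensity fun x => ‖w x‖ₑ ^ 2)
            (s := fun n : ℕ => (Metric.ball (0 : E d) n)ᶜ)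
            (fun n => measurableSet_ball.compl.nullMeasurableSet)
            (fun m n hmn => Set.compl_subset_compl.2 (Metric.ball_subset_ball (by exact_mod_cast hmn)))
            ⟨0, by
              refine ne_top_of_le_ne_top ?_ (measure_mono (Set.subset_univ _))
              rw [withDensity_apply _ MeasurableSet.univ, Measure.restrict_univ,
                lintegral_enorm_sq hw]
              exact ENNReal.ofReal_ne_top⟩
          rw [hempty, measure_empty] at this
          exact this)
      refine this.congr fun n => ?_
      rw [setLIntegral_one, withDensity_apply _ measurableSet_ball.compl]
    have h2 := ENNReal.Tendsto.const_mul (a := ENNReal.ofReal η⁻¹) h1 (Or.inr ENNReal.ofReal_ne_top)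
    rw [mul_zero] at h2
    obtain ⟨n, hn⟩ := (h2.eventually_le_const
      (ENNReal.ofReal_pos.2 (by positivity : 0 < e / 4))).exists
    exact ⟨n, hn⟩
  have h2 := ENNReal.Tendsto.const_mul (a := ENNReal.ofReal η⁻¹) (h R)
    (Or.inr ENNReal.ofReal_ne_top)
  rw [mul_zero] at h2
  filter_upwards [h2.eventually_le_const (ENNReal.ofReal_pos.2 (by positivity : 0 < e / 4))] with n hn
  have hsplit := lintegral_add_compl (μ := volume) (fun x => ‖w x‖ₑ * ‖v n x‖ₑ)
    (measurableSet_ball (x := (0 : E d)) (ε := R))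
  rw [← hsplit]
  have i1 : ∫⁻ x in Metric.ball (0 : E d) R, ‖w x‖ₑ * ‖v n x‖ₑ ≤
      ENNReal.ofReal (η * massSq w) + ENNReal.ofReal (e / 4) := by
    calc _ ≤ ∫⁻ x in Metric.ball (0 : E d) R,
          (ENNReal.ofReal η * ‖w x‖ₑ ^ 2 + ENNReal.ofReal η⁻¹ * ‖v n x‖ₑ ^ 2) :=
          lintegral_mono fun x => enorm_mul_enorm_le _ _ hη0
      _ = ENNReal.ofReal η * (∫⁻ x in Metric.ball (0 : E d) R, ‖w x‖ₑ ^ 2)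
          + ENNReal.ofReal η⁻¹ * ∫⁻ x in Metric.ball (0 : E d) R, ‖v n x‖ₑ ^ 2 := by
          rw [lintegral_add_left' (hmw.restrict.const_mul _), lintegral_const_mul'' _ hmw.restrict,
            lintegral_const_mul'' _ (hmv n).restrict]
      _ ≤ _ := by
          gcongr
          rw [ENNReal.ofReal_mul hη0.le, ← lintegral_enorm_sq hw]
          gcongr
          exact Measure.restrict_le_self
  have i2 : ∫⁻ x in (Metric.ball (0 : E d) R)ᶜ, ‖w x‖ₑ * ‖v n x‖ₑ ≤
      ENNReal.ofReal (η * C) + ENNReal.ofReal (e / 4) := by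
    calc _ ≤ ∫⁻ x in (Metric.ball (0 : E d) R)ᶜ,
          (ENNReal.ofReal η * ‖v n x‖ₑ ^ 2 + ENNReal.ofReal η⁻¹ * ‖w x‖ₑ ^ 2) :=
          lintegral_mono fun x => (mul_comm _ _).le.trans (enorm_mul_enorm_le _ _ hη0)
      _ = ENNReal.ofReal η * (∫⁻ x in (Metric.ball (0 : E d) R)ᶜ, ‖v n x‖ₑ ^ 2)
          + ENNReal.ofReal η⁻¹ * ∫⁻ x in (Metric.ball (0 : E d) R)ᶜ, ‖w x‖ₑ ^ 2 := by
          rw [lintegral_add_left' ((hmv n).restrict.const_mul _),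
            lintegral_const_mul'' _ hmw.restrict, lintegral_const_mul'' _ (hmv n).restrict]
      _ ≤ _ := by
          gcongr
          rw [ENNReal.ofReal_mul hη0.le]
          gcongr
          refine (setLIntegral_le_lintegral _ _).trans ?_
          rw [lintegral_enorm_sq (hv n)]
          exact ENNReal.ofReal_le_ofReal (hC n)
  refine (add_le_add i1 i2).trans (le_trans ?_ heε)
  rw [← ENNReal.ofReal_add (by positivity) (by positivity),
    ← ENNReal.ofReal_add (by positivity) (by positivity),
    ← ENNReal.ofReal_add (by positivity) (by positivity)]
  refine ENNReal.ofReal_le_ofReal ?_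
  have : η * (massSq w + C) ≤ e / 2 := by
    rw [hη, div_mul_eq_mul_div, div_le_div_iff₀ (by positivity) (by norm_num)]
    nlinarith
  linarith

/-- The splitting of the Hartree energy along a weakly convergent sequence. -/
lemma tendsto_P_sub {γ : ℝ} (hγ : IsExponent d γ) {u : ℕ → E d → ℂ} {w : E d → ℂ}
    (hu : ∀ n, MemH1 (u n)) (hw : MemH1 w) {C : ℝ} (hm : ∀ n, massSq (u n - w) ≤ C)
    (hg : ∀ n, gradSq (u n - w) ≤ C)
    (h : ∀ R : ℝ, Tendsto (fun n => ∫⁻ x in Metric.ball 0 R, ‖(u n - w) x‖ₑ ^ 2) atTop (𝓝 0)) :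
    Tendsto (fun n => P γ (u n) - P γ (u n - w)) atTop (𝓝 (P γ w)) := by
  have hd := hγ.dim
  have hv : ∀ n, MemH1 (u n - w) := fun n => (hu n).sub hw
  set v : ℕ → E d → ℂ := fun n => u n - w with hvdef
  have huv : ∀ n, u n = w + v n := fun n => by rw [hvdef]; simp
  obtain ⟨M, hM0, hM⟩ := exists_densNorm_sq_le hd (max C (max (massSq w) (gradSq w)))
  set V : ℕ → E d → ℝ := fun n x => ‖v n x‖ ^ 2 with hV
  set A : E d → ℝ := fun x => ‖w x‖ ^ 2 with hA
  set F : ℕ → E d → ℝ := fun n x => (w x * conj (v n x)).re with hF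
  have hVd : ∀ n, IsDens (V n) := fun n => (hv n).isDens_sq hd
  have hAd : IsDens A := hw.isDens_sq hd
  have hFd : ∀ n, IsDens (F n) := fun n => hw.isDens_re hd (hv n)
  have hVM : ∀ n, densNorm (V n) ≤ ENNReal.ofReal M := fun n =>
    hM _ (hv n) ((hg n).trans (le_max_left _ _)) ((hm n).trans (le_max_left _ _))
  have hAM : densNorm A ≤ ENNReal.ofReal M :=
    hM _ hw ((le_max_right _ _).trans (le_max_right _ _))
      ((le_max_left _ _).trans (le_max_right _ _))
  set M' : ℝ := ((2 : ℝ≥0∞) ^ densExp d * (ENNReal.ofReal M + ENNReal.ofReal M)).toReal with hM'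
  have hM't : (2 : ℝ≥0∞) ^ densExp d * (ENNReal.ofReal M + ENNReal.ofReal M) ≠ ⊤ :=
    ENNReal.mul_ne_top (ENNReal.rpow_ne_top_of_nonneg (by linarith [one_le_densExp hd]) (by simp))
      (by finiteness)
  have hM'0 : 0 ≤ M' := ENNReal.toReal_nonneg
  have hAVM : ∀ n, densNorm (A + V n) ≤ ENNReal.ofReal M' := fun n => by
    rw [hM', ENNReal.ofReal_toReal hM't]
    refine (densNorm_add_le hd hAd.1).trans ?_
    gcongr
    exact hVM n
  have hFM : ∀ n, densNorm (F n) ≤ ENNReal.ofReal M' := fun n => by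
    refine le_trans (densNorm_mono hd fun x => ?_) (hAVM n)
    refine (Complex.abs_re_le_norm _).trans ?_
    simp only [Pi.add_apply, hA, hV]
    rw [Real.norm_of_nonneg (by positivity), norm_mul, Complex.norm_conj]
    nlinarith [sq_nonneg (‖w x‖ - ‖v n x‖), sq_nonneg ‖w x‖, sq_nonneg ‖v n x‖]
  have hle : ENNReal.ofReal M ≤ ENNReal.ofReal M' := by
    rw [hM', ENNReal.ofReal_toReal hM't]
    calc ENNReal.ofReal M ≤ ENNReal.ofReal M + ENNReal.ofReal M := le_self_add
      _ ≤ _ := le_mul_of_one_le_left zero_le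
          (ENNReal.one_le_rpow (by norm_num) (by linarith [one_le_densExp hd]))
  have hF0 : Tendsto (fun n => ∫⁻ x, ‖F n x‖ₑ) atTop (𝓝 0) := by
    refine tendsto_of_tendsto_of_tendsto_of_le_of_le tendsto_const_nhds
      (tendsto_lintegral_mul_of_local (fun n => (hv n).1) hw.1 hm h) (fun _ => zero_le) fun n => ?_
    refine lintegral_mono fun x => ?_
    rw [← enorm_mul, enorm_le_iff_norm_le]
    exact (Complex.abs_re_le_norm _).trans
      (le_of_eq (by rw [norm_mul, norm_mul, Complex.norm_conj]))
  have t1 := tendsto_hartreeForm_of_lintegral hγ hM'0 (fun n => (hFd n).1)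
    (fun n => (hAd.add hd (hVd n)).1) hFM hAVM hF0
  have t2 := tendsto_hartreeForm_of_lintegral hγ hM'0 (fun n => (hFd n).1)
    (fun n => (hFd n).1) hFM hFM hF0
  have t3 := tendsto_hartreeForm_of_local hγ hM0 hAd.1 (fun n => (hVd n).1) hAM hVM (fun R => by
    refine (h R).congr fun n => ?_
    refine lintegral_congr fun x => ?_
    simp [hV, hvdef])
  have e : ∀ n, P γ (u n) - P γ (v n) = P γ w + (2 * hartreeForm γ A (V n)
      + 4 * hartreeForm γ (F n) (A + V n) + 4 * hartreeForm γ (F n) (F n)) := by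
    intro n
    have e0 : (fun x => ‖u n x‖ ^ 2) = (A + V n) + fun x => 2 * F n x := by
      ext x
      rw [huv n]
      simp only [Pi.add_apply, hA, hV, hF]
      rw [← Complex.normSq_eq_norm_sq, ← Complex.normSq_eq_norm_sq, ← Complex.normSq_eq_norm_sq,
        Complex.normSq_add]
    have hAV := hAd.add hd (hVd n)
    have hF2 := (hFd n).const_mul hd 2
    rw [P_eq_hartreeForm hγ (hu n), P_eq_hartreeForm hγ (hv n), P_eq_hartreeForm hγ hw, e0,
      hartreeForm_add_left hγ hAV hF2 (hAV.add hd hF2), hartreeForm_add_right hγ hAV hAV hF2,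
      hartreeForm_add_right hγ hF2 hAV hF2, hartreeForm_const_mul_left, hartreeForm_const_mul_left,
      hartreeForm_const_mul_right, hartreeForm_const_mul_right, hartreeForm_comm γ (A + V n) (F n),
      hartreeForm_add_left hγ hAd (hVd n) hAV, hartreeForm_add_right hγ hAd hAd (hVd n),
      hartreeForm_add_right hγ (hVd n) hAd (hVd n), hartreeForm_comm γ (V n) A]
    ring
  refine Tendsto.congr (fun n => (e n).symm) ?_
  have := (((t3.const_mul 2).add (t1.const_mul 4)).add (t2.const_mul 4)).const_add (P γ w)
  simpa using this

/-- Nonvanishing: a bounded set of `H¹` functions whose Hartree energy is bounded below carries a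
fixed amount of mass in a ball of fixed radius. -/
lemma exists_ball_mass_ge {γ : ℝ} (hγ : IsExponent d γ) {c C : ℝ} (hc : 0 < c) (hC : 0 ≤ C) :
    ∃ R κ : ℝ, 0 < R ∧ 0 < κ ∧ ∀ u : E d → ℂ, MemH1 u → gradSq u ≤ C → massSq u ≤ C → c ≤ P γ u →
      ∃ y : E d, ENNReal.ofReal κ ≤ ∫⁻ x in Metric.ball y R, ‖u x‖ₑ ^ 2 := by
  obtain ⟨M, hM0, hM⟩ := exists_densNorm_sq_le hγ.dim C
  obtain ⟨K, L, hK, hL, H⟩ := exists_enorm_hartreeForm_le hγ (half_pos hc) hM0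
  refine ⟨L, c / (4 * (K + 1) * (C + 1)), hL, by positivity, fun u hu hg hm hP => ?_⟩
  by_contra! hcon
  have hD := hu.isDens_sq hγ.dim
  have h1 := H _ _ hD.1 hD.1 (hM u hu hg hm) (hM u hu hg hm)
  rw [← P_eq_hartreeForm hγ hu, Real.enorm_of_nonneg (P_nonneg γ u)] at h1
  have e : ∀ x, ‖(‖u x‖ ^ 2 : ℝ)‖ₑ = ‖u x‖ₑ ^ 2 := fun x => by simp
  simp only [e] at h1
  have h2 : ∫⁻ x, ‖u x‖ₑ ^ 2 * ∫⁻ y in Metric.ball x L, ‖u y‖ₑ ^ 2 ≤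
      ENNReal.ofReal (C * (c / (4 * (K + 1) * (C + 1)))) := by
    calc _ ≤ ∫⁻ x, ‖u x‖ₑ ^ 2 * ENNReal.ofReal (c / (4 * (K + 1) * (C + 1))) := by
          gcongr with x; exact (hcon x).le
      _ = ENNReal.ofReal (massSq u) * ENNReal.ofReal (c / (4 * (K + 1) * (C + 1))) := by
          rw [lintegral_mul_const' _ _ ENNReal.ofReal_ne_top, lintegral_enorm_sq hu.1]
      _ ≤ _ := by
          rw [ENNReal.ofReal_mul hC]
          gcongr
  have h3 : ENNReal.ofReal (P γ u) ≤
      ENNReal.ofReal (c / 2 + K * (C * (c / (4 * (K + 1) * (C + 1))))) := by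
    rw [ENNReal.ofReal_add (by positivity) (by positivity), ENNReal.ofReal_mul hK]
    exact h1.trans (by gcongr)
  rw [ENNReal.ofReal_le_ofReal_iff (by positivity)] at h3
  have h4 : K * (C * (c / (4 * (K + 1) * (C + 1)))) ≤ c / 4 := by
    have : K * C ≤ (K + 1) * (C + 1) := by nlinarith
    calc _ = (K * C) * c / (4 * ((K + 1) * (C + 1))) := by ring
      _ ≤ ((K + 1) * (C + 1)) * c / (4 * ((K + 1) * (C + 1))) := by gcongr
      _ = c / 4 := by field_simp
  linarith

/-! ### Profile decomposition -/

lemma tendsto_gradSq_sub_of_weak {u : ℕ → E d → ℂ} {w : E d → ℂ}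
    (hu : ∀ n, MemH1 (u n)) (hw : MemH1 w)
    (h : ∀ i (ψ : E d → ℂ), MemLp ψ 2 volume →
        Tendsto (fun n => ∫ x, weakPartial i (u n) x * ψ x) atTop
          (𝓝 (∫ x, weakPartial i w x * ψ x))) :
    Tendsto (fun n => gradSq (u n) - gradSq (u n - w)) atTop (𝓝 (gradSq w)) := by
  have e : ∀ n, gradSq (u n) - gradSq (u n - w) = ∑ i, (massSq (weakPartial i (u n)) -
      massSq (weakPartial i (u n) - weakPartial i w)) := by
    intro n
    rw [((hu n).hasGrad.sub hw.hasGrad).gradSq_eq, gradSq_eq_sum, ← Finset.sum_sub_distrib]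
  simp only [e]
  rw [gradSq_eq_sum]
  exact tendsto_finsetSum _ fun i _ =>
    tendsto_massSq_sub_of_weak (fun n => ((hu n).hasGrad.2 i).1) (hw.hasGrad.2 i).1 (h i)

/-- The decomposition of a bounded sequence in `H¹` which keeps some mass in a fixed ball: along a
subsequence, subtracting the (nonzero) weak limit `w` splits mass, kinetic energy and Hartree
energy, and the remainder vanishes locally. -/
lemma exists_profile {γ : ℝ} (hγ : IsExponent d γ) {u : ℕ → E d → ℂ} (hu : ∀ n, MemH1 (u n))
    {C R κ : ℝ} (hm : ∀ n, massSq (u n) ≤ C) (hg : ∀ n, gradSq (u n) ≤ C) (hκ : 0 < κ)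
    (hloc : ∀ n, ENNReal.ofReal κ ≤ ∫⁻ x in Metric.ball 0 R, ‖u n x‖ₑ ^ 2) :
    ∃ (φ : ℕ → ℕ) (w : E d → ℂ) (C' : ℝ), StrictMono φ ∧ NonzeroH1 w ∧
      (∀ n, massSq (u (φ n) - w) ≤ C') ∧ (∀ n, gradSq (u (φ n) - w) ≤ C') ∧
      Tendsto (fun n => massSq (u (φ n)) - massSq (u (φ n) - w)) atTop (𝓝 (massSq w)) ∧
      Tendsto (fun n => gradSq (u (φ n)) - gradSq (u (φ n) - w)) atTop (𝓝 (gradSq w)) ∧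
      Tendsto (fun n => P γ (u (φ n)) - P γ (u (φ n) - w)) atTop (𝓝 (P γ w)) ∧
      ∀ R : ℝ, Tendsto (fun n => ∫⁻ x in Metric.ball 0 R, ‖(u (φ n) - w) x‖ₑ ^ 2) atTop (𝓝 0) := by
  obtain ⟨φ, w, hφ, hw, h1, h2⟩ := exists_subseq_weak_H1 hu hm hg
  set C' : ℝ := 2 * C + 2 * max (massSq w) (gradSq w) with hC'
  have hv : ∀ n, MemH1 (u (φ n) - w) := fun n => (hu _).sub hw
  have hm' : ∀ n, massSq (u (φ n) - w) ≤ C' := fun n => by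
    refine (massSq_sub_le (hu _).1 hw.1).trans ?_
    linarith [hm (φ n), le_max_left (massSq w) (gradSq w)]
  have hg' : ∀ n, gradSq (u (φ n) - w) ≤ C' := fun n => by
    refine (gradSq_sub_le (hu _) hw).trans ?_
    linarith [hg (φ n), le_max_right (massSq w) (gradSq w)]
  have hl := tendsto_setLIntegral_ball_of_weak hv hm' hg' (fun ψ hψ => by
    have := (h1 ψ hψ).sub_const (∫ x, w x * ψ x)
    rw [sub_self] at this
    refine this.congr fun n => ?_
    rw [← integral_sub (integrable_mul_of_memLp (hu _).1 hψ) (integrable_mul_of_memLp hw.1 hψ)]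
    simp only [Pi.sub_apply, sub_mul])
  refine ⟨φ, w, C', hφ, ⟨hw, fun h0 => ?_⟩, hm', hg',
    tendsto_massSq_sub_of_weak (fun n => (hu _).1) hw.1 h1,
    tendsto_gradSq_sub_of_weak (fun n => hu _) hw h2,
    tendsto_P_sub hγ (fun n => hu _) hw hm' hg' hl, hl⟩
  have h3 : ∀ n, ∫⁻ x in Metric.ball 0 R, ‖(u (φ n) - w) x‖ₑ ^ 2
      = ∫⁻ x in Metric.ball 0 R, ‖u (φ n) x‖ₑ ^ 2 := fun n => by
    refine lintegral_congr_ae (ae_restrict_of_ae ?_)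
    filter_upwards [h0] with x hx
    simp [hx]
  have h4 := hl R
  simp only [h3] at h4
  have h5 := ge_of_tendsto h4 (Eventually.of_forall fun n => hloc (φ n))
  exact absurd h5 (not_le.2 (ENNReal.ofReal_pos.2 hκ))

/-- Strict subadditivity in numerical form: if the total energy `p n → S` at normalization
`a n → 1` splits into a profile with normalization `t > 0` and energy `q ≤ S' t²`, `S' ≤ S`, and a
remainder of energy at most `S` times the square of its normalization, then the profile carries
everything. -/
lemma profile_eq_of_split {S S' t q : ℝ} {p p' a a' : ℕ → ℝ} (hS : 0 < S)
    (hp : Tendsto p atTop (𝓝 S)) (ha : Tendsto a atTop (𝓝 1))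
    (hpp : Tendsto (fun n => p n - p' n) atTop (𝓝 q))
    (haa : Tendsto (fun n => a n - a' n) atTop (𝓝 t)) (ht : 0 < t)
    (hle : ∀ n, p' n ≤ S * a' n ^ 2) (ha0 : ∀ n, 0 ≤ a' n) (hq : q ≤ S' * t ^ 2) (hS' : S' ≤ S) :
    t = 1 ∧ q = S ∧ S ≤ S' := by
  have h1 : Tendsto p' atTop (𝓝 (S - q)) := by simpa using hp.sub hpp
  have h2 : Tendsto a' atTop (𝓝 (1 - t)) := by simpa using ha.sub haa
  have h3 : 0 ≤ 1 - t := ge_of_tendsto' h2 ha0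
  have h4 : S - q ≤ S * (1 - t) ^ 2 := le_of_tendsto_of_tendsto' h1 ((h2.pow 2).const_mul S) hle
  have h5 : S' * t ^ 2 ≤ S * t ^ 2 := by gcongr
  have h6 : t = 1 := by
    refine le_antisymm (by linarith) ?_
    have : 0 ≤ S * t * (t - 1) := by nlinarith
    by_contra hlt
    have : S * t * (t - 1) < 0 := mul_neg_of_pos_of_neg (by positivity) (by linarith)
    linarith
  subst h6
  refine ⟨rfl, by linarith, by linarith⟩

lemma exists_P_le {γ : ℝ} (hγ : IsExponent d γ) (C : ℝ) :
    ∃ K : ℝ, ∀ u : E d → ℂ, MemH1 u → gradSq u ≤ C → massSq u ≤ C → P γ u ≤ K := by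
  obtain ⟨M, hM0, hM⟩ := exists_densNorm_sq_le hγ.dim C
  obtain ⟨K, L, hK, hL, H⟩ := exists_enorm_hartreeForm_le hγ one_pos hM0
  refine ⟨1 + K * (M * M), fun u hu hg hm => ?_⟩
  have hD := hu.isDens_sq hγ.dim
  have hMu := hM u hu hg hm
  have h1 := H _ _ hD.1 hD.1 hMu hMu
  rw [← P_eq_hartreeForm hγ hu, Real.enorm_of_nonneg (P_nonneg γ u)] at h1
  rw [← ENNReal.ofReal_le_ofReal_iff (by positivity)]
  refine h1.trans ?_
  rw [ENNReal.ofReal_add (by positivity) (by positivity), ENNReal.ofReal_mul hK,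
    ENNReal.ofReal_mul hM0]
  gcongr
  calc _ ≤ ∫⁻ x, ‖(‖u x‖ ^ 2 : ℝ)‖ₑ * ENNReal.ofReal M := by
        gcongr with x
        exact (setLIntegral_le_lintegral _ _).trans (le_self_add.trans hMu)
    _ = (∫⁻ x, ‖(‖u x‖ ^ 2 : ℝ)‖ₑ) * ENNReal.ofReal M :=
        lintegral_mul_const' _ _ ENNReal.ofReal_ne_top
    _ ≤ _ := by gcongr; exact le_self_add.trans hMu

lemma lintegral_comp_affine (f : E d → ℝ≥0∞) {r : ℝ} (hr : 0 < r) (b : E d) :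
    ∫⁻ x, f (r • x + b) = ENNReal.ofReal ((r ^ d)⁻¹) * ∫⁻ x, f x := by
  have hemb : MeasurableEmbedding (fun x : E d => r • x + b) :=
    ((MeasurableEquiv.smul₀ r hr.ne').trans (MeasurableEquiv.addRight b)).measurableEmbedding
  have hmap : Measure.map (fun x : E d => r • x + b) volume
      = ENNReal.ofReal ((r ^ d)⁻¹) • (volume : Measure (E d)) := by
    have h1 : (fun x : E d => r • x + b) = (fun x => x + b) ∘ (fun x : E d => r • x) := rfl
    rw [h1, ← Measure.map_map (by fun_prop) (by fun_prop), Measure.map_addHaar_smul _ hr.ne',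
      Measure.map_smul, map_add_right_eq_self]
    simp [abs_of_pos hr]
  rw [← hemb.lintegral_map f, hmap, lintegral_smul_measure, smul_eq_mul]

lemma lintegral_ball_comp_affine {f : E d → ℝ≥0∞} {r : ℝ} (hr : 0 < r) (b : E d) (R : ℝ) :
    ∫⁻ x in Metric.ball 0 R, f (r • x + b) =
      ENNReal.ofReal ((r ^ d)⁻¹) * ∫⁻ x in Metric.ball b (r * R), f x := by
  have hpre : (fun x : E d => r • x + b) ⁻¹' Metric.ball b (r * R) = Metric.ball 0 R := by
    ext x
    simp only [Set.mem_preimage, Metric.mem_ball, dist_eq_norm, add_sub_cancel_right, norm_smul,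
      Real.norm_of_nonneg hr.le, sub_zero]
    exact mul_lt_mul_iff_right₀ hr
  have e : ∀ x, Set.indicator (Metric.ball 0 R) (fun x => f (r • x + b)) x
      = Set.indicator (Metric.ball b (r * R)) f (r • x + b) := fun x => by
    rw [← hpre]; rfl
  rw [← lintegral_indicator measurableSet_ball, ← lintegral_indicator measurableSet_ball]
  simp only [e]
  exact lintegral_comp_affine _ hr b

lemma exists_nonzeroH1 : ∃ u : E d → ℂ, NonzeroH1 u := by
  let b : ContDiffBump (0 : E d) := ⟨1, 2, by norm_num, by norm_num⟩
  have hT : IsTest (fun x => (b x : ℂ)) := by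
    refine ⟨Complex.ofRealCLM.contDiff.comp b.contDiff, ?_⟩
    exact b.hasCompactSupport.comp_left (g := fun t : ℝ => (t : ℂ)) (by simp)
  refine ⟨fun x => (b x : ℂ), hT.hasGrad.memH1, fun h => ?_⟩
  have h1 := (Continuous.ae_eq_iff_eq volume hT.1.continuous continuous_zero).1 h
  have h2 := congrFun h1 0
  have h3 : b 0 = 1 := b.one_of_mem_closedBall (by simp [b])
  simp [h3] at h2

/-! ### The weight `√e^γ √m^{4-γ}` -/

/-- The denominator `√e^γ √m^{4-γ}` of the functional `W`. -/
def weight (γ e m : ℝ) : ℝ := √e ^ γ * √m ^ (4 - γ)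

lemma W_eq (γ : ℝ) (V : E d → ℝ) (u : E d → ℂ) :
    W γ V u = P γ u / weight γ (energySq V u) (massSq u) := rfl

lemma weight_pos (γ : ℝ) {e m : ℝ} (he : 0 < e) (hm : 0 < m) : 0 < weight γ e m := by
  unfold weight; positivity

lemma weight_mul (γ : ℝ) {s t e m : ℝ} (hs : 0 ≤ s) (ht : 0 ≤ t) :
    weight γ (s * e) (t * m) = weight γ s t * weight γ e m := by
  unfold weight
  rw [Real.sqrt_mul hs, Real.sqrt_mul ht, Real.mul_rpow (by positivity) (by positivity),
    Real.mul_rpow (by positivity) (by positivity)]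
  ring

lemma weight_self (γ : ℝ) {s : ℝ} (hs : 0 < s) : weight γ s s = s ^ 2 := by
  rw [weight, ← Real.rpow_add (by positivity)]
  have : γ + (4 - γ) = ((4 : ℕ) : ℝ) := by push_cast; ring
  rw [this, Real.rpow_natCast]
  calc √s ^ 4 = (√s ^ 2) ^ 2 := by ring
    _ = s ^ 2 := by rw [Real.sq_sqrt hs.le]

lemma weight_le_weight {γ e e' m : ℝ} (hγ : 0 ≤ γ) (h : e ≤ e') :
    weight γ e m ≤ weight γ e' m := by
  unfold weight
  gcongr

lemma weight_lt_weight {γ e e' m : ℝ} (hγ : 0 < γ) (he : 0 ≤ e) (hm : 0 < m) (h : e < e') :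
    weight γ e m < weight γ e' m := by
  unfold weight
  gcongr

/-- The weighted inequality of arithmetic and geometric means. -/
lemma weight_le {γ e m : ℝ} (h0 : 0 ≤ γ) (h4 : γ ≤ 4) (he : 0 ≤ e) (hm : 0 ≤ m) :
    weight γ e m ≤ (γ / 4 * e + (1 - γ / 4) * m) ^ 2 := by
  have h := Real.geom_mean_le_arith_mean2_weighted (w₁ := γ / 4) (w₂ := 1 - γ / 4)
    (by positivity) (by linarith) he hm (by ring)
  have e1 : weight γ e m = (e ^ (γ / 4) * m ^ (1 - γ / 4)) ^ 2 := by
    rw [weight, Real.sqrt_eq_rpow, Real.sqrt_eq_rpow, ← Real.rpow_mul he, ← Real.rpow_mul hm,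
      mul_pow, ← Real.rpow_natCast, ← Real.rpow_natCast, ← Real.rpow_mul he, ← Real.rpow_mul hm]
    congr 2 <;> push_cast <;> ring
  rw [e1]
  gcongr

lemma continuous_weight_left {γ : ℝ} (h0 : 0 ≤ γ) (m : ℝ) : Continuous fun e => weight γ e m := by
  unfold weight
  exact (Real.continuous_sqrt.rpow_const fun _ => Or.inr h0).mul continuous_const

/-! ### The Euler–Lagrange equation -/

lemma MemLp.lintegral_pot_ne_top (hd : 3 ≤ d) {V : E d → ℝ}
    (hV : MemLp V ((d : ℝ≥0∞) / 2) volume) {u : E d → ℂ} (hu : MemH1 u) :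
    ∫⁻ x, ‖V x‖ₑ * ‖u x‖ₑ ^ 2 ≠ ⊤ := by
  obtain ⟨C, hC⟩ := exists_hoelder_sobolev hd
  refine ne_top_of_le_ne_top ?_ (hC V u hV.1.aemeasurable hu)
  have := hV.2.ne
  finiteness

lemma MemLp.integrable_pot_sq (hd : 3 ≤ d) {V : E d → ℝ}
    (hV : MemLp V ((d : ℝ≥0∞) / 2) volume) {u : E d → ℂ} (hu : MemH1 u) :
    Integrable (fun x => V x * ‖u x‖ ^ 2) := by
  refine ⟨hV.1.mul (hu.1.1.norm.pow 2), ?_⟩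
  rw [hasFiniteIntegral_iff_enorm]
  refine lt_of_le_of_lt (le_of_eq ?_)
    (lt_top_iff_ne_top.2 (MemLp.lintegral_pot_ne_top hd hV hu))
  refine lintegral_congr fun x => ?_
  rw [enorm_mul]; simp

lemma MemLp.integrable_pot_mul (hd : 3 ≤ d) {V : E d → ℝ}
    (hV : MemLp V ((d : ℝ≥0∞) / 2) volume) {u v : E d → ℂ} (hu : MemH1 u) (hv : MemH1 v) :
    Integrable (fun x => (V x : ℂ) * u x * conj (v x)) := by
  refine ((MemLp.integrable_pot_sq hd hV hu).norm.add
    (MemLp.integrable_pot_sq hd hV hv).norm).mono' ?_ (ae_of_all _ fun x => ?_)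
  · exact ((Complex.continuous_ofReal.comp_aestronglyMeasurable hV.1).mul hu.1.1).mul hv.1.star.1
  · simp only [norm_mul, Complex.norm_real, Complex.norm_conj, Pi.add_apply, norm_pow, norm_norm]
    have := norm_nonneg (V x)
    nlinarith [mul_nonneg this (sq_nonneg (‖u x‖ - ‖v x‖)), mul_nonneg this (sq_nonneg ‖u x‖),
      mul_nonneg this (sq_nonneg ‖v x‖)]

lemma massSq_add_smul {u v : E d → ℂ} (hu : MemLp u 2 volume) (hv : MemLp v 2 volume) (t : ℝ) :
    massSq (u + (t : ℂ) • v) =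
      massSq u + 2 * t * (∫ x, u x * conj (v x)).re + t ^ 2 * massSq v := by
  rw [massSq_add_eq hu (hv.const_smul (t : ℂ)), massSq_smul]
  have : ∫ x, u x * conj (((t : ℂ) • v) x) = (t : ℂ) * ∫ x, u x * conj (v x) := by
    rw [← integral_const_mul]
    refine integral_congr_ae (ae_of_all _ fun x => ?_)
    simp only [Pi.smul_apply, smul_eq_mul, map_mul, Complex.conj_ofReal]; ring
  rw [this, Complex.re_ofReal_mul]
  simp only [Complex.norm_real, Real.norm_eq_abs, sq_abs]
  ring

lemma gradSq_add_smul {u v : E d → ℂ} (hu : MemH1 u) (hv : MemH1 v) (t : ℝ) :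
    gradSq (u + (t : ℂ) • v) = gradSq u +
      2 * t * (∑ i, ∫ x, weakPartial i u x * conj (weakPartial i v x)).re + t ^ 2 * gradSq v := by
  rw [(hu.hasGrad.add (hv.hasGrad.const_smul (t : ℂ))).gradSq_eq, gradSq_eq_sum, gradSq_eq_sum,
    Complex.re_sum, Finset.mul_sum, Finset.mul_sum, ← Finset.sum_add_distrib,
    ← Finset.sum_add_distrib]
  exact Finset.sum_congr rfl fun i _ =>
    massSq_add_smul (hu.hasGrad.2 i).1 (hv.hasGrad.2 i).1 t

lemma norm_add_ofReal_mul_sq (a b : ℂ) (t : ℝ) :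
    ‖a + t * b‖ ^ 2 = ‖a‖ ^ 2 + 2 * t * (a * conj b).re + t ^ 2 * ‖b‖ ^ 2 := by
  rw [← Complex.normSq_eq_norm_sq, ← Complex.normSq_eq_norm_sq, ← Complex.normSq_eq_norm_sq,
    Complex.normSq_add, Complex.normSq_mul, Complex.normSq_ofReal, map_mul, Complex.conj_ofReal]
  have : a * (t * conj b) = t * (a * conj b) := by ring
  rw [this, Complex.re_ofReal_mul]
  ring

lemma integral_pot_add_smul (hd : 3 ≤ d) {V : E d → ℝ}
    (hV : MemLp V ((d : ℝ≥0∞) / 2) volume) {u v : E d → ℂ} (hu : MemH1 u) (hv : MemH1 v) (t : ℝ) :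
    ∫ x, V x * ‖(u + (t : ℂ) • v) x‖ ^ 2 = (∫ x, V x * ‖u x‖ ^ 2) +
      2 * t * (∫ x, (V x : ℂ) * u x * conj (v x)).re + t ^ 2 * ∫ x, V x * ‖v x‖ ^ 2 := by
  have hi := MemLp.integrable_pot_mul hd hV hu hv
  have hre : (∫ x, (V x : ℂ) * u x * conj (v x)).re = ∫ x, ((V x : ℂ) * u x * conj (v x)).re :=
    (Complex.reCLM.integral_comp_comm hi).symm
  have hir : Integrable fun x => ((V x : ℂ) * u x * conj (v x)).re := hi.re
  have h2 : Integrable fun x => V x * ‖u x‖ ^ 2 + 2 * t * ((V x : ℂ) * u x * conj (v x)).re :=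
    (MemLp.integrable_pot_sq hd hV hu).add (hir.const_mul _)
  rw [hre, ← integral_const_mul, ← integral_const_mul,
    ← integral_add (MemLp.integrable_pot_sq hd hV hu) (hir.const_mul _),
    ← integral_add h2 ((MemLp.integrable_pot_sq hd hV hv).const_mul _)]
  refine integral_congr_ae (ae_of_all _ fun x => ?_)
  simp only [Pi.add_apply, Pi.smul_apply, smul_eq_mul]
  rw [norm_add_ofReal_mul_sq, mul_assoc (V x : ℂ), Complex.re_ofReal_mul]
  ring

/-- Along a line, `P` is a quartic polynomial; its linear coefficient is the first variation. -/
lemma exists_P_add_smul {γ : ℝ} (hγ : IsExponent d γ) {u v : E d → ℂ} (hu : MemH1 u)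
    (hv : MemH1 v) : ∃ c₂ c₃ c₄ : ℝ, ∀ t : ℝ, P γ (u + (t : ℂ) • v) = P γ u +
      t * (4 * ∫ x, (u x * conj (v x)).re * hartreePotential γ u x) +
      t ^ 2 * c₂ + t ^ 3 * c₃ + t ^ 4 * c₄ := by
  have hd := hγ.dim
  set A : E d → ℝ := fun x => ‖u x‖ ^ 2 with hA
  set B : E d → ℝ := fun x => ‖v x‖ ^ 2 with hB
  set R : E d → ℝ := fun x => (u x * conj (v x)).re with hR
  have hAd : IsDens A := hu.isDens_sq hd
  have hBd : IsDens B := hv.isDens_sq hd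
  have hRd : IsDens R := hu.isDens_re hd hv
  refine ⟨4 * hartreeForm γ R R + 2 * hartreeForm γ A B, 4 * hartreeForm γ R B, hartreeForm γ B B,
    fun t => ?_⟩
  have hX : (fun x => ‖(u + (t : ℂ) • v) x‖ ^ 2)
      = (A + fun x => (2 * t) * R x) + fun x => t ^ 2 * B x := by
    ext x
    simp only [Pi.add_apply, Pi.smul_apply, smul_eq_mul, hA, hB, hR]
    exact norm_add_ofReal_mul_sq _ _ _
  have hR' := hRd.const_mul hd (2 * t)
  have hB' := hBd.const_mul hd (t ^ 2)
  have hAR := hAd.add hd hR'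
  rw [P_eq_hartreeForm hγ (hu.add (hv.const_smul _)), P_eq_hartreeForm hγ hu, hX,
    ← hartreeForm_sq_right hγ hRd hu,
    hartreeForm_add_left hγ hAR hB' (hAR.add hd hB'), hartreeForm_add_left hγ hAd hR' (hAR.add hd hB'),
    hartreeForm_add_right hγ hAd hAR hB', hartreeForm_add_right hγ hR' hAR hB',
    hartreeForm_add_right hγ hB' hAR hB', hartreeForm_add_right hγ hAd hAd hR',
    hartreeForm_add_right hγ hR' hAd hR', hartreeForm_add_right hγ hB' hAd hR']
  simp only [hartreeForm_const_mul_left, hartreeForm_const_mul_right]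
  rw [hartreeForm_comm γ A R, hartreeForm_comm γ B R, hartreeForm_comm γ B A]
  ring

lemma eq_zero_of_forall_poly_nonneg {b c₂ c₃ c₄ : ℝ}
    (h : ∀ t : ℝ, 0 ≤ t * b + t ^ 2 * c₂ + t ^ 3 * c₃ + t ^ 4 * c₄) : b = 0 := by
  have h1 : HasDerivAt (fun t : ℝ => t * b + t ^ 2 * c₂ + t ^ 3 * c₃ + t ^ 4 * c₄) b 0 := by
    have := (((hasDerivAt_id (0 : ℝ)).mul_const b).fun_add
      ((hasDerivAt_pow 2 (0 : ℝ)).mul_const c₂)).fun_add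
      ((hasDerivAt_pow 3 (0 : ℝ)).mul_const c₃) |>.fun_add ((hasDerivAt_pow 4 (0 : ℝ)).mul_const c₄)
    simpa using this
  refine IsLocalMin.hasDerivAt_eq_zero (f := fun t : ℝ =>
    t * b + t ^ 2 * c₂ + t ^ 3 * c₃ + t ^ 4 * c₄) (Eventually.of_forall fun t => ?_) h1
  simpa using h t

lemma integrable_hartreePotential_mul {γ : ℝ} (hγ : IsExponent d γ) {u φ : E d → ℂ} (hu : MemH1 u)
    (hφ : MemH1 φ) : Integrable (fun x => (hartreePotential γ u x : ℂ) * u x * conj (φ x)) := by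
  have h1 := integrable_mul_hartreePotential hγ (hu.isDens_re hγ.dim hφ) hu
  have h2 := integrable_mul_hartreePotential hγ
    (hu.isDens_re hγ.dim (hφ.const_smul Complex.I)) hu
  refine (h1.ofReal.add (h2.ofReal.mul_const Complex.I) : Integrable _ _).congr
    (ae_of_all _ fun x => ?_)
  have e : (u x * conj ((Complex.I • φ) x)).re = (u x * conj (φ x)).im := by
    simp only [Pi.smul_apply, smul_eq_mul, map_mul, Complex.conj_I]
    have : u x * (-Complex.I * conj (φ x)) = -Complex.I * (u x * conj (φ x)) := by ring
    rw [this]; simp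
  simp only [Pi.add_apply, e]
  rw [mul_assoc]
  conv_rhs => rw [← Complex.re_add_im (u x * conj (φ x))]
  push_cast
  simp
  ring

/-- The Euler–Lagrange equation: a maximizer of `P / (‖·‖²_{Ḣ¹_V} + a ‖·‖²)²` of the right
amplitude is a weak solution. -/
lemma isWeakSolution_of_forall_P_le {γ : ℝ} (hγ : IsExponent d γ) {V : E d → ℝ}
    (hV : MemLp V ((d : ℝ≥0∞) / 2) volume) {a c : ℝ} {Q : E d → ℂ} (hQ : MemH1 Q)
    (hle : ∀ u, MemH1 u → P γ u ≤ c * (energySq V u + a * massSq u) ^ 2)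
    (heq : P γ Q = c * (energySq V Q + a * massSq Q) ^ 2)
    (hone : c * (energySq V Q + a * massSq Q) = 1) : IsWeakSolution γ V a Q := by
  have hd := hγ.dim
  set Z : (E d → ℂ) → ℂ := fun φ =>
    (∑ i : Fin d, ∫ x, weakPartial i Q x * conj (weakPartial i φ x))
      + (∫ x, (V x : ℂ) * Q x * conj (φ x)) + (a : ℂ) * (∫ x, Q x * conj (φ x))
      - (∫ x, (hartreePotential γ Q x : ℂ) * Q x * conj (φ x)) with hZ
  have hre : ∀ φ, MemH1 φ → (Z φ).re = 0 := by
    intro φ hφ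
    obtain ⟨c₂, c₃, c₄, hP⟩ := exists_P_add_smul hγ hQ hφ
    set A0 := energySq V Q + a * massSq Q with hA0
    set A2 := energySq V φ + a * massSq φ with hA2
    set L : ℝ := (∑ i : Fin d, ∫ x, weakPartial i Q x * conj (weakPartial i φ x)).re
      + (∫ x, (V x : ℂ) * Q x * conj (φ x)).re + a * (∫ x, Q x * conj (φ x)).re with hL
    set B : ℝ := ∫ x, (Q x * conj (φ x)).re * hartreePotential γ Q x with hB
    have hA : ∀ t : ℝ, energySq V (Q + (t : ℂ) • φ) + a * massSq (Q + (t : ℂ) • φ)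
        = A0 + 2 * t * L + t ^ 2 * A2 := by
      intro t
      simp only [energySq, hA0, hA2, hL]
      rw [gradSq_add_smul hQ hφ, massSq_add_smul hQ.1 hφ.1, integral_pot_add_smul hd hV hQ hφ]
      ring
    have hpoly : ∀ t : ℝ, 0 ≤ t * (4 * (L - B)) + t ^ 2 * (c * (4 * L ^ 2 + 2 * A0 * A2) - c₂)
        + t ^ 3 * (c * 4 * L * A2 - c₃) + t ^ 4 * (c * A2 ^ 2 - c₄) := by
      intro t
      have h1 := hle _ (hQ.add (hφ.const_smul (t : ℂ)))
      rw [hA, hP, heq] at h1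
      have h2 : c * (A0 + 2 * t * L + t ^ 2 * A2) ^ 2 = c * A0 ^ 2 + 4 * t * (c * A0) * L
        + t ^ 2 * (c * (4 * L ^ 2 + 2 * A0 * A2)) + t ^ 3 * (c * 4 * L * A2)
        + t ^ 4 * (c * A2 ^ 2) := by ring
      rw [h2, hone] at h1
      linarith
    have hLB := eq_zero_of_forall_poly_nonneg hpoly
    have hBre : (∫ x, (hartreePotential γ Q x : ℂ) * Q x * conj (φ x)).re = B := by
      rw [hB, ← Complex.reCLM_apply,
        ← Complex.reCLM.integral_comp_comm (integrable_hartreePotential_mul hγ hQ hφ)]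
      refine integral_congr_ae (ae_of_all _ fun x => ?_)
      simp only [Complex.reCLM_apply]
      rw [mul_assoc, Complex.re_ofReal_mul, mul_comm]
    simp only [hZ, Complex.sub_re, Complex.add_re, Complex.re_ofReal_mul, hBre]
    linarith
  refine ⟨hQ, fun φ hφ => ?_⟩
  change Z φ = 0
  have hI : Z (Complex.I • φ) = -Complex.I * Z φ := by
    have e1 : ∀ i, ∫ x, weakPartial i Q x * conj (weakPartial i (Complex.I • φ) x)
        = -Complex.I * ∫ x, weakPartial i Q x * conj (weakPartial i φ x) := by
      intro i
      rw [← integral_const_mul]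
      refine integral_congr_ae ?_
      filter_upwards [(hφ.hasGrad.const_smul Complex.I).weakPartial_ae i] with x hx
      rw [hx]
      simp only [Pi.smul_apply, smul_eq_mul, map_mul, Complex.conj_I]; ring
    have e2 : ∀ F : E d → ℂ, ∫ x, F x * conj ((Complex.I • φ) x)
        = -Complex.I * ∫ x, F x * conj (φ x) := by
      intro F
      rw [← integral_const_mul]
      refine integral_congr_ae (ae_of_all _ fun x => ?_)
      simp only [Pi.smul_apply, smul_eq_mul, map_mul, Complex.conj_I]; ring
    simp only [hZ, e1, ← Finset.mul_sum]
    rw [e2 (fun x => (V x : ℂ) * Q x), e2 Q, e2 (fun x => (hartreePotential γ Q x : ℂ) * Q x)]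
    ring
  have h1 := hre φ hφ
  have h2 := hre _ (hφ.const_smul Complex.I)
  rw [hI] at h2
  refine Complex.ext h1 ?_
  simpa using h2

/-! ### The free variational problem -/

lemma nonzeroH1_of_massSq_pos {u : E d → ℂ} (hu : MemH1 u) (h : 0 < massSq u) : NonzeroH1 u := by
  refine ⟨hu, fun h0 => ?_⟩
  have : massSq u = 0 := integral_eq_zero_of_ae (h0.mono fun x hx => by simp [hx])
  linarith

lemma NonzeroH1.comp_affine {u : E d → ℂ} (hu : NonzeroH1 u) {r : ℝ} (hr : 0 < r) (b : E d) :
    NonzeroH1 (fun x => u (r • x + b)) := by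
  refine nonzeroH1_of_massSq_pos (hu.1.comp_affine hr b) ?_
  rw [massSq_comp_affine u hr]
  have := massSq_pos hu
  positivity

lemma NonzeroH1.const_smul {u : E d → ℂ} (hu : NonzeroH1 u) {c : ℂ} (hc : c ≠ 0) :
    NonzeroH1 (c • u) := by
  refine nonzeroH1_of_massSq_pos (hu.1.const_smul c) ?_
  rw [massSq_smul]
  have := massSq_pos hu
  have := norm_pos_iff.2 hc
  positivity

lemma P_eq_zero {γ : ℝ} (hγ : IsExponent d γ) {u : E d → ℂ} (hu : MemH1 u) (h : ¬ NonzeroH1 u) :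
    P γ u = 0 := by
  have h0 : u =ᵐ[volume] 0 := by
    by_contra h1; exact h ⟨hu, h1⟩
  have h1 : (fun x => ‖u x‖ ^ 2) =ᵐ[volume] fun _ => (0 : ℝ) := h0.mono fun x hx => by simp [hx]
  rw [P_eq_hartreeForm hγ hu, hartreeForm_congr_ae h1 h1]
  simp [hartreeForm]

/-- The free inhomogeneous inequality `P ≤ S (‖∇·‖² + ‖·‖²)²` has an optimizer: a maximizing
sequence, translated so that it keeps mass in a fixed ball, has a nonzero profile, and the profile
carries everything. -/
lemma exists_free_maximizer {γ : ℝ} (hγ : IsExponent d γ) :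
    ∃ S : ℝ, 0 < S ∧ (∀ u : E d → ℂ, MemH1 u → P γ u ≤ S * (gradSq u + massSq u) ^ 2) ∧
      ∃ w : E d → ℂ, NonzeroH1 w ∧ gradSq w + massSq w = 1 ∧ P γ w = S := by
  set T : Set ℝ := {p | ∃ u : E d → ℂ, NonzeroH1 u ∧ gradSq u + massSq u = 1 ∧ P γ u = p} with hT
  obtain ⟨K, hK⟩ := exists_P_le hγ 1
  have hbdd : BddAbove T := by
    refine ⟨K, ?_⟩
    rintro p ⟨u, hu, h1, rfl⟩
    exact hK u hu.1 (by linarith [massSq_nonneg u]) (by linarith [gradSq_nonneg u])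
  have hnorm : ∀ u : E d → ℂ, NonzeroH1 u → P γ u / (gradSq u + massSq u) ^ 2 ∈ T := by
    intro u hu
    have hA : 0 < gradSq u + massSq u := by linarith [gradSq_nonneg u, massSq_pos hu]
    set s : ℝ := (√(gradSq u + massSq u))⁻¹ with hs
    have hs0 : 0 < s := by positivity
    have hs2 : s ^ 2 = (gradSq u + massSq u)⁻¹ := by
      rw [hs, inv_pow, Real.sq_sqrt hA.le]
    have hsn : ‖(s : ℂ)‖ = s := by simp [abs_of_pos hs0]
    refine ⟨(s : ℂ) • u, hu.const_smul (by exact_mod_cast hs0.ne'), ?_, ?_⟩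
    · rw [gradSq_smul hu.1, massSq_smul, hsn, ← mul_add, hs2, inv_mul_cancel₀ hA.ne']
    · rw [P_smul, hsn, (by ring : s ^ 4 = (s ^ 2) ^ 2), hs2]
      field_simp
  obtain ⟨u₀, hu₀⟩ := exists_nonzeroH1 (d := d)
  have hne : T.Nonempty := ⟨_, hnorm u₀ hu₀⟩
  set S := sSup T with hS
  have hSpos : 0 < S := by
    refine lt_of_lt_of_le ?_ (le_csSup hbdd (hnorm u₀ hu₀))
    have := P_pos hγ hu₀
    have : 0 < gradSq u₀ + massSq u₀ := by linarith [gradSq_nonneg u₀, massSq_pos hu₀]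
    positivity
  have hle : ∀ u : E d → ℂ, MemH1 u → P γ u ≤ S * (gradSq u + massSq u) ^ 2 := by
    intro u hu
    by_cases h : NonzeroH1 u
    · have hA : 0 < gradSq u + massSq u := by linarith [gradSq_nonneg u, massSq_pos h]
      have := le_csSup hbdd (hnorm u h)
      rwa [div_le_iff₀ (by positivity)] at this
    · rw [P_eq_zero hγ hu h]; positivity
  refine ⟨S, hSpos, hle, ?_⟩
  obtain ⟨p, -, hp, hpT⟩ := exists_seq_tendsto_sSup hne hbdd
  obtain ⟨N, hN⟩ := eventually_atTop.1 (hp.eventually_const_le (half_lt_self hSpos))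
  have hp' : Tendsto (fun n => p (n + N)) atTop (𝓝 S) := (tendsto_add_atTop_iff_nat N).2 hp
  choose u hu hu1 huP using fun n => hpT (n + N)
  obtain ⟨R, κ, hR, hκ, hball⟩ := exists_ball_mass_ge hγ (half_pos hSpos) zero_le_one
  have hg1 : ∀ n, gradSq (u n) ≤ 1 := fun n => by linarith [hu1 n, massSq_nonneg (u n)]
  have hm1 : ∀ n, massSq (u n) ≤ 1 := fun n => by linarith [hu1 n, gradSq_nonneg (u n)]
  choose y hy using fun n => hball (u n) (hu n).1 (hg1 n) (hm1 n)
    (by rw [huP]; exact hN _ (Nat.le_add_left _ _))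
  set v : ℕ → E d → ℂ := fun n x => u n ((1 : ℝ) • x + y n) with hv
  have hvH : ∀ n, MemH1 (v n) := fun n => (hu n).1.comp_affine one_pos _
  have hvm : ∀ n, massSq (v n) = massSq (u n) := fun n => by
    rw [hv, massSq_comp_affine _ one_pos]; simp
  have hvg : ∀ n, gradSq (v n) = gradSq (u n) := fun n => by
    rw [hv, gradSq_comp_affine (hu n).1 one_pos]; simp
  have hvP : ∀ n, P γ (v n) = p (n + N) := fun n => by
    rw [hv, P_comp_affine _ _ one_pos, ← huP]; simp
  obtain ⟨φ, w, C', hφ, hw, hm', hg', tm, tg, tP, -⟩ := exists_profile hγ hvH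
    (fun n => (hvm n).le.trans (hm1 n)) (fun n => (hvg n).le.trans (hg1 n)) (R := R) hκ (fun n => by
      have := lintegral_ball_comp_affine (f := fun x => ‖u n x‖ₑ ^ 2) one_pos (y n) R
      rw [one_mul, one_pow, inv_one, ENNReal.ofReal_one, one_mul] at this
      exact (hy n).trans this.ge)
  have hwA : 0 < gradSq w + massSq w := by linarith [gradSq_nonneg w, massSq_pos hw]
  have core := profile_eq_of_split (p := fun n => P γ (v (φ n))) (p' := fun n => P γ (v (φ n) - w))
    (a := fun n => gradSq (v (φ n)) + massSq (v (φ n)))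
    (a' := fun n => gradSq (v (φ n) - w) + massSq (v (φ n) - w)) hSpos
    (by simp only [hvP]; exact hp'.comp hφ.tendsto_atTop)
    (by simp only [hvg, hvm, hu1]; exact tendsto_const_nhds) tP
    ((tg.add tm).congr fun n => by ring) hwA (fun n => hle _ ((hvH _).sub hw.1))
    (fun n => add_nonneg (gradSq_nonneg _) (massSq_nonneg _)) (hle w hw.1) le_rfl
  exact ⟨w, hw, core.1, core.2.1⟩

lemma energySq_zero (u : E d → ℂ) : energySq 0 u = gradSq u := by simp [energySq]

/-- The Nehari identity, from testing the equation with the solution itself. -/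
lemma IsWeakSolution.gradSq_add_massSq_eq {γ : ℝ} {u : E d → ℂ}
    (h : IsWeakSolution γ 0 1 u) : gradSq u + massSq u = P γ u := by
  have h1 := h.2 u h.1
  have e0 : ∀ f : E d → ℂ, ∫ x, f x * conj (f x) = (massSq f : ℂ) := fun f => by
    rw [massSq, ← integral_complex_ofReal]
    refine integral_congr_ae (ae_of_all _ fun x => ?_)
    simp only [Complex.mul_conj, Complex.normSq_eq_norm_sq]
  have e1 : ∫ x, (hartreePotential γ u x : ℂ) * u x * conj (u x) = (P γ u : ℂ) := by
    rw [P, ← integral_complex_ofReal]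
    refine integral_congr_ae (ae_of_all _ fun x => ?_)
    simp only [mul_assoc, Complex.mul_conj, Complex.normSq_eq_norm_sq]
    push_cast; ring
  simp only [e0, e1] at h1
  rw [← Complex.ofReal_sum, ← gradSq_eq_sum] at h1
  simp only [Pi.zero_apply, Complex.ofReal_zero, zero_mul, integral_zero, add_zero,
    Complex.ofReal_one, one_mul] at h1
  have h2 : ((gradSq u + massSq u - P γ u : ℝ) : ℂ) = 0 := by push_cast; exact h1
  linarith [Complex.ofReal_eq_zero.1 h2]

/-- Ground states exist and optimize `P ≤ S (‖∇·‖² + ‖·‖²)²`: by the Nehari identity the action of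
a solution is `¼ (‖∇u‖² + ‖u‖²)`, which is at least `¼ S⁻¹`, with equality exactly for optimizers. -/
lemma exists_groundState {γ : ℝ} (hγ : IsExponent d γ) :
    ∃ S : ℝ, 0 < S ∧ (∀ u : E d → ℂ, MemH1 u → P γ u ≤ S * (gradSq u + massSq u) ^ 2) ∧
      (∃ Q : E d → ℂ, IsFreeGroundState γ Q) ∧ ∀ Q : E d → ℂ, IsFreeGroundState γ Q →
        NonzeroH1 Q ∧ P γ Q = S * (gradSq Q + massSq Q) ^ 2 := by
  obtain ⟨S, hS, hle, w, hw, hw1, hwP⟩ := exists_free_maximizer hγ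
  set s : ℝ := (√S)⁻¹ with hs
  have hs0 : 0 < s := by positivity
  have hs2 : s ^ 2 = S⁻¹ := by rw [hs, inv_pow, Real.sq_sqrt hS.le]
  have hsn : ‖(s : ℂ)‖ = s := by simp [abs_of_pos hs0]
  set Q₀ : E d → ℂ := (s : ℂ) • w with hQ₀
  have hQn : NonzeroH1 Q₀ := hw.const_smul (by exact_mod_cast hs0.ne')
  have hQA : gradSq Q₀ + massSq Q₀ = S⁻¹ := by
    rw [hQ₀, gradSq_smul hw.1, massSq_smul, hsn, ← mul_add, hs2, hw1, mul_one]
  have hQP : P γ Q₀ = S⁻¹ := by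
    rw [hQ₀, P_smul, hsn, (by ring : s ^ 4 = (s ^ 2) ^ 2), hs2, hwP]
    field_simp
  have hQsol : IsWeakSolution γ 0 1 Q₀ := by
    refine isWeakSolution_of_forall_P_le hγ MemLp.zero (c := S) hQn.1 (fun u hu => ?_) ?_ ?_
    · rw [energySq_zero, one_mul]; exact hle u hu
    · rw [energySq_zero, one_mul, hQA, hQP]; field_simp
    · rw [energySq_zero, one_mul, hQA, mul_inv_cancel₀ hS.ne']
  have hact : ∀ v : E d → ℂ, IsWeakSolution γ 0 1 v →
      freeAction γ v = 1 / 4 * (gradSq v + massSq v) := fun v hv => by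
    rw [freeAction, ← hv.gradSq_add_massSq_eq]; ring
  have hlow : ∀ v : E d → ℂ, IsWeakSolution γ 0 1 v → ¬ v =ᵐ[volume] 0 →
      S⁻¹ ≤ gradSq v + massSq v := by
    intro v hv hv0
    have h1 := hle v hv.1
    rw [← hv.gradSq_add_massSq_eq] at h1
    have h2 : 0 < gradSq v + massSq v := by linarith [gradSq_nonneg v, massSq_pos ⟨hv.1, hv0⟩]
    rw [inv_le_iff_one_le_mul₀' hS]
    by_contra! h3
    nlinarith
  refine ⟨S, hS, hle, ⟨Q₀, hQsol, hQn.2, fun v hv hv0 => ?_⟩, fun Q hQ => ?_⟩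
  · rw [hact _ hQsol, hact _ hv, hQA]
    linarith [hlow v hv hv0]
  · refine ⟨⟨hQ.1.1, hQ.2.1⟩, ?_⟩
    have h1 := hQ.2.2 Q₀ hQsol hQn.2
    rw [hact _ hQsol, hact _ hQ.1, hQA] at h1
    have h2 : gradSq Q + massSq Q = S⁻¹ := le_antisymm (by linarith) (hlow Q hQ.1 hQ.2.1)
    rw [← hQ.1.gradSq_add_massSq_eq, h2]
    field_simp

/-- The sharp constant of the free Gagliardo–Nirenberg–Hartree inequality, attained at every
ground state. It comes from the inhomogeneous inequality by optimizing over dilations. -/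
lemma exists_free_constant {γ : ℝ} (hγ : IsExponent d γ) :
    ∃ S : ℝ, 0 < S ∧ (∀ u : E d → ℂ, MemH1 u → P γ u ≤ S * weight γ (gradSq u) (massSq u)) ∧
      (∃ Q : E d → ℂ, IsFreeGroundState γ Q) ∧ ∀ Q : E d → ℂ, IsFreeGroundState γ Q →
        NonzeroH1 Q ∧ P γ Q = S * weight γ (gradSq Q) (massSq Q) := by
  obtain ⟨S, hS, hle, hex, hgs⟩ := exists_groundState hγ
  have h0 := hγ.pos
  have h4 := hγ.lt_four
  set θ : ℝ := γ / 4 with hθ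
  have hθ0 : 0 < θ := by positivity
  have hθ1 : 0 < 1 - θ := by rw [hθ]; linarith
  have hk : 0 < weight γ θ (1 - θ) := weight_pos γ hθ0 hθ1
  have hup : ∀ u : E d → ℂ, MemH1 u →
      P γ u ≤ S / weight γ θ (1 - θ) * weight γ (gradSq u) (massSq u) := by
    intro u hu
    by_cases hn : NonzeroH1 u
    · have hg := gradSq_pos hγ.dim hn
      have hm := massSq_pos hn
      set g := gradSq u
      set m := massSq u
      -- the dilation balancing the two terms
      set r : ℝ := √(θ * m / ((1 - θ) * g)) with hr
      have hr0 : 0 < r := by positivity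
      have hr2 : r ^ 2 = θ * m / ((1 - θ) * g) := Real.sq_sqrt (by positivity)
      have h1 := hle _ (hu.comp_affine hr0 0)
      rw [P_comp_affine γ u hr0, gradSq_comp_affine hu hr0, massSq_comp_affine u hr0] at h1
      have h2 : r ^ γ * P γ u ≤ S * (r ^ 2 * g + m) ^ 2 := by
        have hrd : 0 < (r ^ d)⁻¹ := by positivity
        refine le_of_mul_le_mul_left ?_ (mul_pos hrd hrd)
        calc _ = (r ^ d)⁻¹ * ((r ^ d)⁻¹ * (r ^ γ * P γ u)) := by ring
          _ ≤ _ := h1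
          _ = _ := by ring
      set X := m / (1 - θ) with hX
      have hX0 : 0 < X := by positivity
      have h3 : r ^ 2 * g = θ * X := by rw [hr2, hX]; field_simp
      have h3' : m = (1 - θ) * X := by rw [hX]; field_simp
      have h5 : r ^ 2 * g + m = X := by rw [h3]; linarith
      have h6 : weight γ (r ^ 2 * g) (1 * m) = weight γ (r ^ 2) 1 * weight γ g m :=
        weight_mul γ (by positivity) zero_le_one
      have h7 : weight γ (r ^ 2) 1 = r ^ γ := by
        rw [weight, Real.sqrt_sq hr0.le, Real.sqrt_one, Real.one_rpow, mul_one]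
      have h8 : weight γ (r ^ 2 * g) (1 * m) = weight γ θ (1 - θ) * X ^ 2 := by
        rw [h3, one_mul, h3', weight_mul γ hθ0.le hθ1.le, weight_self γ hX0]
      rw [h5] at h2
      rw [h8, h7] at h6
      have hrg : 0 < r ^ γ := Real.rpow_pos_of_pos hr0 γ
      refine le_of_mul_le_mul_left ?_ hrg
      calc _ ≤ S * X ^ 2 := h2
        _ = S / weight γ θ (1 - θ) * (weight γ θ (1 - θ) * X ^ 2) := by field_simp
        _ = _ := by rw [h6]; ring
    · rw [P_eq_zero hγ hu hn]
      have : 0 ≤ weight γ (gradSq u) (massSq u) := by unfold weight; positivity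
      positivity
  refine ⟨S / weight γ θ (1 - θ), by positivity, hup, hex, fun Q hQ => ?_⟩
  obtain ⟨hn, hP⟩ := hgs Q hQ
  refine ⟨hn, le_antisymm (hup Q hn.1) ?_⟩
  have hg := gradSq_nonneg Q
  have hm := massSq_nonneg Q
  have h1 : weight γ (gradSq Q) (massSq Q) =
      weight γ θ (1 - θ) * weight γ (gradSq Q / θ) (massSq Q / (1 - θ)) := by
    rw [← weight_mul γ hθ0.le hθ1.le]
    congr 1 <;> field_simp
  have h2 := weight_le h0.le h4.le (div_nonneg hg hθ0.le) (div_nonneg hm hθ1.le)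
  rw [← hθ, mul_div_cancel₀ _ hθ0.ne', mul_div_cancel₀ _ hθ1.ne'] at h2
  rw [hP, h1]
  calc _ = S * weight γ (gradSq Q / θ) (massSq Q / (1 - θ)) := by field_simp
    _ ≤ _ := by gcongr

/-! ### Rescaled potentials -/

/-- The potential `r² V(r x + b)`, which acts on `u(r · + b)` as `V` acts on `u`. -/
def rescale (V : E d → ℝ) (r : ℝ) (b : E d) : E d → ℝ := fun x => r ^ 2 * V (r • x + b)

lemma tendsto_zero_of_eventually_le_ofReal {F : ℕ → ℝ≥0∞}
    (h : ∀ η : ℝ, 0 < η → ∀ᶠ n in atTop, F n ≤ ENNReal.ofReal η) : Tendsto F atTop (𝓝 0) := by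
  rw [ENNReal.tendsto_nhds_zero]
  intro ε hε
  obtain ⟨r, hr0, hr⟩ := ENNReal.lt_iff_exists_nnreal_btwn.1 hε
  filter_upwards [h r (by exact_mod_cast hr0)] with n hn
  exact hn.trans (by rw [ENNReal.ofReal_coe_nnreal]; exact hr.le)

lemma memLp_rescale {p : ℝ≥0∞} {V : E d → ℝ} (hV : MemLp V p volume) {r : ℝ} (hr : 0 < r)
    (b : E d) : MemLp (rescale V r b) p volume := (memLp_comp_affine hV hr b).const_mul _

/-- The Hölder–Sobolev bound is invariant under rescaling of the potential. -/
lemma exists_rescale_le (hd : 3 ≤ d) : ∃ C : NNReal, ∀ (V : E d → ℝ) (r : ℝ) (b : E d)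
    (w : E d → ℂ), AEStronglyMeasurable V volume → 0 < r → MemH1 w →
      ∫⁻ x, ‖rescale V r b x‖ₑ * ‖w x‖ₑ ^ 2 ≤
        C * eLpNorm V ((d : ℝ≥0∞) / 2) volume * ENNReal.ofReal (gradSq w) := by
  obtain ⟨C, hC⟩ := exists_hoelder_sobolev hd
  refine ⟨C, fun V r b w hV hr hw => ?_⟩
  have hri : 0 < r⁻¹ := inv_pos.2 hr
  have h1 := hC V _ hV.aemeasurable (hw.comp_affine hri (-(r⁻¹ • b)))
  have h2 := lintegral_comp_affine
    (fun y => ‖V y‖ₑ * ‖w (r⁻¹ • y + -(r⁻¹ • b))‖ₑ ^ 2) hr b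
  have e : ∀ x, r⁻¹ • (r • x + b) + -(r⁻¹ • b) = x := fun x => by
    rw [smul_add, smul_smul, inv_mul_cancel₀ hr.ne', one_smul]; abel
  simp only [e] at h2
  have e2 : ∫⁻ x, ‖rescale V r b x‖ₑ * ‖w x‖ₑ ^ 2
      = ENNReal.ofReal (r ^ 2) * ∫⁻ x, ‖V (r • x + b)‖ₑ * ‖w x‖ₑ ^ 2 := by
    rw [← lintegral_const_mul' _ _ ENNReal.ofReal_ne_top]
    refine lintegral_congr fun x => ?_
    rw [rescale, enorm_mul, Real.enorm_of_nonneg (by positivity : (0:ℝ) ≤ r ^ 2), mul_assoc]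
  rw [e2, h2]
  rw [gradSq_comp_affine hw hri] at h1
  calc _ ≤ ENNReal.ofReal (r ^ 2) * (ENNReal.ofReal (r ^ d)⁻¹ * (C * eLpNorm V ((d : ℝ≥0∞) / 2)
        volume * ENNReal.ofReal ((r⁻¹ ^ d)⁻¹ * (r⁻¹ ^ 2 * gradSq w)))) := by gcongr
    _ = C * eLpNorm V ((d : ℝ≥0∞) / 2) volume * (ENNReal.ofReal (r ^ 2) *
        (ENNReal.ofReal (r ^ d)⁻¹ * ENNReal.ofReal ((r⁻¹ ^ d)⁻¹ * (r⁻¹ ^ 2 * gradSq w)))) := by ring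
    _ = _ := by
        rw [← ENNReal.ofReal_mul (by positivity), ← ENNReal.ofReal_mul (by positivity)]
        congr 2
        rw [inv_pow, inv_inv, inv_pow]
        field_simp

/-- Bounded functions of bounded support are dense in `L^{d/2}`. -/
lemma exists_bounded_approx {V : E d → ℝ} (hV : MemLp V ((d : ℝ≥0∞) / 2) volume)
    {ε : ℝ} (hε : 0 < ε) : ∃ (U : E d → ℝ) (M ρ : ℝ), 0 ≤ M ∧ 0 ≤ ρ ∧
      MemLp U ((d : ℝ≥0∞) / 2) volume ∧ Measurable U ∧
      (∀ x, |U x| ≤ M) ∧ (∀ x, ρ < ‖x‖ → U x = 0) ∧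
      eLpNorm (V - U) ((d : ℝ≥0∞) / 2) volume ≤ ENNReal.ofReal ε := by
  obtain ⟨U, hUc, hUε, hUcont, hUm⟩ := hV.exists_hasCompactSupport_eLpNorm_sub_le
    (ENNReal.div_ne_top (by simp) (by simp)) (ENNReal.ofReal_pos.2 hε).ne'
  obtain ⟨M, hM⟩ := hUcont.bounded_above_of_compact_support hUc
  obtain ⟨ρ, hρ⟩ := hUc.isCompact.isBounded.subset_closedBall 0
  refine ⟨U, M, max ρ 0, (norm_nonneg _).trans (hM 0), le_max_right _ _, hUm, hUcont.measurable,
    fun x => hM x, fun x hx => ?_, hUε⟩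
  refine image_eq_zero_of_notMem_tsupport fun h => ?_
  have := hρ h
  rw [mem_closedBall_zero_iff] at this
  exact absurd this (not_le.2 (lt_of_le_of_lt (le_max_left _ _) hx))

/-- Rescaled potentials `r² V(r x + b)` act negligibly on a fixed function when `r` is small,
when `r` is large, and when `b` is large. -/
lemma exists_rescale_small (hd : 3 ≤ d) {V : E d → ℝ} (hV : MemLp V ((d : ℝ≥0∞) / 2) volume)
    {w : E d → ℂ} (hw : MemH1 w) {ε : ℝ} (hε : 0 < ε) :
    ∃ K : ℝ, 1 ≤ K ∧ ∀ (r : ℝ) (b : E d), 0 < r → (r < K⁻¹ ∨ K < r ∨ K < ‖b‖) →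
      ∫⁻ x, ‖rescale V r b x‖ₑ * ‖w x‖ₑ ^ 2 ≤ ENNReal.ofReal ε := by
  obtain ⟨C, hC⟩ := exists_rescale_le hd
  -- replace `V` by a bounded compactly supported `U`
  obtain ⟨U, M, ρ, hM0, hρ0, hU, hUm, hUM, hUρ, hUε⟩ := exists_bounded_approx hV
    (ε := ε / (3 * (C + 1) * (gradSq w + 1)))
    (by have := gradSq_nonneg w; positivity)
  have hg := gradSq_nonneg w
  have h1 : ∀ (r : ℝ) (b : E d), 0 < r →
      ∫⁻ x, ‖rescale (V - U) r b x‖ₑ * ‖w x‖ₑ ^ 2 ≤ ENNReal.ofReal (ε / 3) := by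
    intro r b hr
    refine (hC _ r b w (hV.1.sub hU.1) hr hw).trans ?_
    calc _ ≤ (C : ℝ≥0∞) * ENNReal.ofReal (ε / (3 * (C + 1) * (gradSq w + 1))) *
          ENNReal.ofReal (gradSq w) := by gcongr
      _ = ENNReal.ofReal (C * (ε / (3 * (C + 1) * (gradSq w + 1))) * gradSq w) := by
          rw [ENNReal.ofReal_mul (by positivity), ENNReal.ofReal_mul (by positivity),
            ENNReal.ofReal_coe_nnreal]
      _ ≤ _ := by
          refine ENNReal.ofReal_le_ofReal ?_
          have h2 : (C : ℝ) * gradSq w ≤ (C + 1) * (gradSq w + 1) := by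
            have : (0 : ℝ) ≤ C := C.2
            nlinarith
          calc (C : ℝ) * (ε / (3 * (C + 1) * (gradSq w + 1))) * gradSq w
              = ε / 3 * ((C * gradSq w) / ((C + 1) * (gradSq w + 1))) := by field_simp
            _ ≤ ε / 3 * 1 := by
                gcongr
                exact div_le_one_of_le₀ h2 (by positivity)
            _ = _ := mul_one _
  -- replace `w` by a test function `φ`
  set N : ℝ := (eLpNorm U ((d : ℝ≥0∞) / 2) volume).toReal with hN
  have hN0 : 0 ≤ N := ENNReal.toReal_nonneg
  obtain ⟨φs, hφs, -, hφg, -⟩ := hw.exists_test_seq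
  obtain ⟨n, hn⟩ := (hφg.eventually_le_const
    (by positivity : 0 < ε / (6 * (C + 1) * (N + 1)))).exists
  set φ := φs n with hφdef
  have hφ : IsTest φ := hφs n
  have hφH : MemH1 φ := hφ.hasGrad.memH1
  have h2 : ∀ (r : ℝ) (b : E d), 0 < r →
      2 * ∫⁻ x, ‖rescale U r b x‖ₑ * ‖(φ - w) x‖ₑ ^ 2 ≤ ENNReal.ofReal (ε / 3) := by
    intro r b hr
    calc _ ≤ 2 * ((C : ℝ≥0∞) * ENNReal.ofReal N * ENNReal.ofReal (gradSq (φ - w))) := by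
          gcongr
          refine (hC _ r b _ hU.1 hr (hφH.sub hw)).trans (le_of_eq ?_)
          rw [hN, ENNReal.ofReal_toReal hU.2.ne]
      _ ≤ 2 * ((C : ℝ≥0∞) * ENNReal.ofReal N * ENNReal.ofReal (ε / (6 * (C + 1) * (N + 1)))) := by
          gcongr
      _ = ENNReal.ofReal (2 * (C * N * (ε / (6 * (C + 1) * (N + 1))))) := by
          rw [ENNReal.ofReal_mul (by positivity), ENNReal.ofReal_mul (by positivity),
            ENNReal.ofReal_mul (by positivity), ENNReal.ofReal_coe_nnreal, ENNReal.ofReal_ofNat]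
      _ ≤ _ := by
          refine ENNReal.ofReal_le_ofReal ?_
          have h2 : (C : ℝ) * N ≤ (C + 1) * (N + 1) := by
            have : (0 : ℝ) ≤ C := C.2
            nlinarith
          calc 2 * ((C : ℝ) * N * (ε / (6 * (C + 1) * (N + 1))))
              = ε / 3 * ((C * N) / ((C + 1) * (N + 1))) := by field_simp; ring
            _ ≤ ε / 3 * 1 := by
                gcongr
                exact div_le_one_of_le₀ h2 (by positivity)
            _ = _ := mul_one _
  obtain ⟨M', hM'⟩ := hφ.1.continuous.bounded_above_of_compact_support hφ.2
  have hM'0 : 0 ≤ M' := (norm_nonneg _).trans (hM' 0)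
  obtain ⟨σ, hσ⟩ := hφ.2.isCompact.isBounded.subset_closedBall 0
  have hφσ : ∀ x, max σ 0 < ‖x‖ → φ x = 0 := fun x hx => by
    refine image_eq_zero_of_notMem_tsupport fun h => ?_
    have := hσ h
    rw [mem_closedBall_zero_iff] at this
    exact absurd this (not_le.2 (lt_of_le_of_lt (le_max_left _ _) hx))
  set I : ℝ → E d → ℝ≥0∞ := fun r b => 2 * ∫⁻ x, ‖rescale U r b x‖ₑ * ‖φ x‖ₑ ^ 2 with hI
  have hUe : ∀ x, ‖U x‖ₑ ≤ ENNReal.ofReal M := fun x => by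
    rw [← ofReal_norm]; exact ENNReal.ofReal_le_ofReal (hUM x)
  have hφe : ∀ x, ‖φ x‖ₑ ^ 2 ≤ ENNReal.ofReal (M' ^ 2) := fun x => by
    rw [ENNReal.ofReal_pow hM'0, ← ofReal_norm]
    gcongr
    exact hM' x
  have hre : ∀ (r : ℝ) (b : E d), ∫⁻ x, ‖rescale U r b x‖ₑ * ‖φ x‖ₑ ^ 2
      = ENNReal.ofReal (r ^ 2) * ∫⁻ x, ‖U (r • x + b)‖ₑ * ‖φ x‖ₑ ^ 2 := by
    intro r b
    rw [← lintegral_const_mul' _ _ ENNReal.ofReal_ne_top]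
    refine lintegral_congr fun x => ?_
    rw [rescale, enorm_mul, Real.enorm_of_nonneg (by positivity : (0:ℝ) ≤ r ^ 2), mul_assoc]
  -- small `r`
  set m : ℝ := massSq φ with hm
  have hm0 : 0 ≤ m := massSq_nonneg φ
  have i1 : ∀ (r : ℝ) (b : E d), I r b ≤ ENNReal.ofReal (2 * (r ^ 2 * (M * m))) := by
    intro r b
    simp only [hI]
    rw [hre, ENNReal.ofReal_mul zero_le_two, ENNReal.ofReal_ofNat,
      ENNReal.ofReal_mul (by positivity)]
    gcongr
    calc _ ≤ ∫⁻ x, ENNReal.ofReal M * ‖φ x‖ₑ ^ 2 := by gcongr with x; exact hUe _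
      _ = _ := by
          rw [lintegral_const_mul' _ _ ENNReal.ofReal_ne_top, lintegral_enorm_sq hφH.1,
            ← ENNReal.ofReal_mul hM0]
  -- large `r`
  have hUint : ∫⁻ x, ‖U x‖ₑ ≠ ⊤ := by
    have h3 : ∀ x, ‖U x‖ₑ ≤ Set.indicator (Metric.closedBall 0 ρ) (fun _ => ENNReal.ofReal M) x := by
      intro x
      by_cases hx : ‖x‖ ≤ ρ
      · rw [Set.indicator_of_mem (by simpa using hx)]; exact hUe x
      · rw [hUρ x (not_le.1 hx)]; simp
    refine ne_top_of_le_ne_top ?_ (lintegral_mono h3)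
    rw [lintegral_indicator_const measurableSet_closedBall]
    exact ENNReal.mul_ne_top ENNReal.ofReal_ne_top measure_closedBall_lt_top.ne
  set A : ℝ := (∫⁻ x, ‖U x‖ₑ).toReal with hA
  have hA0 : 0 ≤ A := ENNReal.toReal_nonneg
  have i2 : ∀ (r : ℝ) (b : E d), 0 < r →
      I r b ≤ ENNReal.ofReal (2 * (r ^ 2 * ((r ^ d)⁻¹ * A * M' ^ 2))) := by
    intro r b hr
    simp only [hI]
    rw [hre, ENNReal.ofReal_mul zero_le_two, ENNReal.ofReal_ofNat,
      ENNReal.ofReal_mul (by positivity)]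
    gcongr
    calc _ ≤ ∫⁻ x, ‖U (r • x + b)‖ₑ * ENNReal.ofReal (M' ^ 2) := by gcongr with x; exact hφe _
      _ = _ := by
          rw [lintegral_mul_const' _ _ ENNReal.ofReal_ne_top,
            lintegral_comp_affine (fun x => ‖U x‖ₑ) hr, ENNReal.ofReal_mul (by positivity),
            ENNReal.ofReal_mul (by positivity), hA, ENNReal.ofReal_toReal hUint]
  -- large `b`
  have i3 : ∀ (r : ℝ) (b : E d), 0 < r → ρ + r * max σ 0 < ‖b‖ → I r b = 0 := by
    intro r b hr hb
    simp only [hI]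
    rw [hre]
    have : ∀ x, ‖U (r • x + b)‖ₑ * ‖φ x‖ₑ ^ 2 = 0 := by
      intro x
      by_cases hx : max σ 0 < ‖x‖
      · rw [hφσ x hx]; simp
      · rw [hUρ (r • x + b)]
        · simp
        · have h3 : ‖b‖ ≤ ‖r • x + b‖ + ‖r • x‖ := by
            calc ‖b‖ = ‖(r • x + b) - r • x‖ := by rw [add_sub_cancel_left]
              _ ≤ _ := norm_sub_le _ _
          rw [norm_smul, Real.norm_of_nonneg hr.le] at h3
          have h4 : r * ‖x‖ ≤ r * max σ 0 := by gcongr; exact not_lt.1 hx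
          linarith
    simp [this]
  have hsplit : ∀ (r : ℝ) (b : E d), 0 < r → I r b ≤ ENNReal.ofReal (ε / 3) →
      ∫⁻ x, ‖rescale V r b x‖ₑ * ‖w x‖ₑ ^ 2 ≤ ENNReal.ofReal ε := by
    intro r b hr hIr
    have mU : AEStronglyMeasurable (rescale U r b) volume := (memLp_rescale hU hr b).1
    have mVU : AEStronglyMeasurable (rescale (V - U) r b) volume :=
      (memLp_rescale (hV.sub hU) hr b).1
    have ma : AEMeasurable (fun x => ‖rescale (V - U) r b x‖ₑ * ‖w x‖ₑ ^ 2) volume :=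
      mVU.enorm.mul (hw.1.1.enorm.pow_const 2)
    have mb : AEMeasurable (fun x => ‖rescale U r b x‖ₑ * ‖φ x‖ₑ ^ 2) volume :=
      mU.enorm.mul (hφH.1.1.enorm.pow_const 2)
    have mc : AEMeasurable (fun x => ‖rescale U r b x‖ₑ * ‖(φ - w) x‖ₑ ^ 2) volume :=
      mU.enorm.mul ((hφH.1.1.sub hw.1.1).enorm.pow_const 2)
    calc _ ≤ ∫⁻ x, (‖rescale (V - U) r b x‖ₑ * ‖w x‖ₑ ^ 2 +
          (2 * (‖rescale U r b x‖ₑ * ‖φ x‖ₑ ^ 2) +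
            2 * (‖rescale U r b x‖ₑ * ‖(φ - w) x‖ₑ ^ 2))) := by
          refine lintegral_mono fun x => ?_
          have e1 : ‖rescale V r b x‖ₑ ≤ ‖rescale (V - U) r b x‖ₑ + ‖rescale U r b x‖ₑ := by
            have : rescale V r b x = rescale (V - U) r b x + rescale U r b x := by
              simp only [rescale, Pi.sub_apply]; ring
            rw [this]; exact enorm_add_le _ _
          have e2 : ‖w x‖ₑ ^ 2 ≤ 2 * ‖φ x‖ₑ ^ 2 + 2 * ‖(φ - w) x‖ₑ ^ 2 := by
            have h3 : ‖w x‖ₑ ≤ ‖φ x‖ₑ + ‖(φ - w) x‖ₑ := by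
              have : w x = φ x - (φ - w) x := by simp
              rw [this]; exact enorm_sub_le
            calc _ ≤ (‖φ x‖ₑ + ‖(φ - w) x‖ₑ) ^ 2 := by gcongr
              _ ≤ 2 * (‖φ x‖ₑ ^ 2 + ‖(φ - w) x‖ₑ ^ 2) := by
                  have := ENNReal.rpow_add_le_mul_rpow_add_rpow ‖φ x‖ₑ ‖(φ - w) x‖ₑ one_le_two
                  norm_num at this
                  exact this
              _ = _ := by ring
          calc _ ≤ (‖rescale (V - U) r b x‖ₑ + ‖rescale U r b x‖ₑ) * ‖w x‖ₑ ^ 2 := by gcongr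
            _ = ‖rescale (V - U) r b x‖ₑ * ‖w x‖ₑ ^ 2 + ‖rescale U r b x‖ₑ * ‖w x‖ₑ ^ 2 :=
                add_mul _ _ _
            _ ≤ ‖rescale (V - U) r b x‖ₑ * ‖w x‖ₑ ^ 2 + ‖rescale U r b x‖ₑ *
                (2 * ‖φ x‖ₑ ^ 2 + 2 * ‖(φ - w) x‖ₑ ^ 2) := by gcongr
            _ = _ := by ring
      _ = (∫⁻ x, ‖rescale (V - U) r b x‖ₑ * ‖w x‖ₑ ^ 2) + (I r b +
            2 * ∫⁻ x, ‖rescale U r b x‖ₑ * ‖(φ - w) x‖ₑ ^ 2) := by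
          rw [lintegral_add_left' ma, lintegral_add_left' (mb.const_mul _),
            lintegral_const_mul'' _ mb, lintegral_const_mul'' _ mc]
      _ ≤ ENNReal.ofReal (ε / 3) + (ENNReal.ofReal (ε / 3) + ENNReal.ofReal (ε / 3)) := by
          gcongr
          · exact h1 r b hr
          · exact h2 r b hr
      _ = _ := by
          rw [← ENNReal.ofReal_add (by positivity) (by positivity),
            ← ENNReal.ofReal_add (by positivity) (by positivity)]
          congr 1; ring
  -- the thresholds
  set K₁ : ℝ := 1 + 6 * (M * m + A * M' ^ 2) / ε with hK₁
  have hK₁1 : 1 ≤ K₁ := by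
    have : 0 ≤ 6 * (M * m + A * M' ^ 2) / ε := by positivity
    linarith
  have hK₁0 : 0 < K₁ := by linarith
  have hKε : 6 * (M * m + A * M' ^ 2) ≤ ε * K₁ := by
    have : ε * (6 * (M * m + A * M' ^ 2) / ε) = 6 * (M * m + A * M' ^ 2) :=
      mul_div_cancel₀ _ hε.ne'
    rw [hK₁]; linarith
  refine ⟨max K₁ (ρ + K₁ * max σ 0), le_max_of_le_left hK₁1, fun r b hr h => ?_⟩
  refine hsplit r b hr ?_
  rcases lt_or_ge r K₁⁻¹ with h3 | h3
  · refine (i1 r b).trans (ENNReal.ofReal_le_ofReal ?_)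
    have h4 : r * K₁ < 1 := by rwa [← one_div, lt_div_iff₀ hK₁0] at h3
    have h5 : r ≤ 1 := by nlinarith
    have h6 : 0 ≤ M * m := by positivity
    have h7 : 0 ≤ A * M' ^ 2 := by positivity
    have h8 : 6 * (M * m) * r ≤ ε := by
      calc 6 * (M * m) * r ≤ ε * K₁ * r :=
            mul_le_mul_of_nonneg_right (by linarith) hr.le
        _ = ε * (r * K₁) := by ring
        _ ≤ ε * 1 := by gcongr
        _ = ε := mul_one _
    have h9 : r ^ 2 * (M * m) ≤ r * (M * m) :=
      mul_le_mul_of_nonneg_right (by nlinarith) h6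
    linarith
  · rcases lt_or_ge K₁ r with h4 | h4
    · refine (i2 r b hr).trans (ENNReal.ofReal_le_ofReal ?_)
      have hr1 : 1 ≤ r := by linarith
      have h5 : r ^ 2 * (r ^ d)⁻¹ ≤ r⁻¹ := by
        rw [← div_eq_mul_inv, div_le_iff₀ (by positivity), inv_mul_eq_div, le_div_iff₀ hr,
          ← pow_succ]
        exact pow_le_pow_right₀ hr1 hd
      have h6 : r⁻¹ * (A * M' ^ 2) ≤ ε / 6 := by
        rw [inv_mul_le_iff₀ hr]
        have : 0 ≤ M * m := by positivity
        nlinarith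
      have h7 : 0 ≤ A * M' ^ 2 := by positivity
      calc 2 * (r ^ 2 * ((r ^ d)⁻¹ * A * M' ^ 2)) = 2 * ((r ^ 2 * (r ^ d)⁻¹) * (A * M' ^ 2)) := by
            ring
        _ ≤ 2 * (r⁻¹ * (A * M' ^ 2)) := by gcongr
        _ ≤ _ := by linarith
    · rw [i3 r b hr]
      · exact zero_le
      · have h5 : max K₁ (ρ + K₁ * max σ 0) < ‖b‖ := by
          rcases h with h | h | h
          · exfalso
            have : (max K₁ (ρ + K₁ * max σ 0))⁻¹ ≤ K₁⁻¹ := by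
              gcongr; exact le_max_left _ _
            linarith
          · exfalso
            linarith [le_max_left K₁ (ρ + K₁ * max σ 0)]
          · exact h
        have h6 : r * max σ 0 ≤ K₁ * max σ 0 := by
          gcongr
        linarith [le_max_right K₁ (ρ + K₁ * max σ 0)]

/-! ### Coercivity and the sign of the potential energy -/

lemma enorm_integral_pot_le (V : E d → ℝ) (u : E d → ℂ) :
    ‖∫ x, V x * ‖u x‖ ^ 2‖ₑ ≤ ∫⁻ x, ‖V x‖ₑ * ‖u x‖ₑ ^ 2 := by
  refine (enorm_integral_le_lintegral_enorm _).trans (le_of_eq ?_)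
  refine lintegral_congr fun x => ?_
  rw [enorm_mul]; simp

lemma energySq_rescale (V : E d → ℝ) {u : E d → ℂ} (hu : MemH1 u) {r : ℝ} (hr : 0 < r) (b : E d) :
    energySq (rescale V r b) (fun x => u (r • x + b)) = (r ^ d)⁻¹ * (r ^ 2 * energySq V u) := by
  have h := integral_comp_affine (fun x => V x * ‖u x‖ ^ 2) hr b
  rw [smul_eq_mul] at h
  rw [energySq, energySq, gradSq_comp_affine hu hr]
  simp only [rescale, mul_assoc]
  rw [integral_const_mul, h]
  ring

lemma MemH1.exists_comp_affine_eq {v : E d → ℂ} (hv : MemH1 v) {r : ℝ} (hr : 0 < r) (b : E d) :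
    ∃ u : E d → ℂ, MemH1 u ∧ v = fun x => u (r • x + b) := by
  refine ⟨fun x => v (r⁻¹ • x + -(r⁻¹ • b)), hv.comp_affine (inv_pos.2 hr) _, ?_⟩
  ext x
  have : r⁻¹ • (r • x + b) + -(r⁻¹ • b) = x := by
    rw [smul_add, smul_smul, inv_mul_cancel₀ hr.ne', one_smul]; abel
  simp only [this]

lemma memLp_negPart {p : ℝ≥0∞} {V : E d → ℝ} (hV : MemLp V p volume) :
    MemLp (negPart V) p volume := by
  refine hV.mono ?_ (ae_of_all _ fun x => ?_)
  · exact (continuous_id.min continuous_const).comp_aestronglyMeasurable hV.1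
  · simp only [negPart, Real.norm_eq_abs]
    rcases le_total (V x) 0 with h | h
    · rw [min_eq_left h]
    · rw [min_eq_right h]; simp

/-- Coercivity of the energy: by the Kato bound, the negative part of `V` consumes only a fixed
fraction of the kinetic energy. -/
lemma IsAdmissible.exists_coercive (hd : 3 ≤ d) {V : E d → ℝ} (hV : IsAdmissible V) :
    ∃ c : ℝ, 0 < c ∧ ∀ u : E d → ℂ, MemH1 u → c * gradSq u ≤ energySq V u := by
  have hN := newtonConst_pos hd
  have hfin : katoNorm (negPart V) ≠ ⊤ := hV.2.2.ne_top
  set κ := newtonConst d * (katoNorm (negPart V)).toReal with hκ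
  have hκ1 : κ < 1 := by
    have := ENNReal.toReal_lt_of_lt_ofReal hV.2.2
    rw [lt_div_iff₀ hN] at this
    rw [hκ]; linarith
  refine ⟨1 - κ, by linarith, fun u hu => ?_⟩
  have hn := memLp_negPart hV.2.1
  have h1 := (enorm_integral_pot_le (negPart V) u).trans
    (lintegral_mul_sq_le_katoNorm hd hn.1.aemeasurable hfin hu)
  rw [← hκ, ← ofReal_norm, ENNReal.ofReal_le_ofReal_iff
    (mul_nonneg (by positivity) (gradSq_nonneg u)), Real.norm_eq_abs] at h1
  have h2 : ∫ x, negPart V x * ‖u x‖ ^ 2 ≤ ∫ x, V x * ‖u x‖ ^ 2 := by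
    refine integral_mono (MemLp.integrable_pot_sq hd hn hu)
      (MemLp.integrable_pot_sq hd hV.2.1 hu) fun x => ?_
    exact mul_le_mul_of_nonneg_right (min_le_left _ _) (by positivity)
  have h3 := (abs_le.1 h1).1
  rw [energySq]
  linarith

/-- The potential energy of translates escaping to infinity tends to zero. -/
lemma tendsto_integral_pot_translate (hd : 3 ≤ d) {V : E d → ℝ}
    (hV : MemLp V ((d : ℝ≥0∞) / 2) volume) {Q : E d → ℂ} (hQ : MemH1 Q) {z : ℕ → E d}
    (hz : Tendsto (fun n => ‖z n‖) atTop atTop) :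
    Tendsto (fun n => ∫ x, V x * ‖Q (x - z n)‖ ^ 2) atTop (𝓝 0) := by
  rw [tendsto_zero_iff_enorm_tendsto_zero]
  refine tendsto_zero_of_eventually_le_ofReal fun η hη => ?_
  obtain ⟨K, -, hK⟩ := exists_rescale_small hd hV hQ hη
  filter_upwards [hz.eventually_gt_atTop K] with n hn
  have h1 := hK 1 (z n) one_pos (Or.inr (Or.inr hn))
  have h2 := integral_comp_affine (fun x => V x * ‖Q (x - z n)‖ ^ 2) one_pos (z n)
  simp only [one_smul, add_sub_cancel_right, one_pow, inv_one] at h2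
  have h3 := enorm_integral_pot_le (rescale V 1 (z n)) Q
  simp only [rescale, one_pow, one_mul, one_smul] at h1 h3
  rw [h2] at h3
  exact h3.trans h1

/-- A bounded compactly supported weight sees a uniformly bounded amount of any translate of an
`L^p` function. -/
lemma exists_lintegral_translate_le {V χ : E d → ℝ} {p : ℝ≥0∞} (hp : 1 ≤ p) (hp' : p ≠ ⊤)
    (hV : MemLp V p volume) (hχ : Continuous χ) (hχc : HasCompactSupport χ) :
    ∃ B : ℝ≥0∞, B ≠ ⊤ ∧ ∀ s : E d, ∫⁻ z, ‖χ z‖ₑ * ‖V (z + s)‖ₑ ≤ B := by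
  obtain ⟨M, hM⟩ := hχ.bounded_above_of_compact_support hχc
  have hint : Integrable χ := hχ.integrable_of_hasCompactSupport hχc
  have hp0 : p ≠ 0 := (lt_of_lt_of_le one_pos hp).ne'
  have hfin := lintegral_rpow_enorm_lt_top_of_eLpNorm_lt_top hp0 hp' hV.2
  have hp1 : 1 ≤ p.toReal := by
    rw [← ENNReal.toReal_one]; exact ENNReal.toReal_mono hp' hp
  refine ⟨(∫⁻ z, ‖χ z‖ₑ) + ENNReal.ofReal M * ∫⁻ z, ‖V z‖ₑ ^ p.toReal,
    ENNReal.add_ne_top.2 ⟨hint.hasFiniteIntegral.ne, by finiteness⟩, fun s => ?_⟩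
  calc _ ≤ ∫⁻ z, (‖χ z‖ₑ + ENNReal.ofReal M * ‖V (z + s)‖ₑ ^ p.toReal) := by
        refine lintegral_mono fun z => ?_
        have h1 : ‖V (z + s)‖ₑ ≤ 1 + ‖V (z + s)‖ₑ ^ p.toReal := by
          rcases le_total ‖V (z + s)‖ₑ 1 with h | h
          · exact h.trans le_self_add
          · refine le_trans ?_ le_add_self
            calc _ = ‖V (z + s)‖ₑ ^ (1 : ℝ) := (ENNReal.rpow_one _).symm
              _ ≤ _ := ENNReal.rpow_le_rpow_of_exponent_le h hp1
        have h2 : ‖χ z‖ₑ ≤ ENNReal.ofReal M := by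
          rw [← ofReal_norm]; exact ENNReal.ofReal_le_ofReal (hM z)
        calc _ ≤ ‖χ z‖ₑ * (1 + ‖V (z + s)‖ₑ ^ p.toReal) := by gcongr
          _ = ‖χ z‖ₑ + ‖χ z‖ₑ * ‖V (z + s)‖ₑ ^ p.toReal := by rw [mul_add, mul_one]
          _ ≤ _ := by gcongr
    _ = _ := by
        rw [lintegral_add_left hχ.measurable.enorm, lintegral_const_mul' _ _ ENNReal.ofReal_ne_top,
          lintegral_add_right_eq_self (fun z => ‖V z‖ₑ ^ p.toReal) s]

/-- If all rescaled and translated copies of `|Q|²` give `V` nonnegative mean, then `V` has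
nonnegative mean against every nonnegative continuous compactly supported weight. -/
lemma integral_mul_nonneg_of_forall_affine {V χ : E d → ℝ} {p : ℝ≥0∞} (hp : 1 ≤ p) (hp' : p ≠ ⊤)
    (hV : MemLp V p volume) (hVm : Measurable V) (hχ : Continuous χ) (hχc : HasCompactSupport χ)
    (hχ0 : ∀ x, 0 ≤ χ x) {Q : E d → ℂ} (hQ : NonzeroH1 Q)
    (h : ∀ (t : ℝ) (z : E d), 0 < t → 0 ≤ ∫ y, V (t • y + z) * ‖Q y‖ ^ 2) :
    0 ≤ ∫ x, χ x * V x := by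
  obtain ⟨B, hB, hBle⟩ := exists_lintegral_translate_le hp hp' hV hχ hχc
  set H : E d → ℝ := fun s => ∫ z, χ z * V (z + s) with hH
  have hHcont : Continuous H := by
    have h1 : Continuous (convolution V (fun x => χ (-x)) (ContinuousLinearMap.mul ℝ ℝ) volume) :=
      HasCompactSupport.continuous_convolution_right _
        (hχc.comp_homeomorph (Homeomorph.neg _)) (hV.locallyIntegrable hp) (by fun_prop)
    refine h1.congr fun s => ?_
    rw [convolution_def, hH]
    simp only [ContinuousLinearMap.mul_apply']
    rw [← integral_add_right_eq_self _ s]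
    refine integral_congr_ae (ae_of_all _ fun z => ?_)
    simp only [sub_add_cancel_right, neg_neg]; ring
  have hHB : ∀ s, ‖H s‖ ≤ B.toReal := fun s => by
    have h1 : ‖H s‖ₑ ≤ B := by
      refine (enorm_integral_le_lintegral_enorm _).trans (le_trans (le_of_eq ?_) (hBle s))
      simp only [enorm_mul]
    rw [← ENNReal.ofReal_le_iff_le_toReal hB, ofReal_norm]
    exact h1
  have hQint := integrable_sq_of_memLp hQ.1.1
  -- averaging the hypothesis over the centres against `χ`
  have key : ∀ t : ℝ, 0 < t → 0 ≤ ∫ y, H (t • y) * ‖Q y‖ ^ 2 := by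
    intro t ht
    have hint : Integrable (fun q : E d × E d => χ q.1 * V (q.1 + t • q.2) * ‖Q q.2‖ ^ 2)
        (volume.prod volume) := by
      have hmV : Measurable fun q : E d × E d => χ q.1 * V (q.1 + t • q.2) := by
        have := hχ.measurable
        fun_prop
      have hmQ : AEStronglyMeasurable (fun q : E d × E d => ‖Q q.2‖ ^ 2) (volume.prod volume) :=
        hQint.1.comp_snd
      refine ⟨hmV.aestronglyMeasurable.mul hmQ, ?_⟩
      rw [hasFiniteIntegral_iff_enorm]
      have e : AEMeasurable (fun q : E d × E d => ‖χ q.1 * V (q.1 + t • q.2) * ‖Q q.2‖ ^ 2‖ₑ)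
        (volume.prod volume) := (hmV.aestronglyMeasurable.mul hmQ).enorm
      rw [lintegral_prod_symm _ e]
      calc _ ≤ ∫⁻ y, B * ‖Q y‖ₑ ^ 2 := by
            refine lintegral_mono fun y => ?_
            simp only [enorm_mul]
            rw [lintegral_mul_const' _ _ enorm_ne_top]
            refine mul_le_mul (hBle (t • y)) (le_of_eq (by simp)) zero_le zero_le
        _ = B * ENNReal.ofReal (massSq Q) := by
            rw [lintegral_const_mul' _ _ hB, lintegral_enorm_sq hQ.1.1]
        _ < ⊤ := by finiteness
    have e1 := integral_integral_swap (f := fun z y => χ z * V (z + t • y) * ‖Q y‖ ^ 2) hint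
    have e2 : ∫ y, H (t • y) * ‖Q y‖ ^ 2 = ∫ z, ∫ y, χ z * V (z + t • y) * ‖Q y‖ ^ 2 := by
      rw [e1]
      refine integral_congr_ae (ae_of_all _ fun y => ?_)
      simp only [hH]
      rw [← integral_mul_const]
    rw [e2]
    refine integral_nonneg fun z => ?_
    have e3 : ∫ y, χ z * V (z + t • y) * ‖Q y‖ ^ 2 = χ z * ∫ y, V (t • y + z) * ‖Q y‖ ^ 2 := by
      rw [← integral_const_mul]
      refine integral_congr_ae (ae_of_all _ fun y => ?_)
      simp only [add_comm z, mul_assoc]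
    simp only [e3]
    exact mul_nonneg (hχ0 z) (h t z ht)
  have hlim : Tendsto (fun n : ℕ => ∫ y, H (((n : ℝ) + 1)⁻¹ • y) * ‖Q y‖ ^ 2) atTop
      (𝓝 (∫ y, H 0 * ‖Q y‖ ^ 2)) := by
    refine tendsto_integral_of_dominated_convergence (fun y => B.toReal * ‖Q y‖ ^ 2)
      (fun n => ?_) (hQint.const_mul _) (fun n => ae_of_all _ fun y => ?_)
      (ae_of_all _ fun y => ?_)
    · exact (hHcont.comp (by fun_prop)).aestronglyMeasurable.mul hQint.1
    · rw [norm_mul, Real.norm_of_nonneg (by positivity : 0 ≤ ‖Q y‖ ^ 2)]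
      gcongr
      exact hHB _
    · have h1 : Tendsto (fun n : ℕ => ((n : ℝ) + 1)⁻¹ • y) atTop (𝓝 0) := by
        have := (tendsto_one_div_add_atTop_nhds_zero_nat (𝕜 := ℝ)).smul_const y
        simpa using this
      exact ((hHcont.tendsto 0).comp h1).mul_const _
  have h1 := ge_of_tendsto' hlim fun n => key _ (by positivity)
  rw [integral_const_mul] at h1
  have h2 : 0 < ∫ y, ‖Q y‖ ^ 2 := massSq_pos hQ
  have h3 : 0 ≤ H 0 := by
    by_contra! h4
    exact absurd h1 (not_le.2 (mul_neg_of_neg_of_pos h4 h2))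
  simpa [hH] using h3

/-- Otherwise `V` would have nonnegative mean over every compact subset of `{V < 0}`, as seen by
testing against shrinking neighbourhoods of the subset. -/
lemma exists_integral_pot_neg_of_measurable {V : E d → ℝ} {p : ℝ≥0∞} (hp : 1 ≤ p) (hp' : p ≠ ⊤)
    (hV : MemLp V p volume) (hVm : Measurable V)
    (hneg : ¬ negPart V =ᵐ[volume] 0) {Q : E d → ℂ} (hQ : NonzeroH1 Q) :
    ∃ (t : ℝ) (z : E d), 0 < t ∧ ∫ y, V (t • y + z) * ‖Q y‖ ^ 2 < 0 := by
  by_contra! hcon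
  have hA : MeasurableSet {x | V x < 0} := measurableSet_lt hVm measurable_const
  have hpos : 0 < volume {x | V x < 0} := by
    rw [pos_iff_ne_zero]
    intro h0
    refine hneg ?_
    have : ∀ᵐ x, ¬ V x < 0 := by rw [ae_iff]; simpa using h0
    filter_upwards [this] with x hx
    simp [negPart, not_lt.1 hx]
  obtain ⟨K, hKA, hK, hK0⟩ := hA.exists_lt_isCompact hpos
  have hδ : ∀ n : ℕ, (0 : ℝ) < 1 / ((n : ℝ) + 1) := fun n => by positivity
  set χ : ℕ → E d → ℝ := fun n x => (thickenedIndicator (hδ n) K x : ℝ) with hχ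
  have hzero : ∀ n x, x ∉ Metric.cthickening 1 K → χ n x = 0 := by
    intro n x hx
    simp only [hχ]
    rw [thickenedIndicator_zero]
    · simp
    · intro h1
      refine hx (Metric.thickening_subset_cthickening 1 K (Metric.thickening_mono ?_ K h1))
      rw [div_le_one (by positivity)]
      linarith [Nat.cast_nonneg (α := ℝ) n]
  have hKc : IsCompact (Metric.cthickening 1 K) := hK.cthickening
  have h1 : ∀ n, 0 ≤ ∫ x, χ n x * V x := fun n => by
    refine integral_mul_nonneg_of_forall_affine hp hp' hV hVm ?_ ?_ (fun x => NNReal.coe_nonneg _)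
      hQ hcon
    · exact NNReal.continuous_coe.comp (thickenedIndicator (hδ n) K).continuous
    · exact HasCompactSupport.intro hKc (hzero n)
  have hloc := hV.locallyIntegrable hp
  have hlim : Tendsto (fun n => ∫ x, χ n x * V x) atTop
      (𝓝 (∫ x, Set.indicator K V x)) := by
    refine tendsto_integral_of_dominated_convergence
      (fun x => Set.indicator (Metric.cthickening 1 K) (fun x => ‖V x‖) x) (fun n => ?_) ?_
      (fun n => ae_of_all _ fun x => ?_) (ae_of_all _ fun x => ?_)
    · exact ((NNReal.continuous_coe.comp (thickenedIndicator (hδ n) K).continuous).measurable.mul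
        hVm).aestronglyMeasurable
    · exact (integrable_indicator_iff hKc.measurableSet).2 (hloc.integrableOn_isCompact hKc).norm
    · by_cases hx : x ∈ Metric.cthickening 1 K
      · rw [Set.indicator_of_mem hx, norm_mul]
        refine mul_le_of_le_one_left (norm_nonneg _) ?_
        rw [Real.norm_of_nonneg (NNReal.coe_nonneg _)]
        exact_mod_cast thickenedIndicator_le_one (hδ n) K x
      · rw [hzero n x hx, Set.indicator_of_notMem hx]; simp
    · have h2 := tendsto_pi_nhds.1 (thickenedIndicator_tendsto_indicator_closure hδ
        tendsto_one_div_add_atTop_nhds_zero_nat K) x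
      have h3 := ((NNReal.continuous_coe.tendsto _).comp h2).mul_const (V x)
      rw [hK.isClosed.closure_eq] at h3
      have e : ((Set.indicator K (fun _ => (1 : NNReal)) x : NNReal) : ℝ) * V x
          = Set.indicator K V x := by
        by_cases hx : x ∈ K <;> simp [hx]
      rw [e] at h3
      exact h3
  have h2 := ge_of_tendsto' hlim h1
  rw [integral_indicator hK.measurableSet] at h2
  have h3 : 0 < ∫ x in K, -V x := by
    have hi : IntegrableOn (fun x => -V x) K := (hloc.integrableOn_isCompact hK).neg
    rw [setIntegral_pos_iff_support_of_nonneg_ae _ hi]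
    · have : Function.support (fun x => -V x) ∩ K = K := by
        refine Set.inter_eq_right.2 fun x hx => ?_
        have : V x < 0 := hKA hx
        simp [this.ne]
      rw [this]; exact hK0
    · refine (ae_restrict_iff' hK.measurableSet).2 (ae_of_all _ fun x hx => ?_)
      have : V x < 0 := hKA hx
      simp only [Pi.zero_apply]; linarith
  rw [integral_neg] at h3
  linarith

/-- If `V` is negative on a set of positive measure, some dilated and translated copy of `Q` has
negative potential energy. -/
lemma exists_integral_pot_neg (hd : 3 ≤ d) {V : E d → ℝ}
    (hV : MemLp V ((d : ℝ≥0∞) / 2) volume) (hneg : ¬ negPart V =ᵐ[volume] 0) {Q : E d → ℂ}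
    (hQ : NonzeroH1 Q) : ∃ (r : ℝ) (b : E d), 0 < r ∧ ∫ x, V x * ‖Q (r • x + b)‖ ^ 2 < 0 := by
  have hp : (1 : ℝ≥0∞) ≤ (d : ℝ≥0∞) / 2 := by
    rw [ENNReal.le_div_iff_mul_le (by simp) (by simp), one_mul]
    exact_mod_cast (by omega : 2 ≤ d)
  have hp' : (d : ℝ≥0∞) / 2 ≠ ⊤ := ENNReal.div_ne_top (by simp) (by simp)
  set U := hV.1.mk V with hU
  have hVU : V =ᵐ[volume] U := hV.1.ae_eq_mk
  have hnegU : ¬ negPart U =ᵐ[volume] 0 := fun h0 => hneg (by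
    filter_upwards [h0, hVU] with x h1 h2
    rw [← h1, negPart, negPart, h2])
  obtain ⟨t, z, ht, h⟩ := exists_integral_pot_neg_of_measurable hp hp' (hV.ae_eq hVU)
    hV.1.stronglyMeasurable_mk.measurable hnegU hQ
  have hti : 0 < t⁻¹ := inv_pos.2 ht
  refine ⟨t⁻¹, -(t⁻¹ • z), hti, ?_⟩
  have e1 : ∫ x, V x * ‖Q (t⁻¹ • x + -(t⁻¹ • z))‖ ^ 2 = ∫ x, U x * ‖Q (t⁻¹ • x + -(t⁻¹ • z))‖ ^ 2 :=
    integral_congr_ae (hVU.mono fun x hx => by simp only [hx])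
  have e2 := integral_comp_affine (fun x => U x * ‖Q (t⁻¹ • x + -(t⁻¹ • z))‖ ^ 2) ht z
  have e3 : ∀ y, t⁻¹ • (t • y + z) + -(t⁻¹ • z) = y := fun y => by
    rw [smul_add, smul_smul, inv_mul_cancel₀ ht.ne', one_smul]; abel
  simp only [e3, smul_eq_mul] at e2
  rw [e2] at h
  rw [e1]
  have h4 : 0 < (t ^ d)⁻¹ := by positivity
  by_contra! h5
  exact absurd h (not_lt.2 (mul_nonneg h4.le h5))

/-! ### Nonnegative potentials -/

lemma W_le_iff {γ S : ℝ} {V : E d → ℝ} {u : E d → ℂ} (hE : 0 < energySq V u)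
    (hu : NonzeroH1 u) :
    W γ V u ≤ S ↔ P γ u ≤ S * weight γ (energySq V u) (massSq u) := by
  rw [W_eq, div_le_iff₀ (weight_pos γ hE (massSq_pos hu))]

/-- For a nonnegative potential the energy dominates the kinetic energy. No integrability is needed:
a nonintegrable `V |u|²` contributes the value `0`. -/
lemma gradSq_le_energySq {V : E d → ℝ} (hV : negPart V =ᵐ[volume] 0) (u : E d → ℂ) :
    gradSq u ≤ energySq V u := by
  have : 0 ≤ ∫ x, V x * ‖u x‖ ^ 2 := by
    refine integral_nonneg_of_ae ?_
    filter_upwards [hV] with x hx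
    have : 0 ≤ V x := by
      have : min (V x) 0 = 0 := hx
      exact min_eq_right_iff.1 this
    simp only [Pi.zero_apply]; positivity
  rw [energySq]; linarith

/-- Translates that escape to infinity do not feel the potential, so a free ground state
exhausts the supremum of `W` along them. -/
lemma isMaximizingSeq_translate {γ S : ℝ} (hγ : IsExponent d γ) {V : E d → ℝ}
    (hV : MemLp V ((d : ℝ≥0∞) / 2) volume) (hneg : negPart V =ᵐ[volume] 0) (hS : 0 ≤ S)
    (hle : ∀ u : E d → ℂ, MemH1 u → P γ u ≤ S * weight γ (gradSq u) (massSq u)) {Q : E d → ℂ}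
    (hQ : NonzeroH1 Q) (hP : P γ Q = S * weight γ (gradSq Q) (massSq Q)) {z : ℕ → E d}
    (hz : Tendsto (fun n => ‖z n‖) atTop atTop) :
    IsMaximizingSeq γ V (fun n x => Q (x - z n)) := by
  have hg := gradSq_pos hγ.dim hQ
  have hm := massSq_pos hQ
  have htr : ∀ n, (fun x => Q (x - z n)) = fun x => Q ((1 : ℝ) • x + -z n) := fun n => by
    simp only [one_smul, sub_eq_add_neg]
  have hn : ∀ n, NonzeroH1 (fun x => Q (x - z n)) := fun n => by
    rw [htr]; exact hQ.comp_affine one_pos _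
  have hgn : ∀ n, gradSq (fun x => Q (x - z n)) = gradSq Q := fun n => by
    rw [htr, gradSq_comp_affine hQ.1 one_pos]; simp
  have hmn : ∀ n, massSq (fun x => Q (x - z n)) = massSq Q := fun n => by
    rw [htr, massSq_comp_affine _ one_pos]; simp
  have hPn : ∀ n, P γ (fun x => Q (x - z n)) = P γ Q := fun n => by
    rw [htr, P_comp_affine _ _ one_pos]; simp
  have hup : S ∈ upperBounds (W γ V '' {v : E d → ℂ | NonzeroH1 v}) := by
    rintro _ ⟨v, hv, rfl⟩
    have hle' := gradSq_le_energySq hneg v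
    rw [W_le_iff ((gradSq_pos hγ.dim hv).trans_le hle') hv]
    exact (hle v hv.1).trans (mul_le_mul_of_nonneg_left (weight_le_weight hγ.pos.le hle') hS)
  have hlim : Tendsto (fun n => W γ V (fun x => Q (x - z n))) atTop (𝓝 S) := by
    have h1 : Tendsto (fun n => energySq V (fun x => Q (x - z n))) atTop (𝓝 (gradSq Q)) := by
      have := (tendsto_integral_pot_translate hγ.dim hV hQ.1 hz).const_add (gradSq Q)
      rw [add_zero] at this
      exact this.congr fun n => by rw [energySq, hgn]
    have h2 := ((continuous_weight_left hγ.pos.le (massSq Q)).tendsto _).comp h1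
    have hw := weight_pos γ hg hm
    have h3 := (tendsto_const_nhds (x := P γ Q)).div h2 hw.ne'
    rw [hP, mul_div_cancel_right₀ _ hw.ne'] at h3
    refine h3.congr fun n => ?_
    rw [W_eq, hPn, hmn, hP]; rfl
  refine ⟨hn, S, ⟨hup, fun c hc => le_of_tendsto' hlim fun n => hc ⟨_, hn n, rfl⟩⟩, hlim⟩

/-! ### Splitting of the potential energy -/

lemma abs_norm_sq_sub_sub_le (a w : ℂ) :
    |‖a‖ ^ 2 - ‖a - w‖ ^ 2 - ‖w‖ ^ 2| ≤ 2 * (‖w‖ * ‖a - w‖) := by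
  have h := norm_add_ofReal_mul_sq (a - w) w 1
  rw [Complex.ofReal_one, one_mul, sub_add_cancel] at h
  have h2 := Complex.abs_re_le_norm ((a - w) * conj w)
  rw [norm_mul, Complex.norm_conj] at h2
  rw [h, abs_le]
  have := abs_le.1 h2
  constructor <;> nlinarith

/-- The potential energy splits as soon as the cross term vanishes. -/
lemma tendsto_integral_pot_sub (hd : 3 ≤ d) {V : ℕ → E d → ℝ}
    (hV : ∀ n, MemLp (V n) ((d : ℝ≥0∞) / 2) volume) {u : ℕ → E d → ℂ} {w : E d → ℂ}
    (hu : ∀ n, MemH1 (u n)) (hw : MemH1 w)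
    (h : Tendsto (fun n => ∫⁻ x, ‖V n x‖ₑ * (‖w x‖ₑ * ‖(u n - w) x‖ₑ)) atTop (𝓝 0)) :
    Tendsto (fun n => (∫ x, V n x * ‖u n x‖ ^ 2) - (∫ x, V n x * ‖(u n - w) x‖ ^ 2)
      - ∫ x, V n x * ‖w x‖ ^ 2) atTop (𝓝 0) := by
  rw [tendsto_zero_iff_enorm_tendsto_zero]
  have h2 : Tendsto (fun n => 2 * ∫⁻ x, ‖V n x‖ₑ * (‖w x‖ₑ * ‖(u n - w) x‖ₑ)) atTop (𝓝 0) := by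
    have := ENNReal.Tendsto.const_mul h (a := 2) (Or.inr (by simp))
    rwa [mul_zero] at this
  refine tendsto_of_tendsto_of_tendsto_of_le_of_le tendsto_const_nhds h2 (fun _ => zero_le)
    fun n => ?_
  have i1 := MemLp.integrable_pot_sq hd (hV n) (hu n)
  have i2 := MemLp.integrable_pot_sq hd (hV n) ((hu n).sub hw)
  have i3 := MemLp.integrable_pot_sq hd (hV n) hw
  have e : (∫ x, V n x * ‖u n x‖ ^ 2) - (∫ x, V n x * ‖(u n - w) x‖ ^ 2)
      - ∫ x, V n x * ‖w x‖ ^ 2 =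
      ∫ x, (V n x * ‖u n x‖ ^ 2 - V n x * ‖(u n - w) x‖ ^ 2 - V n x * ‖w x‖ ^ 2) := by
    rw [← integral_sub i1 i2]
    exact (integral_sub (i1.sub i2) i3).symm
  simp only [e]
  refine (enorm_integral_le_lintegral_enorm _).trans ?_
  rw [← lintegral_const_mul' _ _ (by simp)]
  refine lintegral_mono fun x => ?_
  rw [← mul_sub, ← mul_sub, enorm_mul, mul_left_comm]
  refine mul_le_mul_right ?_ _
  have := abs_norm_sq_sub_sub_le (u n x) (w x)
  rw [← Real.norm_eq_abs] at this
  have h3 := ENNReal.ofReal_le_ofReal this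
  rw [ofReal_norm, ENNReal.ofReal_mul (by norm_num), ENNReal.ofReal_mul (norm_nonneg _),
    ofReal_norm, ofReal_norm] at h3
  simpa using h3

/-- The cross term vanishes when the potentials stop acting on the profile. -/
lemma tendsto_cross_of_escape {V : ℕ → E d → ℝ} {v : ℕ → E d → ℂ} {w : E d → ℂ}
    (hV : ∀ n, AEStronglyMeasurable (V n) volume)
    (hw : AEStronglyMeasurable w volume) {B : ℝ}
    (hB : ∀ n, ∫⁻ x, ‖V n x‖ₑ * ‖v n x‖ₑ ^ 2 ≤ ENNReal.ofReal B)
    (h : Tendsto (fun n => ∫⁻ x, ‖V n x‖ₑ * ‖w x‖ₑ ^ 2) atTop (𝓝 0)) :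
    Tendsto (fun n => ∫⁻ x, ‖V n x‖ₑ * (‖w x‖ₑ * ‖v n x‖ₑ)) atTop (𝓝 0) := by
  refine tendsto_zero_of_eventually_le_ofReal fun η hη => ?_
  set t : ℝ := 2 * (|B| + 1) / η with ht
  have ht0 : 0 < t := by positivity
  have hpos : 0 < η / 2 / t := by positivity
  filter_upwards [h.eventually_le_const (ENNReal.ofReal_pos.2 hpos)] with n hn
  calc ∫⁻ x, ‖V n x‖ₑ * (‖w x‖ₑ * ‖v n x‖ₑ)
      ≤ ∫⁻ x, (ENNReal.ofReal t * (‖V n x‖ₑ * ‖w x‖ₑ ^ 2)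
        + ENNReal.ofReal t⁻¹ * (‖V n x‖ₑ * ‖v n x‖ₑ ^ 2)) := lintegral_mono fun x => by
        refine (mul_le_mul_right (enorm_mul_enorm_le _ _ ht0) _).trans (le_of_eq ?_)
        ring
    _ = ENNReal.ofReal t * (∫⁻ x, ‖V n x‖ₑ * ‖w x‖ₑ ^ 2)
        + ENNReal.ofReal t⁻¹ * ∫⁻ x, ‖V n x‖ₑ * ‖v n x‖ₑ ^ 2 := by
        have m1 : AEMeasurable (fun x => ENNReal.ofReal t * (‖V n x‖ₑ * ‖w x‖ₑ ^ 2)) volume :=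
          ((hV n).enorm.mul (hw.enorm.pow_const 2)).const_mul _
        rw [lintegral_add_left' m1, lintegral_const_mul' _ _ ENNReal.ofReal_ne_top,
          lintegral_const_mul' _ _ ENNReal.ofReal_ne_top]
    _ ≤ ENNReal.ofReal t * ENNReal.ofReal (η / 2 / t)
        + ENNReal.ofReal t⁻¹ * ENNReal.ofReal |B| := by
        gcongr
        exact (hB n).trans (ENNReal.ofReal_le_ofReal (le_abs_self B))
    _ ≤ ENNReal.ofReal η := by
        rw [← ENNReal.ofReal_mul ht0.le, ← ENNReal.ofReal_mul (by positivity),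
          ← ENNReal.ofReal_add (by positivity) (by positivity)]
        refine ENNReal.ofReal_le_ofReal ?_
        rw [mul_div_cancel₀ _ ht0.ne', ht, inv_div, div_mul_eq_mul_div]
        have : η * |B| / (2 * (|B| + 1)) ≤ η / 2 := by
          rw [div_le_div_iff₀ (by positivity) (by norm_num)]
          nlinarith [abs_nonneg B]
        linarith

/-- For a fixed potential the cross term vanishes when the remainders vanish locally. -/
lemma tendsto_cross_of_local (hd : 3 ≤ d) {V : E d → ℝ}
    (hV : MemLp V ((d : ℝ≥0∞) / 2) volume) {v : ℕ → E d → ℂ} {w : E d → ℂ}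
    (hv : ∀ n, MemH1 (v n)) (hw : MemH1 w) {C : ℝ} (hm : ∀ n, massSq (v n) ≤ C)
    (hg : ∀ n, gradSq (v n) ≤ C)
    (hl : ∀ R : ℝ, Tendsto (fun n => ∫⁻ x in Metric.ball 0 R, ‖v n x‖ₑ ^ 2) atTop (𝓝 0)) :
    Tendsto (fun n => ∫⁻ x, ‖V x‖ₑ * (‖w x‖ₑ * ‖v n x‖ₑ)) atTop (𝓝 0) := by
  obtain ⟨K, hK⟩ := exists_hoelder_sobolev hd
  refine tendsto_zero_of_eventually_le_ofReal fun η hη => ?_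
  have hC : 0 ≤ C := (massSq_nonneg _).trans (hm 0)
  have hgw := gradSq_nonneg w
  set D : ℝ := K * (gradSq w + C) + 1 with hD
  have hD0 : 0 < D := by positivity
  obtain ⟨U, M, ρ, hM, -, hU, hUm, hUM, -, hUε⟩ := exists_bounded_approx hV
    (ε := η / 2 / D) (by positivity)
  have hVU : AEStronglyMeasurable (V - U) volume := hV.1.sub hU.1
  have h0 := tendsto_lintegral_mul_of_local (fun n => (hv n).1) hw.1 hm hl
  have h1 : Tendsto (fun n => ENNReal.ofReal M * ∫⁻ x, ‖w x‖ₑ * ‖v n x‖ₑ) atTop (𝓝 0) := by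
    have := ENNReal.Tendsto.const_mul h0 (a := ENNReal.ofReal M) (Or.inr ENNReal.ofReal_ne_top)
    rwa [mul_zero] at this
  filter_upwards [h1.eventually_le_const (ENNReal.ofReal_pos.2 (half_pos hη))] with n hn
  have mw := hw.1.1.enorm
  have mv := (hv n).1.1.enorm
  have mU := hVU.enorm
  have hfar : ∀ u : E d → ℂ, MemH1 u → ∫⁻ x, ‖(V - U) x‖ₑ * ‖u x‖ₑ ^ 2 ≤
      ENNReal.ofReal (K * (η / 2 / D) * gradSq u) := fun u hu => by
    refine (hK _ u hVU.aemeasurable hu).trans ?_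
    rw [ENNReal.ofReal_mul (by positivity), ENNReal.ofReal_mul (by positivity),
      ENNReal.ofReal_coe_nnreal]
    gcongr
  calc ∫⁻ x, ‖V x‖ₑ * (‖w x‖ₑ * ‖v n x‖ₑ)
      ≤ ∫⁻ x, (ENNReal.ofReal M * (‖w x‖ₑ * ‖v n x‖ₑ)
        + (‖(V - U) x‖ₑ * ‖w x‖ₑ ^ 2 + ‖(V - U) x‖ₑ * ‖v n x‖ₑ ^ 2)) := lintegral_mono fun x => by
        have e1 : ‖V x‖ₑ ≤ ENNReal.ofReal M + ‖(V - U) x‖ₑ := by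
          calc ‖V x‖ₑ = ‖U x + (V - U) x‖ₑ := by simp
            _ ≤ ‖U x‖ₑ + ‖(V - U) x‖ₑ := enorm_add_le _ _
            _ ≤ _ := by
              gcongr
              rw [← ofReal_norm]
              exact ENNReal.ofReal_le_ofReal (hUM x)
        have e2 := enorm_mul_enorm_le (w x) (v n x) one_pos
        simp only [inv_one, ENNReal.ofReal_one, one_mul] at e2
        calc _ ≤ (ENNReal.ofReal M + ‖(V - U) x‖ₑ) * (‖w x‖ₑ * ‖v n x‖ₑ) := by gcongr
          _ ≤ ENNReal.ofReal M * (‖w x‖ₑ * ‖v n x‖ₑ)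
            + ‖(V - U) x‖ₑ * (‖w x‖ₑ ^ 2 + ‖v n x‖ₑ ^ 2) := by rw [add_mul]; gcongr
          _ = _ := by ring
    _ = ENNReal.ofReal M * (∫⁻ x, ‖w x‖ₑ * ‖v n x‖ₑ) + ((∫⁻ x, ‖(V - U) x‖ₑ * ‖w x‖ₑ ^ 2)
        + ∫⁻ x, ‖(V - U) x‖ₑ * ‖v n x‖ₑ ^ 2) := by
        have m1 : AEMeasurable (fun x => ENNReal.ofReal M * (‖w x‖ₑ * ‖v n x‖ₑ)) volume :=
          (mw.mul mv).const_mul _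
        have m2 : AEMeasurable (fun x => ‖(V - U) x‖ₑ * ‖w x‖ₑ ^ 2) volume :=
          mU.mul (mw.pow_const 2)
        rw [lintegral_add_left' m1, lintegral_const_mul' _ _ ENNReal.ofReal_ne_top,
          lintegral_add_left' m2]
    _ ≤ ENNReal.ofReal (η / 2) + (ENNReal.ofReal (K * (η / 2 / D) * gradSq w)
        + ENNReal.ofReal (K * (η / 2 / D) * C)) := by
        gcongr
        · exact hfar w hw
        · refine (hfar _ (hv n)).trans (ENNReal.ofReal_le_ofReal ?_)
          have := hg n
          gcongr
    _ ≤ ENNReal.ofReal η := by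
        rw [← ENNReal.ofReal_add (by positivity) (by positivity),
          ← ENNReal.ofReal_add (by positivity) (by positivity)]
        refine ENNReal.ofReal_le_ofReal ?_
        have e : K * (η / 2 / D) * gradSq w + K * (η / 2 / D) * C = η / 2 / D * (D - 1) := by
          rw [hD]; ring
        have e2 : η / 2 / D * D = η / 2 := div_mul_cancel₀ _ hD0.ne'
        have e3 : 0 < η / 2 / D := by positivity
        rw [e, mul_sub, e2]; linarith

/-! ### Maximizing sequences -/

lemma weight_nonneg (γ e m : ℝ) : 0 ≤ weight γ e m := by unfold weight; positivity

/-- The weight scales under dilations exactly as `P` does. -/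
lemma weight_rescale (γ e m : ℝ) {r : ℝ} (hr : 0 < r) :
    weight γ ((r ^ d)⁻¹ * (r ^ 2 * e)) ((r ^ d)⁻¹ * m) =
      (r ^ d)⁻¹ * ((r ^ d)⁻¹ * (r ^ γ * weight γ e m)) := by
  have h1 : weight γ (r ^ 2) 1 = r ^ γ := by
    rw [weight, Real.sqrt_sq hr.le, Real.sqrt_one, Real.one_rpow, mul_one]
  have h2 : weight γ (r ^ 2 * e) (1 * m) = weight γ (r ^ 2) 1 * weight γ e m :=
    weight_mul γ (by positivity) zero_le_one
  rw [one_mul, h1] at h2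
  rw [weight_mul γ (by positivity) (by positivity), weight_self γ (by positivity), h2]
  ring

/-- The sharp inequality is invariant under rescaling of the potential. -/
lemma P_le_weight_rescale {γ S : ℝ} {V : E d → ℝ}
    (hle : ∀ u : E d → ℂ, MemH1 u → P γ u ≤ S * weight γ (energySq V u) (massSq u))
    {r : ℝ} (hr : 0 < r) (b : E d) {v : E d → ℂ} (hv : MemH1 v) :
    P γ v ≤ S * weight γ (energySq (rescale V r b) v) (massSq v) := by
  obtain ⟨u, hu, rfl⟩ := hv.exists_comp_affine_eq hr b
  rw [P_comp_affine γ u hr, energySq_rescale V hu hr, massSq_comp_affine u hr,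
    weight_rescale γ _ _ hr]
  have h1 : 0 < (r ^ d)⁻¹ := by positivity
  have h2 : 0 < r ^ γ := Real.rpow_pos_of_pos hr γ
  calc _ ≤ (r ^ d)⁻¹ * ((r ^ d)⁻¹ * (r ^ γ * (S * weight γ (energySq V u) (massSq u)))) := by
        have := hle u hu
        gcongr
    _ = _ := by ring

lemma gradSq_le_energySq_rescale {c : ℝ} {V : E d → ℝ}
    (hc : ∀ u : E d → ℂ, MemH1 u → c * gradSq u ≤ energySq V u)
    {r : ℝ} (hr : 0 < r) (b : E d) {v : E d → ℂ} (hv : MemH1 v) :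
    c * gradSq v ≤ energySq (rescale V r b) v := by
  obtain ⟨u, hu, rfl⟩ := hv.exists_comp_affine_eq hr b
  rw [energySq_rescale V hu hr, gradSq_comp_affine hu hr]
  calc _ = (r ^ d)⁻¹ * (r ^ 2 * (c * gradSq u)) := by ring
    _ ≤ _ := by have := hc u hu; gcongr

/-- If the rescaled potentials disappear along a maximizing sequence, the sequence cannot do
better than the free functional. -/
lemma le_of_escape {γ : ℝ} (hγ : IsExponent d γ) {V : ℕ → E d → ℝ} {B : NNReal} {c S S₀ κ R : ℝ}
    (hV : ∀ n, MemLp (V n) ((d : ℝ≥0∞) / 2) volume)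
    (hB : ∀ n u, MemH1 u → ∫⁻ x, ‖V n x‖ₑ * ‖u x‖ₑ ^ 2 ≤ B * ENNReal.ofReal (gradSq u))
    (hc : 0 < c) (hcoer : ∀ n u, MemH1 u → c * gradSq u ≤ energySq (V n) u)
    (hS : 0 < S) (hle : ∀ n u, MemH1 u → P γ u ≤ S * weight γ (energySq (V n) u) (massSq u))
    (hS₀ : 0 ≤ S₀) (hle₀ : ∀ u : E d → ℂ, MemH1 u → P γ u ≤ S₀ * weight γ (gradSq u) (massSq u))
    {v : ℕ → E d → ℂ} (hv : ∀ n, MemH1 (v n)) (hm : ∀ n, massSq (v n) = 1)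
    (he : ∀ n, energySq (V n) (v n) = 1) (hP : Tendsto (fun n => P γ (v n)) atTop (𝓝 S))
    (hκ : 0 < κ) (hloc : ∀ n, ENNReal.ofReal κ ≤ ∫⁻ x in Metric.ball 0 R, ‖v n x‖ₑ ^ 2)
    (hesc : ∀ u : E d → ℂ, MemH1 u →
      Tendsto (fun n => ∫⁻ x, ‖V n x‖ₑ * ‖u x‖ₑ ^ 2) atTop (𝓝 0)) : S ≤ S₀ := by
  have hgn : ∀ n, gradSq (v n) ≤ max 1 c⁻¹ := fun n => by
    refine le_trans ?_ (le_max_right _ _)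
    have := hcoer n _ (hv n)
    rw [he] at this
    rw [← one_div, le_div_iff₀ hc]; linarith
  obtain ⟨φ, w, C', hφ, hw, hm', hg', tm, tg, tP, -⟩ := exists_profile hγ hv
    (fun n => (hm n).le.trans (le_max_left 1 c⁻¹)) hgn hκ hloc
  by_contra! hlt
  have h0 := hγ.pos
  have h4 := hγ.lt_four
  set θ : ℝ := γ / 4 with hθ
  have hθ0 : 0 < θ := by positivity
  have hθ1 : 0 < 1 - θ := by rw [hθ]; linarith
  have hescφ : Tendsto (fun n => ∫⁻ x, ‖V (φ n) x‖ₑ * ‖w x‖ₑ ^ 2) atTop (𝓝 0) :=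
    (hesc w hw.1).comp hφ.tendsto_atTop
  have hvw : ∀ n, MemH1 (v (φ n) - w) := fun n => (hv _).sub hw.1
  have hcross := tendsto_cross_of_escape (V := fun n => V (φ n)) (v := fun n => v (φ n) - w)
    (fun n => (hV _).1) hw.1.1.1 (B := B * C')
    (fun n => by
      refine (hB _ _ (hvw n)).trans ?_
      rw [ENNReal.ofReal_mul B.coe_nonneg, ENNReal.ofReal_coe_nnreal]
      have := hg' n
      gcongr) hescφ
  have t1 := tendsto_integral_pot_sub hγ.dim (fun n => hV (φ n)) (fun n => hv (φ n)) hw.1 hcross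
  have t2 : Tendsto (fun n => ∫ x, V (φ n) x * ‖w x‖ ^ 2) atTop (𝓝 0) := by
    rw [tendsto_zero_iff_enorm_tendsto_zero]
    exact tendsto_of_tendsto_of_tendsto_of_le_of_le tendsto_const_nhds hescφ
      (fun _ => zero_le) fun n => enorm_integral_pot_le _ _
  have tE : Tendsto (fun n => energySq (V (φ n)) (v (φ n)) - energySq (V (φ n)) (v (φ n) - w))
      atTop (𝓝 (gradSq w)) := by
    have := tg.add (t1.add t2)
    rw [add_zero, add_zero] at this
    refine this.congr fun n => ?_
    rw [energySq, energySq]; ring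
  have hgw := gradSq_pos hγ.dim hw
  have hmw := massSq_pos hw
  have hEnn : ∀ n u, MemH1 u → 0 ≤ energySq (V n) u := fun n u hu =>
    (mul_nonneg hc.le (gradSq_nonneg u)).trans (hcoer n u hu)
  have core := profile_eq_of_split (p := fun n => P γ (v (φ n))) (p' := fun n => P γ (v (φ n) - w))
    (a := fun n => θ * energySq (V (φ n)) (v (φ n)) + (1 - θ) * massSq (v (φ n)))
    (a' := fun n => θ * energySq (V (φ n)) (v (φ n) - w) + (1 - θ) * massSq (v (φ n) - w))
    (t := θ * gradSq w + (1 - θ) * massSq w) (S' := S₀) hS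
    (hP.comp hφ.tendsto_atTop)
    (by
      simp only [he, hm, mul_one, add_sub_cancel]
      exact tendsto_const_nhds) tP
    (((tE.const_mul θ).add (tm.const_mul (1 - θ))).congr fun n => by ring) (by positivity)
    (fun n => (hle _ _ (hvw n)).trans (mul_le_mul_of_nonneg_left
      (weight_le h0.le h4.le (hEnn _ _ (hvw n)) (massSq_nonneg _)) hS.le))
    (fun n => add_nonneg (mul_nonneg hθ0.le (hEnn _ _ (hvw n)))
      (mul_nonneg hθ1.le (massSq_nonneg _)))
    ((hle₀ w hw.1).trans (mul_le_mul_of_nonneg_left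
      (weight_le h0.le h4.le hgw.le hmw.le) hS₀)) hlt.le
  exact absurd core.2.2 (not_le.2 hlt)

/-- A maximizing sequence of bounded scale and position converges to a maximizer. -/
lemma exists_maximizer_of_local {γ : ℝ} (hγ : IsExponent d γ) {V : E d → ℝ} {c e S κ R : ℝ}
    (hV : MemLp V ((d : ℝ≥0∞) / 2) volume)
    (hc : 0 < c) (hcoer : ∀ u, MemH1 u → c * gradSq u ≤ energySq V u)
    (hS : 0 < S) (hle : ∀ u, MemH1 u → P γ u ≤ S * weight γ (energySq V u) (massSq u))
    {v : ℕ → E d → ℂ} (hv : ∀ n, MemH1 (v n)) (hm : ∀ n, massSq (v n) = 1) (he0 : 0 < e)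
    (he : Tendsto (fun n => energySq V (v n)) atTop (𝓝 e))
    (hP : Tendsto (fun n => P γ (v n)) atTop (𝓝 (S * weight γ e 1)))
    (hκ : 0 < κ) (hloc : ∀ n, ENNReal.ofReal κ ≤ ∫⁻ x in Metric.ball 0 R, ‖v n x‖ₑ ^ 2) :
    ∃ w, NonzeroH1 w ∧ P γ w = S * weight γ (energySq V w) (massSq w) := by
  obtain ⟨B, hB⟩ := he.bddAbove_range
  have hgn : ∀ n, gradSq (v n) ≤ max 1 (B / c) := fun n => by
    refine le_trans ?_ (le_max_right _ _)
    rw [le_div_iff₀ hc]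
    have h1 : energySq V (v n) ≤ B := hB ⟨n, rfl⟩
    linarith [hcoer _ (hv n)]
  obtain ⟨φ, w, C', hφ, hw, hm', hg', tm, tg, tP, hl⟩ := exists_profile hγ hv
    (fun n => (hm n).le.trans (le_max_left 1 (B / c))) hgn hκ hloc
  refine ⟨w, hw, le_antisymm (hle w hw.1) ?_⟩
  have h0 := hγ.pos
  have h4 := hγ.lt_four
  set θ : ℝ := γ / 4 with hθ
  have hθ0 : 0 < θ := by positivity
  have hθ1 : 0 < 1 - θ := by rw [hθ]; linarith
  have hvw : ∀ n, MemH1 (v (φ n) - w) := fun n => (hv _).sub hw.1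
  have hcross := tendsto_cross_of_local hγ.dim hV hvw hw.1 hm' hg' hl
  have t1 := tendsto_integral_pot_sub hγ.dim (fun _ => hV) (fun n => hv (φ n)) hw.1 hcross
  have tE : Tendsto (fun n => energySq V (v (φ n)) - energySq V (v (φ n) - w))
      atTop (𝓝 (energySq V w)) := by
    have := tg.add (t1.add_const (∫ x, V x * ‖w x‖ ^ 2))
    rw [zero_add] at this
    refine this.congr fun n => ?_
    rw [energySq, energySq]; ring
  have hEnn : ∀ u, MemH1 u → 0 ≤ energySq V u := fun u hu =>
    (mul_nonneg hc.le (gradSq_nonneg u)).trans (hcoer u hu)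
  have hEw := hEnn w hw.1
  have hmw := massSq_pos hw
  have hwe := weight_pos γ he0 one_pos
  have hbd : ∀ u, MemH1 u → weight γ (energySq V u) (massSq u) ≤
      weight γ e 1 * (θ / e * energySq V u + (1 - θ) * massSq u) ^ 2 := fun u hu => by
    have h1 : weight γ (e * (energySq V u / e)) (1 * massSq u) =
      weight γ e 1 * weight γ (energySq V u / e) (massSq u) := weight_mul γ he0.le zero_le_one
    rw [mul_div_cancel₀ _ he0.ne', one_mul] at h1
    rw [h1]
    have h2 := weight_le h0.le h4.le (div_nonneg (hEnn u hu) he0.le) (massSq_nonneg u)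
    rw [← hθ, mul_div_assoc', mul_div_right_comm] at h2
    gcongr
  have hPbd : ∀ u, MemH1 u → P γ u ≤
      S * weight γ e 1 * (θ / e * energySq V u + (1 - θ) * massSq u) ^ 2 := fun u hu => by
    rw [mul_assoc]
    exact (hle u hu).trans (mul_le_mul_of_nonneg_left (hbd u hu) hS.le)
  have core := profile_eq_of_split (p := fun n => P γ (v (φ n))) (p' := fun n => P γ (v (φ n) - w))
    (a := fun n => θ / e * energySq V (v (φ n)) + (1 - θ) * massSq (v (φ n)))
    (a' := fun n => θ / e * energySq V (v (φ n) - w) + (1 - θ) * massSq (v (φ n) - w))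
    (t := θ / e * energySq V w + (1 - θ) * massSq w) (mul_pos hS hwe)
    (hP.comp hφ.tendsto_atTop)
    (by
      have := ((he.comp hφ.tendsto_atTop).const_mul (θ / e)).add_const (1 - θ)
      rw [div_mul_cancel₀ _ he0.ne', add_sub_cancel] at this
      refine this.congr fun n => ?_
      rw [hm, mul_one]; rfl) tP
    (((tE.const_mul (θ / e)).add (tm.const_mul (1 - θ))).congr fun n => by ring) (by positivity)
    (fun n => hPbd _ (hvw n))
    (fun n => add_nonneg (mul_nonneg (by positivity) (hEnn _ (hvw n)))
      (mul_nonneg hθ1.le (massSq_nonneg _)))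
    (hPbd w hw.1) le_rfl
  have h5 := hbd w hw.1
  rw [core.1, one_pow, mul_one] at h5
  rw [core.2.1]
  gcongr

/-! ### Existence of a maximizer -/

lemma energySq_smul (V : E d → ℝ) {u : E d → ℂ} (hu : MemH1 u) (c : ℂ) :
    energySq V (c • u) = ‖c‖ ^ 2 * energySq V u := by
  rw [energySq, energySq, gradSq_smul hu, mul_add, ← integral_const_mul]
  congr 2
  ext x
  rw [Pi.smul_apply, norm_smul]; ring

lemma W_smul (γ : ℝ) (V : E d → ℝ) {u : E d → ℂ} (hu : MemH1 u) {c : ℂ} (hc : c ≠ 0) :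
    W γ V (c • u) = W γ V u := by
  have h : 0 < ‖c‖ ^ 2 := by positivity
  rw [W_eq, W_eq, energySq_smul V hu, massSq_smul, P_smul, weight_mul γ h.le h.le, weight_self γ h,
    ← pow_mul]
  exact mul_div_mul_left _ _ (by positivity)

lemma exists_smul_massSq_eq_one {u : E d → ℂ} (hu : NonzeroH1 u) :
    ∃ c : ℂ, c ≠ 0 ∧ massSq (c • u) = 1 := by
  have hm := massSq_pos hu
  refine ⟨((√(massSq u))⁻¹ : ℝ), by exact_mod_cast (inv_pos.2 (Real.sqrt_pos.2 hm)).ne', ?_⟩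
  rw [massSq_smul, Complex.norm_real, Real.norm_eq_abs, sq_abs, inv_pow, Real.sq_sqrt hm.le,
    inv_mul_cancel₀ hm.ne']

/-- A free ground state, placed where the potential is negative on average, beats the free
functional. -/
lemma free_constant_lt {γ : ℝ} (hγ : IsExponent d γ) {V : E d → ℝ} {c S S₀ : ℝ}
    (hV : MemLp V ((d : ℝ≥0∞) / 2) volume) (hneg : ¬ negPart V =ᵐ[volume] 0)
    (hc : 0 < c) (hcoer : ∀ u, MemH1 u → c * gradSq u ≤ energySq V u)
    (hle : ∀ u, MemH1 u → P γ u ≤ S * weight γ (energySq V u) (massSq u)) (hS₀ : 0 < S₀)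
    {Q : E d → ℂ} (hQ : NonzeroH1 Q) (hP : P γ Q = S₀ * weight γ (gradSq Q) (massSq Q)) :
    S₀ < S := by
  obtain ⟨r, b, hr, hlt⟩ := exists_integral_pot_neg hγ.dim hV hneg hQ
  set u : E d → ℂ := fun x => Q (r • x + b) with hu
  have hun : NonzeroH1 u := hQ.comp_affine hr b
  have hPu : P γ u = S₀ * weight γ (gradSq u) (massSq u) := by
    rw [hu, P_comp_affine γ Q hr, gradSq_comp_affine hQ.1 hr, massSq_comp_affine Q hr,
      weight_rescale γ _ _ hr, hP]
    ring
  have hE : 0 < energySq V u :=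
    (mul_pos hc (gradSq_pos hγ.dim hun)).trans_le (hcoer u hun.1)
  have hEg : energySq V u < gradSq u := by rw [energySq]; linarith
  have hm := massSq_pos hun
  have h1 := weight_lt_weight hγ.pos hE.le hm hEg
  have h2 := weight_pos γ hE hm
  have h3 := hle u hun.1
  rw [hPu] at h3
  by_contra! h4
  have h5 := mul_lt_mul_of_pos_left h1 hS₀
  have h6 := mul_le_mul_of_nonneg_right h4 h2.le
  linarith

/-- Normalization in the scale: after rescaling, mass and energy are both one, the energy being
taken with respect to the rescaled potential. -/
lemma normalized_rescale {γ : ℝ} {V : E d → ℝ} {u : E d → ℂ} (hu : MemH1 u) (hm : massSq u = 1)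
    (he : 0 < energySq V u) {r : ℝ} (hr : 0 < r) (hr2 : r ^ 2 = (energySq V u)⁻¹) (b : E d) :
    MemH1 ((√(r ^ d) : ℂ) • fun x => u (r • x + b)) ∧
    massSq ((√(r ^ d) : ℂ) • fun x => u (r • x + b)) = 1 ∧
    energySq (rescale V r b) ((√(r ^ d) : ℂ) • fun x => u (r • x + b)) = 1 ∧
    P γ ((√(r ^ d) : ℂ) • fun x => u (r • x + b)) = W γ V u ∧
    ∀ R, ∫⁻ x in Metric.ball 0 R, ‖((√(r ^ d) : ℂ) • fun x => u (r • x + b)) x‖ₑ ^ 2 =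
      ∫⁻ x in Metric.ball b (r * R), ‖u x‖ₑ ^ 2 := by
  have hrd : 0 < r ^ d := by positivity
  have hs : ‖(√(r ^ d) : ℂ)‖ ^ 2 = r ^ d := by
    rw [Complex.norm_real, Real.norm_eq_abs, sq_abs, Real.sq_sqrt hrd.le]
  have hH := hu.comp_affine hr b
  have hw : r ^ γ * weight γ (energySq V u) 1 = 1 := by
    have h1 : weight γ (r ^ 2) 1 = r ^ γ := by
      rw [weight, Real.sqrt_sq hr.le, Real.sqrt_one, Real.one_rpow, mul_one]
    rw [← h1, ← weight_mul γ (by positivity) zero_le_one, hr2, inv_mul_cancel₀ he.ne', one_mul,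
      weight_self γ one_pos, one_pow]
  refine ⟨hH.const_smul _, ?_, ?_, ?_, fun R => ?_⟩
  · rw [massSq_smul, hs, massSq_comp_affine u hr, hm]; field_simp
  · rw [energySq_smul _ hH, hs, energySq_rescale V hu hr, hr2]; field_simp
  · have hw0 := weight_pos γ he one_pos
    rw [P_smul, P_comp_affine γ u hr, W_eq, hm, eq_div_iff hw0.ne',
      (by ring : ‖(√(r ^ d) : ℂ)‖ ^ 4 = (‖(√(r ^ d) : ℂ)‖ ^ 2) ^ 2), hs]
    calc _ = (r ^ d * (r ^ d)⁻¹) ^ 2 * P γ u * (r ^ γ * weight γ (energySq V u) 1) := by ring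
      _ = _ := by rw [hw, mul_inv_cancel₀ hrd.ne']; ring
  · have h1 : ∀ x, ‖((√(r ^ d) : ℂ) • fun x => u (r • x + b)) x‖ₑ ^ 2 =
        ENNReal.ofReal (r ^ d) * ‖u (r • x + b)‖ₑ ^ 2 := fun x => by
      have h2 : ENNReal.ofReal (r ^ d) = ‖(√(r ^ d) : ℂ)‖ₑ ^ 2 := by
        rw [← ofReal_norm, ← ENNReal.ofReal_pow (norm_nonneg _), hs]
      rw [Pi.smul_apply, enorm_smul, mul_pow, h2]
    simp only [h1]
    rw [lintegral_const_mul' _ _ ENNReal.ofReal_ne_top,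
      lintegral_ball_comp_affine (f := fun x => ‖u x‖ₑ ^ 2) hr, ← mul_assoc,
      ← ENNReal.ofReal_mul hrd.le, mul_inv_cancel₀ hrd.ne', ENNReal.ofReal_one, one_mul]

/-- If the sharp constant exceeds the free one, maximizing sequences neither spread out,
concentrate nor run away, and the supremum is attained. -/
lemma exists_maximizer_of_lt {γ : ℝ} (hγ : IsExponent d γ) {V : E d → ℝ} {c S S₀ : ℝ}
    (hV : MemLp V ((d : ℝ≥0∞) / 2) volume)
    (hc : 0 < c) (hcoer : ∀ u, MemH1 u → c * gradSq u ≤ energySq V u)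
    (hle : ∀ u, MemH1 u → P γ u ≤ S * weight γ (energySq V u) (massSq u)) (hS₀ : 0 < S₀)
    (hle₀ : ∀ u : E d → ℂ, MemH1 u → P γ u ≤ S₀ * weight γ (gradSq u) (massSq u)) (hlt : S₀ < S)
    {u : ℕ → E d → ℂ} (hu : ∀ n, NonzeroH1 (u n)) (hm : ∀ n, massSq (u n) = 1)
    (hW : Tendsto (fun n => W γ V (u n)) atTop (𝓝 S)) (hWS : ∀ n, S / 2 ≤ W γ V (u n)) :
    ∃ w, NonzeroH1 w ∧ P γ w = S * weight γ (energySq V w) (massSq w) := by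
  have hd := hγ.dim
  have hS : 0 < S := hS₀.trans hlt
  have he : ∀ n, 0 < energySq V (u n) := fun n =>
    (mul_pos hc (gradSq_pos hd (hu n))).trans_le (hcoer _ (hu n).1)
  set r : ℕ → ℝ := fun n => (√(energySq V (u n)))⁻¹ with hr
  have hr0 : ∀ n, 0 < r n := fun n => inv_pos.2 (Real.sqrt_pos.2 (he n))
  have hr2 : ∀ n, r n ^ 2 = (energySq V (u n))⁻¹ := fun n => by
    rw [hr, inv_pow, Real.sq_sqrt (he n).le]
  set f : ℕ → E d → E d → ℂ := fun n b => (√(r n ^ d) : ℂ) • fun x => u n (r n • x + b) with hf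
  have hN : ∀ n b, MemH1 (f n b) ∧ massSq (f n b) = 1 ∧ energySq (rescale V (r n) b) (f n b) = 1 ∧
      P γ (f n b) = W γ V (u n) ∧ ∀ R, ∫⁻ x in Metric.ball 0 R, ‖f n b x‖ₑ ^ 2 =
        ∫⁻ x in Metric.ball b (r n * R), ‖u n x‖ₑ ^ 2 := fun n b =>
    normalized_rescale (hu n).1 (hm n) (he n) (hr0 n) (hr2 n) b
  have hgf : ∀ n b, gradSq (f n b) ≤ max 1 c⁻¹ := fun n b => by
    refine le_trans ?_ (le_max_right _ _)
    have := gradSq_le_energySq_rescale hcoer (hr0 n) b (hN n b).1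
    rw [(hN n b).2.2.1] at this
    rw [← one_div, le_div_iff₀ hc]; linarith
  obtain ⟨R, κ, hR, hκ, hball⟩ := exists_ball_mass_ge hγ (half_pos hS)
    (zero_le_one.trans (le_max_left 1 c⁻¹))
  choose y hy using fun n => hball (f n 0) (hN n 0).1 (hgf n 0)
    ((hN n 0).2.1.le.trans (le_max_left 1 c⁻¹)) ((hWS n).trans (hN n 0).2.2.2.1.ge)
  set b : ℕ → E d := fun n => r n • y n with hb
  have hloc : ∀ n, ENNReal.ofReal κ ≤ ∫⁻ x in Metric.ball 0 R, ‖f n (b n) x‖ₑ ^ 2 := fun n => by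
    have h1 := lintegral_ball_comp_affine (f := fun x => ‖f n 0 x‖ₑ ^ 2) one_pos (y n) R
    rw [one_mul, one_pow, inv_one, ENNReal.ofReal_one, one_mul] at h1
    refine (hy n).trans (h1.ge.trans (le_of_eq ?_))
    refine lintegral_congr fun x => ?_
    simp only [hf, hb, Pi.smul_apply, one_smul, smul_add, add_zero]
  by_cases hcpt : ∃ K : ℝ, 1 ≤ K ∧ ∃ᶠ n in atTop, ¬ (r n < K⁻¹ ∨ K < r n ∨ K < ‖b n‖)
  · obtain ⟨K, hK1, hK⟩ := hcpt
    have hK0 : 0 < K := one_pos.trans_le hK1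
    obtain ⟨ψ, hψ, hψK⟩ := extraction_of_frequently_atTop hK
    simp only [not_or, not_lt] at hψK
    obtain ⟨a, ha, φ, hφ, hlim⟩ := isCompact_Icc.tendsto_subseq
      (x := fun n => r (ψ n)) (s := Set.Icc K⁻¹ K) fun n => ⟨(hψK n).1, (hψK n).2.1⟩
    have ha0 : 0 < a := (inv_pos.2 hK0).trans_le ha.1
    set χ : ℕ → ℕ := fun n => ψ (φ n) with hχ
    have hχt : Tendsto χ atTop atTop := hψ.tendsto_atTop.comp hφ.tendsto_atTop
    have hlim' : Tendsto (fun n => energySq V (u (χ n))) atTop (𝓝 ((a ^ 2)⁻¹)) := by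
      refine ((hlim.pow 2).inv₀ (by positivity)).congr fun n => ?_
      change (r (χ n) ^ 2)⁻¹ = _
      rw [hr2, inv_inv]
    refine exists_maximizer_of_local hγ hV hc hcoer hS hle (v := fun n => u (χ n))
      (fun n => (hu _).1) (fun n => hm _) (by positivity) hlim' ?_ hκ (R := K + K * R) fun n => ?_
    · have h1 := ((continuous_weight_left hγ.pos.le 1).tendsto _).comp hlim'
      refine ((hW.comp hχt).mul h1).congr fun n => ?_
      have hw0 := weight_pos γ (he (χ n)) one_pos
      simp only [Function.comp_apply]
      rw [W_eq, hm, div_mul_cancel₀ _ hw0.ne']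
    · have h1 := hloc (χ n)
      rw [(hN _ _).2.2.2.2] at h1
      refine h1.trans (lintegral_mono_set fun x hx => ?_)
      rw [Metric.mem_ball, dist_eq_norm] at hx
      rw [mem_ball_zero_iff]
      have h2 : ‖x‖ ≤ ‖x - b (χ n)‖ + ‖b (χ n)‖ := norm_le_norm_sub_add _ _
      have h3 : r (χ n) * R ≤ K * R := mul_le_mul_of_nonneg_right (hψK (φ n)).2.1 hR.le
      have h4 : ‖b (χ n)‖ ≤ K := (hψK (φ n)).2.2
      linarith
  · push Not at hcpt
    obtain ⟨C, hC⟩ := exists_rescale_le hd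
    refine absurd ?_ (not_le.2 hlt)
    have hVfin := hV.2.ne
    refine le_of_escape hγ (V := fun n => rescale V (r n) (b n))
      (B := C * (eLpNorm V ((d : ℝ≥0∞) / 2) volume).toNNReal)
      (fun n => memLp_rescale hV (hr0 n) _) (fun n u hu => ?_) hc
      (fun n u hu => gradSq_le_energySq_rescale hcoer (hr0 n) _ hu) hS
      (fun n u hu => P_le_weight_rescale hle (hr0 n) _ hu) hS₀.le hle₀
      (fun n => (hN n (b n)).1) (fun n => (hN n (b n)).2.1) (fun n => (hN n (b n)).2.2.1)
      (by simp only [(hN _ _).2.2.2.1]; exact hW) hκ hloc fun u hu => ?_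
    · rw [ENNReal.coe_mul, ENNReal.coe_toNNReal hVfin]
      exact hC V _ _ u hV.1 (hr0 n) hu
    · refine tendsto_zero_of_eventually_le_ofReal fun η hη => ?_
      obtain ⟨K, hK1, hK⟩ := exists_rescale_small hd hV hu hη
      have h1 := hcpt K hK1
      filter_upwards [h1] with n hn
      exact hK (r n) (b n) (hr0 n) (by tauto)

/-- A potential with a nontrivial negative part admits an optimizer of the sharp inequality
`P ≤ S √E_V^γ √m^{4-γ}`. -/
lemma exists_maximizer {γ : ℝ} (hγ : IsExponent d γ) {V : E d → ℝ} {c : ℝ}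
    (hV : MemLp V ((d : ℝ≥0∞) / 2) volume) (hneg : ¬ negPart V =ᵐ[volume] 0)
    (hc : 0 < c) (hcoer : ∀ u, MemH1 u → c * gradSq u ≤ energySq V u) :
    ∃ S : ℝ, 0 < S ∧ (∀ u, MemH1 u → P γ u ≤ S * weight γ (energySq V u) (massSq u)) ∧
      ∃ w, NonzeroH1 w ∧ P γ w = S * weight γ (energySq V w) (massSq w) := by
  have hd := hγ.dim
  obtain ⟨S₀, hS₀, hle₀, ⟨Q, hQ⟩, hgs⟩ := exists_free_constant hγ
  obtain ⟨hQn, hQP⟩ := hgs Q hQ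
  have hE : ∀ u, NonzeroH1 u → 0 < energySq V u := fun u hu =>
    (mul_pos hc (gradSq_pos hd hu)).trans_le (hcoer u hu.1)
  set T : Set ℝ := {p | ∃ u : E d → ℂ, NonzeroH1 u ∧ massSq u = 1 ∧ W γ V u = p} with hT
  have hbdd : BddAbove T := by
    refine ⟨S₀ * weight γ c⁻¹ 1, ?_⟩
    rintro p ⟨u, hu, -, rfl⟩
    rw [W_le_iff (hE u hu) hu, mul_assoc, ← weight_mul γ (by positivity) zero_le_one, one_mul]
    refine (hle₀ u hu.1).trans (mul_le_mul_of_nonneg_left (weight_le_weight hγ.pos.le ?_) hS₀.le)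
    rw [inv_mul_eq_div, le_div_iff₀ hc]
    linarith [hcoer u hu.1]
  have hmem : ∀ u, NonzeroH1 u → W γ V u ∈ T := fun u hu => by
    obtain ⟨k, hk, hk1⟩ := exists_smul_massSq_eq_one hu
    exact ⟨k • u, hu.const_smul hk, hk1, W_smul γ V hu.1 hk⟩
  set S := sSup T with hS
  have hle : ∀ u, MemH1 u → P γ u ≤ S * weight γ (energySq V u) (massSq u) := by
    have hWQ : 0 ≤ W γ V Q := div_nonneg (P_nonneg γ Q) (weight_nonneg γ _ _)
    have hS0 : 0 ≤ S := hWQ.trans (le_csSup hbdd (hmem Q hQn))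
    intro u hu
    by_cases h : NonzeroH1 u
    · exact (W_le_iff (hE u h) h).1 (le_csSup hbdd (hmem u h))
    · rw [P_eq_zero hγ hu h]
      exact mul_nonneg hS0 (weight_nonneg γ _ _)
  have hlt := free_constant_lt hγ hV hneg hc hcoer hle hS₀ hQn hQP
  have hSpos := hS₀.trans hlt
  refine ⟨S, hSpos, hle, ?_⟩
  obtain ⟨p, -, hp, hpT⟩ := exists_seq_tendsto_sSup ⟨_, hmem Q hQn⟩ hbdd
  obtain ⟨N, hN⟩ := eventually_atTop.1 (hp.eventually_const_le (half_lt_self hSpos))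
  have hp' : Tendsto (fun n => p (n + N)) atTop (𝓝 S) := (tendsto_add_atTop_iff_nat N).2 hp
  choose u hu hu1 huW using fun n => hpT (n + N)
  exact exists_maximizer_of_lt hγ hV hc hcoer hle hS₀ hle₀ hlt hu hu1
    (by simp only [huW]; exact hp') fun n => by rw [huW]; exact hN _ (Nat.le_add_left _ _)

/-! ### The Euler–Lagrange equation of a maximizer -/

/-- A suitable multiple of an optimizer solves the equation: by the inequality of arithmetic and
geometric means the sharp inequality implies `P ≤ k (E_V + a m)²` with equality at the same
optimizer. -/
lemma exists_solution_of_maximizer {γ : ℝ} (hγ : IsExponent d γ) {V : E d → ℝ} {c S : ℝ}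
    (hV : MemLp V ((d : ℝ≥0∞) / 2) volume)
    (hc : 0 < c) (hcoer : ∀ u, MemH1 u → c * gradSq u ≤ energySq V u) (hS : 0 < S)
    (hle : ∀ u, MemH1 u → P γ u ≤ S * weight γ (energySq V u) (massSq u))
    {w : E d → ℂ} (hw : NonzeroH1 w) (hwP : P γ w = S * weight γ (energySq V w) (massSq w)) :
    ∃ (Q : E d → ℂ) (q : ℝ), IsMaximizer γ V Q ∧ 0 < q ∧
      q ^ 2 = (4 - γ) * energySq V Q / (γ * massSq Q) ∧ IsWeakSolution γ V (q ^ 2) Q := by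
  have h0 := hγ.pos
  have h4 := hγ.lt_four
  have h4' : 0 < 4 - γ := by linarith
  have hE0 : ∀ u, NonzeroH1 u → 0 < energySq V u := fun u hu =>
    (mul_pos hc (gradSq_pos hγ.dim hu)).trans_le (hcoer u hu.1)
  have hEnn : ∀ u, MemH1 u → 0 ≤ energySq V u := fun u hu =>
    (mul_nonneg hc.le (gradSq_nonneg u)).trans (hcoer u hu)
  have hE := hE0 w hw
  have hM := massSq_pos hw
  set e := energySq V w with he
  set m := massSq w with hm
  set a : ℝ := (4 - γ) * e / (γ * m) with ha
  have ha0 : 0 < a := by positivity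
  have hwt := weight_pos γ hE hM
  set k : ℝ := S * weight γ e m * (γ / (4 * e)) ^ 2 with hk
  have hk0 : 0 < k := by positivity
  have hsum : e + a * m = 4 * e / γ := by rw [ha]; field_simp; ring
  have hbd : ∀ u, MemH1 u → P γ u ≤ k * (energySq V u + a * massSq u) ^ 2 := fun u hu => by
    have h1 : weight γ (e * (energySq V u / e)) (m * (massSq u / m)) =
      weight γ e m * weight γ (energySq V u / e) (massSq u / m) := weight_mul γ hE.le hM.le
    rw [mul_div_cancel₀ _ hE.ne', mul_div_cancel₀ _ hM.ne'] at h1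
    have h2 := weight_le h0.le h4.le (div_nonneg (hEnn u hu) hE.le)
      (div_nonneg (massSq_nonneg u) hM.le)
    have h3 : γ / 4 * (energySq V u / e) + (1 - γ / 4) * (massSq u / m) =
        γ / (4 * e) * (energySq V u + a * massSq u) := by rw [ha]; field_simp
    rw [h3, mul_pow] at h2
    calc P γ u ≤ S * weight γ (energySq V u) (massSq u) := hle u hu
      _ ≤ S * (weight γ e m * ((γ / (4 * e)) ^ 2 * (energySq V u + a * massSq u) ^ 2)) := by
        rw [h1]; gcongr
      _ = _ := by rw [hk]; ring
  -- the amplitude making the Lagrange multiplier equal to one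
  set t : ℝ := √(γ / (4 * e * k)) with ht
  have ht0 : 0 < t := by positivity
  have ht2 : t ^ 2 = γ / (4 * e * k) := Real.sq_sqrt (by positivity)
  have htn : ‖(t : ℂ)‖ = t := by simp [abs_of_pos ht0]
  have htc : (t : ℂ) ≠ 0 := by exact_mod_cast ht0.ne'
  set Q : E d → ℂ := (t : ℂ) • w with hQ
  have hQn : NonzeroH1 Q := hw.const_smul htc
  have hQe : energySq V Q = t ^ 2 * e := by rw [hQ, energySq_smul V hw.1, htn]
  have hQm : massSq Q = t ^ 2 * m := by rw [hQ, massSq_smul, htn]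
  have hQs : energySq V Q + a * massSq Q = k⁻¹ := by
    rw [hQe, hQm, (by ring : t ^ 2 * e + a * (t ^ 2 * m) = t ^ 2 * (e + a * m)), hsum, ht2]
    field_simp
  have hQP : P γ Q = k⁻¹ := by
    rw [hQ, P_smul, htn, hwP, (by ring : t ^ 4 = (t ^ 2) ^ 2), ht2]
    have : S * weight γ e m = k * (4 * e / γ) ^ 2 := by rw [hk]; field_simp
    rw [this]; field_simp
  have hsq : √a ^ 2 = a := Real.sq_sqrt ha0.le
  refine ⟨Q, √a, ⟨hQn, fun v hv => ?_⟩, Real.sqrt_pos.2 ha0, ?_, ?_⟩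
  · have h1 : W γ V Q = S := by
      rw [hQ, W_smul γ V hw.1 htc, W_eq, hwP, mul_div_cancel_right₀ _ hwt.ne']
    rw [h1, W_le_iff (hE0 v hv) hv]
    exact hle v hv.1
  · rw [hsq, hQe, hQm, ha]; field_simp
  · rw [hsq]
    refine isWeakSolution_of_forall_P_le hγ hV hQn.1 hbd ?_ ?_
    · rw [hQs, hQP]; field_simp
    · rw [hQs, mul_inv_cancel₀ hk0.ne']

end Hartree

end

theorem mainTheorem2 (d : ℕ) (γ : ℝ) (hd : 3 ≤ d) (hγ : 2 < γ) (hγ' : γ < min 4 (d : ℝ))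
    (V : Hartree.E d → ℝ) (hV : Hartree.IsAdmissible V) :
    (Hartree.negPart V =ᵐ[volume] 0 →
      (∃ Q : Hartree.E d → ℂ, Hartree.IsFreeGroundState γ Q) ∧
      ∀ Q : Hartree.E d → ℂ, Hartree.IsFreeGroundState γ Q →
        ∀ z : ℕ → Hartree.E d, Tendsto (fun n => ‖z n‖) atTop atTop →
          Hartree.IsMaximizingSeq γ V (fun n x => Q (x - z n))) ∧
    (¬ Hartree.negPart V =ᵐ[volume] 0 →
      ∃ (Q : Hartree.E d → ℂ) (w : ℝ),
        Hartree.IsMaximizer γ V Q ∧ 0 < w ∧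
        w ^ 2 = (4 - γ) * Hartree.energySq V Q / (γ * Hartree.massSq Q) ∧
        Hartree.IsWeakSolution γ V (w ^ 2) Q) := by
  have hexp : Hartree.IsExponent d γ := ⟨hd, hγ, hγ'⟩
  have hVp := hV.2.1
  refine ⟨fun hneg => ?_, fun hneg => ?_⟩
  · obtain ⟨S, hS, hle, hex, hgs⟩ := Hartree.exists_free_constant hexp
    refine ⟨hex, fun Q hQ z hz => ?_⟩
    obtain ⟨hQn, hQP⟩ := hgs Q hQ
    exact Hartree.isMaximizingSeq_translate hexp hVp hneg hS.le hle hQn hQP hz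
  · obtain ⟨c, hc, hcoer⟩ := hV.exists_coercive hd
    obtain ⟨S, hS, hle, w, hw, hwP⟩ := Hartree.exists_maximizer hexp hVp hneg hc hcoer
    exact Hartree.exists_solution_of_maximizer hexp hVp hc hcoer hS hle hw hwP
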